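/- Let $M$ be a compact oriented hyperbolic 3-manifold with smooth boundary $\partial M$ (metric $\langle\,,\rangle$ of constant curvature $-1$, Levi-Civita connection $\nabla$, cross product $\times$ given by metric and orientation). Let $E$ be the flat bundle of germs of infinitesimal isometries of $M$ (the germ of an infinitesimal isometry being parallel), with exterior derivative $d_E$. Identify $E$ with $TM\otimes\mathbb C$: the germ at $p$ of an infinitesimal isometry $K$ corresponds to $K(p)+i\,w$, where $w\in T_pM$ is determined by $\nabla_XK=w\times X$ for all $X\in T_pM$. Let $s=u+i\tilde u$ be a smooth section of $E$ and write $d_Es=\eta_c+i\,\tilde\eta_c$, where $\eta_c,\tilde\eta_c$ are $TM$-valued 1-forms. Let $n$ be the inward unit normal along $\partial M$, orient $\partial M$ by $n$, so that $JX=n\times X$ is the rotation by $\pi/2$ on $T(\partial M)$, and let $d$, $*$, $\delta=-{*}d{*}$, $\Delta=d\delta+\delta d$ be the exterior derivative, Hodge star, codifferential and Laplacian on forms of the surface $\partial M$ (on 1-forms $(*\alpha)(X)=-\alpha(JX)$). Let $\langle\alpha,\beta\rangle=\int_{\partial M}\alpha\wedge*\beta$ be the $L^2$ inner product. Let $S(X)=\nabla_Xn$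 be the shape operator, acting on 1-forms by $(S\alpha)(X)=\alpha(SX)$, let $H=\operatorname{tr}S$, and let $K$ be the Gaussian curvature of the induced metric on $\partial M$. On $\partial M$ decompose $u=v+hn$, $\tilde u=\tilde v+\tilde hn$ with $v,\tilde v$ tangent to $\partial M$, and let $\sigma,\tilde\sigma$ be the 1-forms on $\partial M$ dual to $v,\tilde v$. Put $$b=\int_{\partial M}\eta_c\wedge\tilde\eta_c,\qquad (\eta_c\wedge\tilde\eta_c)(X,Y)=\langle\eta_c(X),\tilde\eta_c(Y)\rangle-\langle\eta_c(Y),\tilde\eta_c(X)\rangle .$$ (1) One has $$b=2\big(\langle h,\delta\sigma\rangle+\langle\tilde h,\delta\tilde\sigma\rangle\big)-\langle S\sigma+*\tilde\sigma,\ *S\tilde\sigma+\sigma\rangle-\big(\langle Hh,h\rangle+\langle H\tilde h,\tilde h\rangle\big)+\langle K\sigma,*\tilde\sigma\rangle .$$ (2) Let $A$ be an operator on 1-forms on $\partial M$ (for instance a linear differential operator) and put $\hat S=-{*}S{*}$. If $2\tilde h=*d\sigma$, $2h=-{*}d\tilde\sigma$ and $\tilde\sigma=*A\sigma$ on $\partial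 M$, then $$b=\langle(A-S)\sigma,(I-\hat SA)\sigma\rangle+\langle A\sigma,(\Delta-K)\sigma\rangle-\tfrac14\big(\langle H\,\delta A\sigma,\delta A\sigma\rangle+\langle H\,d\sigma,d\sigma\rangle\big).$$ -/

import Mathlib

set_option maxSynthPendingDepth 3

open Set MeasureTheory
open scoped Manifold ContDiff Topology

noncomputable section

namespace HypBdry

/-! ### Riemannian geometry in charts -/

section Riemannian

variable {E : Type*} [NormedAddCommGroup E] [NormedSpace ℝ E]
  {H : Type*} [TopologicalSpace H] {I : ModelWithCorners ℝ E H}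
  {M : Type*} [TopologicalSpace M] [ChartedSpace H M]

variable (I M) in
/-- (Not necessarily smooth) vector fields on `M`. -/
abbrev VField := Π x : M, TangentSpace I x

variable (I M) in
/-- Fields of bilinear forms on the tangent spaces; used for Riemannian metrics. -/
abbrev MetricField := Π x : M, TangentSpace I x →L[ℝ] TangentSpace I x →L[ℝ] ℝ

/-- Smoothness of a vector field on a set. -/
def SmoothFieldOn [IsManifold I 1 M] (Y : VField I M) (U : Set M) : Prop :=
  ContMDiffOn I I.tangent ∞ (fun x => (⟨x, Y x⟩ : TangentBundle I M)) U

/-- Differential of the inverse of the preferred chart at `x`, at the point `y` of the image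
of that chart: it sends the standard basis to the coordinate vector fields. -/
def coordFrame (I : ModelWithCorners ℝ E H) (x : M) (y : E) :
    E →L[ℝ] TangentSpace I ((extChartAt I x).symm y) :=
  mfderivWithin 𝓘(ℝ, E) I (extChartAt I x).symm (range I) y

/-- The metric `g` in the coordinates of the preferred chart at `x`: the matrix `g_ij(y)`,
as a bilinear form on `E`. -/
def coordMetric (g : MetricField I M) (x : M) (y : E) : E →L[ℝ] E →L[ℝ] ℝ :=
  (ContinuousLinearMap.precomp ℝ (coordFrame I x y)) ∘L
    (g ((extChartAt I x).symm y)) ∘L (coordFrame I x y)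

/-- Christoffel symbols of the first kind in the preferred chart at `x`:
`(a, b, c) ↦ (∂_a g(b, c) + ∂_b g(a, c) - ∂_c g(a, b)) / 2`. -/
def christoffelFst (g : MetricField I M) (x : M) (y : E) : E →L[ℝ] E →L[ℝ] E →L[ℝ] ℝ :=
  let Dg : E →L[ℝ] E →L[ℝ] E →L[ℝ] ℝ := fderivWithin ℝ (coordMetric g x) (range I) y
  let Dg' : E →L[ℝ] E →L[ℝ] E →L[ℝ] ℝ :=
    (ContinuousLinearMap.flipₗᵢ ℝ E E ℝ).toContinuousLinearEquiv.toContinuousLinearMap ∘L Dg.flip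
  (1 / 2 : ℝ) • (Dg + Dg.flip - Dg')

/-- Christoffel symbols `Γ(a, b) = Γ^k_ij a^i b^j ∂_k` in the preferred chart at `x`. -/
def christoffel (g : MetricField I M) (x : M) (y : E) : E →L[ℝ] E →L[ℝ] E :=
  (ContinuousLinearMap.compL ℝ E (E →L[ℝ] ℝ) E (coordMetric g x y).inverse) ∘L
    christoffelFst g x y

/-- The Levi-Civita covariant derivative `a ↦ (∇_a Y)(x)`, that is
`(∇_a Y)^k = a^i ∂_i Y^k + Γ^k_ij a^i Y^j`, computed in the preferred chart at `x`
(whose differential at `x` is the identity of `TangentSpace I x = E`). -/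
def covDeriv (g : MetricField I M) (Y : VField I M) (x : M) :
    TangentSpace I x →L[ℝ] TangentSpace I x :=
  let dY : E →L[ℝ] E := fderivWithin ℝ
    (fun y => (VectorField.mpullbackWithin 𝓘(ℝ, E) I (extChartAt I x).symm Y (range I) y : E))
    (range I) (extChartAt I x x)
  let Γ : E →L[ℝ] E →L[ℝ] E := christoffel g x (extChartAt I x x)
  (dY + Γ.flip (Y x) : E →L[ℝ] E)

/-- The Riemann curvature `R(a, b) c = (∇_a ∇_b - ∇_b ∇_a - ∇_[a, b]) c` at `x`. -/
def curvature (g : MetricField I M) (x : M) (a b c : TangentSpace I x) : TangentSpace I x :=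
  let Γ : E → E →L[ℝ] E →L[ℝ] E := christoffel g x
  let x₀ : E := extChartAt I x x
  (fderivWithin ℝ (fun y => Γ y b c) (range I) x₀ a - fderivWithin ℝ (fun y => Γ y a c) (range I) x₀ b
    + Γ x₀ a (Γ x₀ b c) - Γ x₀ b (Γ x₀ a c) : E)

/-- The metric is hyperbolic: all sectional curvatures are equal to `-1`. -/
def IsHyperbolic (g : MetricField I M) : Prop :=
  ∀ (x : M) (a b c : TangentSpace I x), curvature g x a b c = g x a c • b - g x b c • a

end Riemannian

/-! ### Oriented hyperbolic 3-manifolds with boundary and the bundle `E` -/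

section ThreeManifold

variable {M : Type*} [TopologicalSpace M] [ChartedSpace (EuclideanHalfSpace 3) M]
  [IsManifold (𝓡∂ 3) ∞ M]

/-- An orientation of a Riemannian 3-manifold, given by its smooth unit volume form. -/
structure IsVolumeForm (g : MetricField (𝓡∂ 3) M)
    (vol : Π x : M, TangentSpace (𝓡∂ 3) x →L[ℝ] TangentSpace (𝓡∂ 3) x →L[ℝ]
      TangentSpace (𝓡∂ 3) x →L[ℝ] ℝ) : Prop where
  alt_left : ∀ x a b, vol x a a b = 0
  alt_right : ∀ x a b, vol x a b b = 0
  unit : ∀ x a b c, g x a a = 1 → g x b b = 1 → g x c c = 1 →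
    g x a b = 0 → g x a c = 0 → g x b c = 0 → |vol x a b c| = 1
  smooth : ∀ X Y Z : VField (𝓡∂ 3) M, SmoothFieldOn X univ → SmoothFieldOn Y univ →
    SmoothFieldOn Z univ → ContMDiff (𝓡∂ 3) 𝓘(ℝ, ℝ) ∞ (fun x => vol x (X x) (Y x) (Z x))

/-- The cross product `b ↦ a × b`, given by `g (a × b, c) = vol (a, b, c)`. In other words this is
the infinitesimal rotation `rot_a`. -/
def cross (g : MetricField (𝓡∂ 3) M)
    (vol : Π x : M, TangentSpace (𝓡∂ 3) x →L[ℝ] TangentSpace (𝓡∂ 3) x →L[ℝ]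
      TangentSpace (𝓡∂ 3) x →L[ℝ] ℝ) (x : M) (a : TangentSpace (𝓡∂ 3) x) :
    TangentSpace (𝓡∂ 3) x →L[ℝ] TangentSpace (𝓡∂ 3) x :=
  (g x).inverse ∘L (vol x a)

/-- `K` is an infinitesimal isometry (a Killing field) on the set `U`. -/
structure IsKillingOn (g : MetricField (𝓡∂ 3) M) (U : Set M) (K : VField (𝓡∂ 3) M) : Prop where
  smooth : SmoothFieldOn K U
  skew : ∀ x ∈ U, ∀ a b : TangentSpace (𝓡∂ 3) x,
    g x (covDeriv g K x a) b + g x a (covDeriv g K x b) = 0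

/-- `W` is the infinitesimal rotation part of the infinitesimal isometry `K` on `U`:
`∇_a K = W × a`. (Equivalently, `W` is one half of the curl of `K`.) -/
def IsRotationPart (g : MetricField (𝓡∂ 3) M)
    (vol : Π x : M, TangentSpace (𝓡∂ 3) x →L[ℝ] TangentSpace (𝓡∂ 3) x →L[ℝ]
      TangentSpace (𝓡∂ 3) x →L[ℝ] ℝ) (U : Set M) (K W : VField (𝓡∂ 3) M) : Prop :=
  ∀ x ∈ U, ∀ a : TangentSpace (𝓡∂ 3) x, covDeriv g K x a = cross g vol x (W x) a

/-- `η + i η'` is the image `d_E s` of the smooth section `s = u + i u'` of the flat bundle `E` of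
germs of infinitesimal isometries. The germ at `q` of an infinitesimal isometry `K` with
rotation part `W` is identified with `K q + i W q`, which identifies `E` with the complexified
tangent bundle. The sections of `E` over an open set `U` coming from an infinitesimal isometry on
`U` are parallel; a smooth section is locally a combination `s = ∑ f_j K_j` of such parallel
sections with smooth coefficients, and then `d_E s = ∑ df_j ⊗ K_j`. -/
def IsCoboundary (g : MetricField (𝓡∂ 3) M)
    (vol : Π x : M, TangentSpace (𝓡∂ 3) x →L[ℝ] TangentSpace (𝓡∂ 3) x →L[ℝ]
      TangentSpace (𝓡∂ 3) x →L[ℝ] ℝ) (u u' : VField (𝓡∂ 3) M)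
    (η η' : Π x : M, TangentSpace (𝓡∂ 3) x →L[ℝ] TangentSpace (𝓡∂ 3) x) : Prop :=
  ∀ p : M, ∃ U : Set M, IsOpen U ∧ p ∈ U ∧
    ∃ (m : ℕ) (K W : Fin m → VField (𝓡∂ 3) M) (f : Fin m → M → ℝ),
      (∀ j, IsKillingOn g U (K j)) ∧ (∀ j, IsRotationPart g vol U (K j) (W j)) ∧
      (∀ j, ContMDiffOn (𝓡∂ 3) 𝓘(ℝ, ℝ) ∞ (f j) U) ∧
      (∀ q ∈ U, u q = ∑ j, f j q • K j q ∧ u' q = ∑ j, f j q • W j q) ∧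
      (∀ a : TangentSpace (𝓡∂ 3) p,
        η p a = ∑ j, mvfderiv (𝓡∂ 3) (f j) p a • K j p ∧
        η' p a = ∑ j, mvfderiv (𝓡∂ 3) (f j) p a • W j p)

end ThreeManifold

/-! ### Exterior calculus on an oriented Riemannian surface

The surface carries a metric `gB` and the rotation `J` by `π / 2`, which records
the orientation: the area form is `dA (a, b) = gB (J a, b)`. -/

section Surface

variable {B : Type*} [TopologicalSpace B] [ChartedSpace (EuclideanSpace ℝ (Fin 2)) B]

variable (B) in
/-- 1-forms on the surface. -/
abbrev OneForm := Π x : B, TangentSpace (𝓡 2) x →L[ℝ] ℝ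

variable (B) in
/-- 2-forms on the surface. -/
abbrev TwoForm := Π x : B, TangentSpace (𝓡 2) x → TangentSpace (𝓡 2) x → ℝ

variable (B) in
/-- Fields of endomorphisms of the tangent spaces. -/
abbrev EndField := Π x : B, TangentSpace (𝓡 2) x →L[ℝ] TangentSpace (𝓡 2) x

/-- The `i`-th coordinate vector at `x` of the preferred chart at `x`. -/
def coordVec (x : B) (i : Fin 2) : TangentSpace (𝓡 2) x :=
  (EuclideanSpace.single i (1 : ℝ) : EuclideanSpace ℝ (Fin 2))

/-- The area form. -/
def areaForm (gB : MetricField (𝓡 2) B) (J : EndField B) : TwoForm B := fun x a b => gB x (J x a) b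

/-- Hodge star of a function, `*f = f dA`. -/
def star0 (gB : MetricField (𝓡 2) B) (J : EndField B) (f : B → ℝ) : TwoForm B :=
  fun x a b => f x * areaForm gB J x a b

/-- Hodge star of a 1-form, `(*α)(X) = - α (J X)`: if `α` is dual to `v`, then `*α` is
dual to `J v`. -/
def star1 (J : EndField B) (α : OneForm B) : OneForm B := fun x => -(α x ∘L J x)

/-- Hodge star of a 2-form: the function `*θ` with `θ = (*θ) dA`. -/
def star2 (gB : MetricField (𝓡 2) B) (J : EndField B) (θ : TwoForm B) : B → ℝ := fun x =>
  θ x (coordVec x 0) (coordVec x 1) / areaForm gB J x (coordVec x 0) (coordVec x 1)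

/-- Differential of a function. -/
def d0 (f : B → ℝ) : OneForm B := fun x => mvfderiv (𝓡 2) f x

/-- Exterior derivative of a 1-form, `(dα)_ij = ∂_i α_j - ∂_j α_i` in the preferred chart. -/
def d1 (α : OneForm B) : TwoForm B := fun x a b =>
  let Dα : EuclideanSpace ℝ (Fin 2) →L[ℝ] EuclideanSpace ℝ (Fin 2) →L[ℝ] ℝ :=
    fderiv ℝ (fun y => α ((extChartAt (𝓡 2) x).symm y) ∘L coordFrame (𝓡 2) x y)
      (extChartAt (𝓡 2) x x)
  Dα a b - Dα b a

/-- Codifferential `δ = - * d *` on 1-forms. -/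
def delta1 (gB : MetricField (𝓡 2) B) (J : EndField B) (α : OneForm B) : B → ℝ :=
  fun x => -star2 gB J (d1 (star1 J α)) x

/-- Codifferential `δ = - * d *` on 2-forms. -/
def delta2 (gB : MetricField (𝓡 2) B) (J : EndField B) (θ : TwoForm B) : OneForm B :=
  fun x => -star1 J (d0 (star2 gB J θ)) x

/-- The Laplacian `Δ = d δ + δ d` on 1-forms. -/
def laplacian (gB : MetricField (𝓡 2) B) (J : EndField B) (α : OneForm B) : OneForm B :=
  fun x => d0 (delta1 gB J α) x + delta2 gB J (d1 α) x

/-- Wedge product of 1-forms. -/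
def wedge (α β : OneForm B) : TwoForm B := fun x a b => α x a * β x b - α x b * β x a

/-- The action of an endomorphism field on 1-forms, `(S α)(X) = α (S X)`. -/
def actOn (S : EndField B) (α : OneForm B) : OneForm B := fun x => α x ∘L S x

/-- Gaussian curvature of the metric, `K = ⟨R(e₀, e₁) e₁, e₀⟩ / |e₀ ∧ e₁|²`. -/
def gaussCurvature (gB : MetricField (𝓡 2) B) (x : B) : ℝ :=
  let e : Fin 2 → TangentSpace (𝓡 2) x := coordVec x
  gB x (curvature gB x (e 0) (e 1) (e 1)) (e 0) /
    (gB x (e 0) (e 0) * gB x (e 1) (e 1) - gB x (e 0) (e 1) ^ 2)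

/-- The area measure in the preferred chart at `x`: `sqrt (det g_ij) dy` on the image of the chart,
transported to the surface. -/
def chartArea [MeasurableSpace B] (gB : MetricField (𝓡 2) B) (x : B) : Measure B :=
  ((volume.restrict (extChartAt (𝓡 2) x).target).withDensity (fun y =>
    ENNReal.ofReal (Real.sqrt (Matrix.det (Matrix.of fun i j : Fin 2 =>
      coordMetric gB x y (EuclideanSpace.single i 1) (EuclideanSpace.single j 1)))))).map
    (extChartAt (𝓡 2) x).symm

/-- The Riemannian area measure. The measures `chartArea gB x` are its restrictions
to the chart domains, which cover the surface, so it is their supremum. -/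
def area [MeasurableSpace B] (gB : MetricField (𝓡 2) B) : Measure B := ⨆ x : B, chartArea gB x

/-- Integral of a 2-form over the oriented surface. -/
def integral2 [MeasurableSpace B] (gB : MetricField (𝓡 2) B) (J : EndField B) (θ : TwoForm B) : ℝ :=
  ∫ x, star2 gB J θ x ∂(area gB)

/-- `L²` inner product `∫ f ∧ *k` of functions. -/
def inner0 [MeasurableSpace B] (gB : MetricField (𝓡 2) B) (J : EndField B) (f k : B → ℝ) : ℝ :=
  integral2 gB J (fun x a b => f x * star0 gB J k x a b)

/-- `L²` inner product `∫ α ∧ *β` of 1-forms. -/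
def inner1 [MeasurableSpace B] (gB : MetricField (𝓡 2) B) (J : EndField B) (α β : OneForm B) : ℝ :=
  integral2 gB J (wedge α (star1 J β))

/-- `L²` inner product `∫ θ ∧ *τ` of 2-forms. -/
def inner2 [MeasurableSpace B] (gB : MetricField (𝓡 2) B) (J : EndField B) (θ τ : TwoForm B) : ℝ :=
  integral2 gB J (fun x a b => star2 gB J τ x * θ x a b)

end Surface

/-! ### The boundary surface -/

section Boundary

variable {M : Type*} [TopologicalSpace M] [ChartedSpace (EuclideanHalfSpace 3) M]
  [IsManifold (𝓡∂ 3) ∞ M]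
  {B : Type*} [TopologicalSpace B] [ChartedSpace (EuclideanSpace ℝ (Fin 2)) B]

/-- The smooth surface `B`, through the smooth embedding `ι`, is the boundary of `M`. -/
structure IsBoundaryInclusion (ι : B → M) : Prop where
  smooth : ContMDiff (𝓡 2) (𝓡∂ 3) ∞ ι
  isEmbedding : Topology.IsEmbedding ι
  immersion : ∀ x : B, Function.Injective (mfderiv (𝓡 2) (𝓡∂ 3) ι x)
  range_eq : range ι = (𝓡∂ 3).boundary M

/-- Differential of the inclusion of the boundary. -/
def dincl (ι : B → M) (x : B) : TangentSpace (𝓡 2) x →L[ℝ] TangentSpace (𝓡∂ 3) (ι x) :=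
  mfderiv (𝓡 2) (𝓡∂ 3) ι x

/-- The metric induced on the boundary. -/
def inducedMetric (g : MetricField (𝓡∂ 3) M) (ι : B → M) : MetricField (𝓡 2) B := fun x =>
  (ContinuousLinearMap.precomp ℝ (dincl ι x)) ∘L (g (ι x)) ∘L (dincl ι x)

/-- Orthogonal projection of the tangent space of `M` at a boundary point to the
tangent space of the boundary. -/
def tangProj (g : MetricField (𝓡∂ 3) M) (ι : B → M) (x : B) :
    TangentSpace (𝓡∂ 3) (ι x) →L[ℝ] TangentSpace (𝓡 2) x :=
  (inducedMetric g ι x).inverse ∘L (ContinuousLinearMap.precomp ℝ (dincl ι x)) ∘L (g (ι x))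

/-- The first coordinate of a tangent vector in the preferred boundary chart; at a boundary point
it is positive exactly for the vectors that point into the manifold. -/
def inwardCoord (p : M) (w : TangentSpace (𝓡∂ 3) p) : ℝ :=
  (show EuclideanSpace ℝ (Fin 3) from w) 0

/-- Along the boundary the vector field `n` is the inward unit normal (and `n` is
smooth near the boundary). -/
structure IsInwardUnitNormal (g : MetricField (𝓡∂ 3) M) (ι : B → M) (n : VField (𝓡∂ 3) M) :
    Prop where
  smooth : ∃ U : Set M, IsOpen U ∧ range ι ⊆ U ∧ SmoothFieldOn n U
  unit : ∀ x : B, g (ι x) (n (ι x)) (n (ι x)) = 1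
  normal : ∀ (x : B) (a : TangentSpace (𝓡 2) x), g (ι x) (n (ι x)) (dincl ι x a) = 0
  inward : ∀ x : B, 0 < inwardCoord (ι x) (n (ι x))

/-- Rotation by `π / 2` on the boundary oriented by the normal `n`: `J X = n × X`. -/
def rotJ (g : MetricField (𝓡∂ 3) M)
    (vol : Π x : M, TangentSpace (𝓡∂ 3) x →L[ℝ] TangentSpace (𝓡∂ 3) x →L[ℝ]
      TangentSpace (𝓡∂ 3) x →L[ℝ] ℝ) (ι : B → M) (n : VField (𝓡∂ 3) M) : EndField B :=
  fun x => tangProj g ι x ∘L cross g vol (ι x) (n (ι x)) ∘L dincl ι x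

/-- The shape operator `S X = ∇_X n` of the boundary. -/
def shapeOp (g : MetricField (𝓡∂ 3) M) (ι : B → M) (n : VField (𝓡∂ 3) M) : EndField B :=
  fun x => tangProj g ι x ∘L covDeriv g n (ι x) ∘L dincl ι x

/-- The mean curvature `H = tr S`. -/
def meanCurvature (g : MetricField (𝓡∂ 3) M) (ι : B → M) (n : VField (𝓡∂ 3) M) (x : B) : ℝ :=
  LinearMap.trace ℝ (TangentSpace (𝓡 2) x) (shapeOp g ι n x).toLinearMap

/-- Restriction to the boundary of the wedge product of two vector-valued 1-forms,
`(η ∧ η')(X, Y) = g (η X, η' Y) - g (η Y, η' X)`. -/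
def bdryWedge (g : MetricField (𝓡∂ 3) M) (ι : B → M)
    (η η' : Π x : M, TangentSpace (𝓡∂ 3) x →L[ℝ] TangentSpace (𝓡∂ 3) x) : TwoForm B :=
  fun x a b => g (ι x) (η (ι x) (dincl ι x a)) (η' (ι x) (dincl ι x b)) -
    g (ι x) (η (ι x) (dincl ι x b)) (η' (ι x) (dincl ι x a))

end Boundary

end HypBdry

end

open HypBdry

/-!
The formula for `b` holds because the 2-form `η ∧ η'` on the boundary differs from the sum of the
integrands on the right by an exact form.

Let `K` be an infinitesimal isometry with rotation part `W`, so that `∇_a K = W × a`. In curvature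
`-1` one has `∇_a W = a × K` (`killing_rotation`), and therefore a section `u + i u'` has the
coboundary `η = ∇u - u' ×`, `η' = ∇u' + u ×` (`IsCoboundary.eq`). Put

  `ω = ⟨u, ∇u'⟩ + h *σ + h' *σ'`

on the boundary (`primitiveForm`). In `dω` the first term yields `⟨∇u ∧ ∇u'⟩` and a curvature term
that is known explicitly (`d1_connForm`); in the other terms `*σ = -vol (n, ·, u)`
(`star1_flatB`), which is easy to differentiate since the volume form is parallel
(`volume_parallel`, `d1_twistForm`). In an orthonormal frame `n`, `f1`, `f2` the difference of
`η ∧ η'`, of the integrand and of `dω` is a polynomial in the components of `u`, `u'`, `∇u`, `∇u'`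
and `S`, and it vanishes because `H = tr S` and, by the Gauss equation, the Gaussian curvature of
the boundary is `-1 + det S` (`gaussCurvature_eq`). This is `star2_bdryWedge_eq`. Since the
boundary is a closed surface, the integral of `dω` is zero (`stokes`).

The second formula is obtained by substitution. The operator enters only through `β = A σ`, which
is smooth whatever `A` is, since `β = -*σ'`. The hypotheses say that `h = δβ / 2` and
`h' = *dσ / 2`, and `δσ' = *dβ`; the terms `⟨h, δσ⟩ + ⟨h', δσ'⟩` become `⟨β, Δσ⟩ / 2` by the
pointwise identity `star2_wedge_laplacian` and a second use of Stokes' theorem.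

Metrics, connections, forms and the area measure are defined at each point by the preferred chart
there. In order to differentiate and to integrate them, they are first shown to have the same
expression in every chart: `covDeriv_chart` for the covariant derivative, `d1_chart` for the
exterior derivative and `area_apply` for the area. The calculus itself is then carried out on
subsets of vector spaces, for vector fields along a map (`nab`); its two cases are the changes of
charts and the inclusion of the boundary.
-/

set_option linter.unusedSectionVars false

noncomputable section

namespace HypBdry

/-! ### Metrics and connections on open sets of a vector space -/

section Euclidean

variable {E E' : Type*} [NormedAddCommGroup E] [NormedSpace ℝ E] [NormedAddCommGroup E']
  [NormedSpace ℝ E']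

/-- Christoffel symbols of the first kind of the metric `G` on the subset `s` of a vector space;
this is `christoffelFst` without the manifold. -/
def chrFst (G : E → E →L[ℝ] E →L[ℝ] ℝ) (s : Set E) (z : E) : E →L[ℝ] E →L[ℝ] E →L[ℝ] ℝ :=
  let Dg : E →L[ℝ] E →L[ℝ] E →L[ℝ] ℝ := fderivWithin ℝ G s z
  let Dg' : E →L[ℝ] E →L[ℝ] E →L[ℝ] ℝ :=
    (ContinuousLinearMap.flipₗᵢ ℝ E E ℝ).toContinuousLinearEquiv.toContinuousLinearMap ∘L Dg.flip
  (1 / 2 : ℝ) • (Dg + Dg.flip - Dg')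

/-- Christoffel symbols of the metric `G` on the subset `s` of a vector space; this is
`christoffel` without the manifold. -/
def chr (G : E → E →L[ℝ] E →L[ℝ] ℝ) (s : Set E) (z : E) : E →L[ℝ] E →L[ℝ] E :=
  (ContinuousLinearMap.compL ℝ E (E →L[ℝ] ℝ) E (G z).inverse) ∘L chrFst G s z

lemma chrFst_apply (G : E → E →L[ℝ] E →L[ℝ] ℝ) (s : Set E) (z a b c : E) :
    chrFst G s z a b c = (fderivWithin ℝ G s z a b c + fderivWithin ℝ G s z b a c
      - fderivWithin ℝ G s z c a b) / 2 := by
  simp [chrFst]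
  ring

/-- The derivative of a field of symmetric bilinear forms is symmetric in the last two
arguments. -/
lemma fderivWithin_apply_swap {G : E → E →L[ℝ] E →L[ℝ] ℝ} {s : Set E} {z : E}
    (hsymm : ∀ z a b, G z a b = G z b a)
    (hG : DifferentiableWithinAt ℝ G s z) (hs : UniqueDiffWithinAt ℝ s z) (c a b : E) :
    fderivWithin ℝ G s z c a b = fderivWithin ℝ G s z c b a := by
  have h : ∀ a b, fderivWithin ℝ G s z c a b = fderivWithin ℝ (fun z => G z a b) s z c := by
    intro a b
    have := ((hG.hasFDerivWithinAt.clm_apply (hasFDerivWithinAt_const a z s)).clm_apply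
      (hasFDerivWithinAt_const b z s)).fderivWithin hs
    rw [this]; simp
  rw [h, h]; simp_rw [hsymm _ a b]

lemma metric_isInvertible [FiniteDimensional ℝ E] {g : E →L[ℝ] E →L[ℝ] ℝ}
    (hpos : ∀ a, a ≠ 0 → 0 < g a a) : g.IsInvertible := by
  have hinj : Function.Injective g.toLinearMap := by
    rw [← LinearMap.ker_eq_bot, LinearMap.ker_eq_bot']
    intro a ha
    by_contra h
    have := hpos a h
    have h2 : g a = 0 := ha
    simp [h2] at this
  have hdim : Module.finrank ℝ E = Module.finrank ℝ (E →L[ℝ] ℝ) := by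
    rw [← (LinearMap.toContinuousLinearMap (𝕜 := ℝ) (E := E) (F' := ℝ)).finrank_eq]
    exact (Subspace.dual_finrank_eq (K := ℝ) (V := E)).symm
  let e := LinearEquiv.ofInjectiveOfFinrankEq g.toLinearMap hinj hdim
  exact ⟨e.toContinuousLinearEquiv, by ext; rfl⟩

/-- The covector `l` is represented by the vector `g.inverse l`; the junk value of `inverse` is
avoided because `g` is invertible. -/
lemma metric_inverse_apply {g : E →L[ℝ] E →L[ℝ] ℝ} (hg : g.IsInvertible) (l : E →L[ℝ] ℝ) :
    g (g.inverse l) = l := by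
  obtain ⟨e, rfl⟩ := hg
  simp

lemma chr_spec {G : E → E →L[ℝ] E →L[ℝ] ℝ} {s : Set E} {z : E} (hg : (G z).IsInvertible)
    (a b c : E) : G z (chr G s z a b) c = chrFst G s z a b c := by
  simp [chr, metric_inverse_apply hg]

lemma metric_ext {g : E →L[ℝ] E →L[ℝ] ℝ} (hpos : ∀ a, a ≠ 0 → 0 < g a a) {a b : E}
    (h : ∀ c, g a c = g b c) : a = b := by
  by_contra hne
  have := hpos (a - b) (sub_ne_zero.2 hne)
  simp [h] at this

/-- `G` is a field of inner products which near the point `z` of the set `s` is smooth within `s`.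
Symmetry is asked at all points, positivity only at `z`: coordinate expressions `coordMetric g x`
are symmetric everywhere, but definite only on the image of the chart. -/
structure IsMetricAt (G : E → E →L[ℝ] E →L[ℝ] ℝ) (s : Set E) (z : E) : Prop where
  symm : ∀ z a b, G z a b = G z b a
  pos : ∀ a, a ≠ 0 → 0 < G z a a
  smooth : ContDiffWithinAt ℝ ∞ G s z
  unique : UniqueDiffOn ℝ s
  mem : z ∈ s

section
variable {G : E → E →L[ℝ] E →L[ℝ] ℝ} {s : Set E} {z : E}

lemma IsMetricAt.diff (h : IsMetricAt G s z) : DifferentiableWithinAt ℝ G s z :=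
  h.smooth.differentiableWithinAt (by simp)

lemma IsMetricAt.inv [FiniteDimensional ℝ E] (h : IsMetricAt G s z) : (G z).IsInvertible :=
  metric_isInvertible h.pos

lemma IsMetricAt.chr_symm [FiniteDimensional ℝ E] (h : IsMetricAt G s z) (a b : E) :
    chr G s z a b = chr G s z b a := by
  apply metric_ext h.pos
  intro c
  rw [chr_spec h.inv, chr_spec h.inv, chrFst_apply, chrFst_apply,
    fderivWithin_apply_swap h.symm h.diff (h.unique z h.mem) c a b]
  ring

/-- The Levi-Civita connection is metric. -/
lemma IsMetricAt.compat [FiniteDimensional ℝ E] (h : IsMetricAt G s z) (a b c : E) :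
    fderivWithin ℝ G s z a b c = G z (chr G s z a b) c + G z b (chr G s z a c) := by
  rw [h.symm z b, chr_spec h.inv, chr_spec h.inv, chrFst_apply, chrFst_apply,
    fderivWithin_apply_swap h.symm h.diff (h.unique z h.mem) a c b]
  ring

lemma IsMetricAt.chr_smooth [FiniteDimensional ℝ E] (h : IsMetricAt G s z) :
    ContDiffWithinAt ℝ ∞ (chr G s) s z := by
  have h1 : ContDiffWithinAt ℝ ∞ (fun z => (G z).inverse) s z := by
    have : ContDiffAt ℝ ∞ (ContinuousLinearMap.inverse : (E →L[ℝ] E →L[ℝ] ℝ) → _) (G z) :=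
      h.inv.contDiffAt_map_inverse
    exact this.comp_contDiffWithinAt z h.smooth
  have h2 : ContDiffWithinAt ℝ ∞ (fderivWithin ℝ G s) s z :=
    h.smooth.fderivWithin_right h.unique (by simp) h.mem
  have h3 : ContDiffWithinAt ℝ ∞ (chrFst G s) s z := by
    unfold chrFst
    apply ContDiffWithinAt.const_smul
    have hf : ContDiffWithinAt ℝ ∞ (fun z => (fderivWithin ℝ G s z).flip) s z :=
      (ContinuousLinearMap.flipₗᵢ ℝ E E (E →L[ℝ] ℝ)).contDiff.comp_contDiffWithinAt h2
    exact (h2.add hf).sub (contDiffWithinAt_const.clm_comp hf)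
  exact ((ContinuousLinearMap.compL ℝ E (E →L[ℝ] ℝ) E).contDiff.comp_contDiffWithinAt
    h1).clm_comp h3

end

/-! ### Covariant derivatives along maps -/

/-- Covariant derivative `a ↦ ∇_a X` of the vector field `X` along the map `F`, for the connection
with Christoffel symbols `Γ`. The usual covariant derivative is the case `F = id`. -/
def nab (Γ : E → E →L[ℝ] E →L[ℝ] E) (t : Set E') (F X : E' → E) (y : E') : E' →L[ℝ] E :=
  fderivWithin ℝ X t y + (Γ (F y)).flip (X y) ∘L fderivWithin ℝ F t y

lemma nab_apply (Γ : E → E →L[ℝ] E →L[ℝ] E) (t : Set E') (F X : E' → E) (y a : E') :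
    nab Γ t F X y a = fderivWithin ℝ X t y a + Γ (F y) (fderivWithin ℝ F t y a) (X y) := rfl

variable {s : Set E} {t : Set E'} {F X Y Z : E' → E} {y : E'}

lemma nab_metric {G : E → E →L[ℝ] E →L[ℝ] ℝ} {Γ : E → E →L[ℝ] E →L[ℝ] E}
    (ht : UniqueDiffWithinAt ℝ t y) (hst : MapsTo F t s)
    (hG : DifferentiableWithinAt ℝ G s (F y))
    (hΓ : ∀ a b c, fderivWithin ℝ G s (F y) a b c
      = G (F y) (Γ (F y) a b) c + G (F y) b (Γ (F y) a c))
    (hF : DifferentiableWithinAt ℝ F t y) (hX : DifferentiableWithinAt ℝ X t y)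
    (hY : DifferentiableWithinAt ℝ Y t y) (a : E') :
    fderivWithin ℝ (fun y => G (F y) (X y) (Y y)) t y a =
      G (F y) (nab Γ t F X y a) (Y y) + G (F y) (X y) (nab Γ t F Y y a) := by
  have := (((hG.hasFDerivWithinAt.comp y hF.hasFDerivWithinAt hst).clm_apply
    hX.hasFDerivWithinAt).clm_apply hY.hasFDerivWithinAt).fderivWithin ht
  simp only [Function.comp_apply] at this
  rw [this]
  simp [nab_apply, hΓ]
  ring

/-- The Leibniz rule for a field `V` of trilinear forms that is parallel, as expressed by `hΓ`. -/
lemma nab_trilinear {V : E → E →L[ℝ] E →L[ℝ] E →L[ℝ] ℝ} {Γ : E → E →L[ℝ] E →L[ℝ] E}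
    (ht : UniqueDiffWithinAt ℝ t y) (hst : MapsTo F t s)
    (hV : DifferentiableWithinAt ℝ V s (F y))
    (hΓ : ∀ a b c d, fderivWithin ℝ V s (F y) a b c d
      = V (F y) (Γ (F y) a b) c d + V (F y) b (Γ (F y) a c) d + V (F y) b c (Γ (F y) a d))
    (hF : DifferentiableWithinAt ℝ F t y) (hX : DifferentiableWithinAt ℝ X t y)
    (hY : DifferentiableWithinAt ℝ Y t y) (hZ : DifferentiableWithinAt ℝ Z t y) (a : E') :
    fderivWithin ℝ (fun y => V (F y) (X y) (Y y) (Z y)) t y a =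
      V (F y) (nab Γ t F X y a) (Y y) (Z y) + V (F y) (X y) (nab Γ t F Y y a) (Z y)
        + V (F y) (X y) (Y y) (nab Γ t F Z y a) := by
  have := ((((hV.hasFDerivWithinAt.comp y hF.hasFDerivWithinAt hst).clm_apply
    hX.hasFDerivWithinAt).clm_apply hY.hasFDerivWithinAt).clm_apply
    hZ.hasFDerivWithinAt).fderivWithin ht
  simp only [Function.comp_apply] at this
  rw [this]
  simp [nab_apply, hΓ]
  ring

/-- The curvature `R(a, b) c` of the connection with Christoffel symbols `Γ`; this is `curvature`
without the manifold. -/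
def curv (Γ : E → E →L[ℝ] E →L[ℝ] E) (s : Set E) (z a b c : E) : E :=
  fderivWithin ℝ Γ s z a b c - fderivWithin ℝ Γ s z b a c + Γ z a (Γ z b c) - Γ z b (Γ z a c)

lemma fderivWithin_fderivWithin_apply_symm (ht : UniqueDiffOn ℝ t) (hy : y ∈ t)
    (hyt : y ∈ closure (interior t)) (hX : ContDiffWithinAt ℝ ∞ X t y) (a b : E') :
    fderivWithin ℝ (fun y => fderivWithin ℝ X t y b) t y a =
    fderivWithin ℝ (fun y => fderivWithin ℝ X t y a) t y b := by
  have h2 : DifferentiableWithinAt ℝ (fderivWithin ℝ X t) t y :=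
    (hX.fderivWithin_right (m := 1) ht (by norm_cast) hy).differentiableWithinAt (by simp)
  have h : ∀ a b, fderivWithin ℝ (fun y => fderivWithin ℝ X t y b) t y a =
      fderivWithin ℝ (fderivWithin ℝ X t) t y a b := by
    intro a b
    rw [(h2.hasFDerivWithinAt.clm_apply (hasFDerivWithinAt_const b y t)).fderivWithin (ht y hy)]
    simp
  rw [h, h]
  exact (hX.isSymmSndFDerivWithinAt (by simpa using by norm_cast) ht hyt hy).eq a b

/-- A torsion free connection satisfies `∇_a (∂_b F) = ∇_b (∂_a F)`. -/
lemma nab_fderiv_symm {Γ : E → E →L[ℝ] E →L[ℝ] E} (hΓ : ∀ a b, Γ (F y) a b = Γ (F y) b a)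
    (ht : UniqueDiffOn ℝ t) (hy : y ∈ t)
    (hyt : y ∈ closure (interior t)) (hF : ContDiffWithinAt ℝ ∞ F t y) (a b : E') :
    nab Γ t F (fun y => fderivWithin ℝ F t y b) y a =
    nab Γ t F (fun y => fderivWithin ℝ F t y a) y b := by
  rw [nab_apply, nab_apply, fderivWithin_fderivWithin_apply_symm ht hy hyt hF, hΓ]

/-- The commutator of two covariant derivatives along a map is the curvature. The constant fields
`a`, `b` commute, so there is no bracket term. -/
lemma nab_comm {Γ : E → E →L[ℝ] E →L[ℝ] E} (hΓ : DifferentiableWithinAt ℝ Γ s (F y))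
    (hst : MapsTo F t s) (ht : UniqueDiffOn ℝ t) (hy : y ∈ t)
    (hyt : y ∈ closure (interior t)) (hF : ContDiffWithinAt ℝ ∞ F t y)
    (hX : ContDiffWithinAt ℝ ∞ X t y) (a b : E') :
    nab Γ t F (fun y => nab Γ t F X y b) y a - nab Γ t F (fun y => nab Γ t F X y a) y b =
      curv Γ s (F y) (fderivWithin ℝ F t y a) (fderivWithin ℝ F t y b) (X y) := by
  have hF2 : ∀ b, DifferentiableWithinAt ℝ (fun y => fderivWithin ℝ F t y b) t y := fun b =>
    ((hF.fderivWithin_right (m := 1) ht (by norm_cast) hy).differentiableWithinAt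
      (by simp)).clm_apply (differentiableWithinAt_const b)
  have hX2 : ∀ b, DifferentiableWithinAt ℝ (fun y => fderivWithin ℝ X t y b) t y := fun b =>
    ((hX.fderivWithin_right (m := 1) ht (by norm_cast) hy).differentiableWithinAt
      (by simp)).clm_apply (differentiableWithinAt_const b)
  have hF1 := (hF.differentiableWithinAt (by simp)).hasFDerivWithinAt
  have hX1 := (hX.differentiableWithinAt (by simp)).hasFDerivWithinAt
  have key : ∀ a b, fderivWithin ℝ (fun y => nab Γ t F X y b) t y a =
      fderivWithin ℝ (fun y => fderivWithin ℝ X t y b) t y a +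
      (fderivWithin ℝ Γ s (F y) (fderivWithin ℝ F t y a) (fderivWithin ℝ F t y b) (X y)
        + Γ (F y) (fderivWithin ℝ (fun y => fderivWithin ℝ F t y b) t y a) (X y)
        + Γ (F y) (fderivWithin ℝ F t y b) (fderivWithin ℝ X t y a)) := by
    intro a b
    have := ((hX2 b).hasFDerivWithinAt.add
      (((hΓ.hasFDerivWithinAt.comp y hF1 hst).clm_apply (hF2 b).hasFDerivWithinAt).clm_apply
        hX1)).fderivWithin (ht y hy)
    simp only [Function.comp_apply] at this
    simp only [nab_apply]
    erw [this]
    simp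
    abel
  rw [nab_apply Γ t F (fun y => nab Γ t F X y b), nab_apply Γ t F (fun y => nab Γ t F X y a),
    key, key, nab_apply, nab_apply,
    fderivWithin_fderivWithin_apply_symm ht hy hyt hF a b,
    fderivWithin_fderivWithin_apply_symm ht hy hyt hX a b, curv]
  simp only [map_add]
  abel

/-- The Christoffel symbols of the metric `G'` pulled back by the map `F`:
`⟨∇_a b, c⟩ = ⟨∇_a (∂_b F), ∂_c F⟩`. For a change of charts this is the transformation law of the
Christoffel symbols, for an immersion it is the Gauss formula. -/
lemma chrFst_pullback {G : E → E →L[ℝ] E →L[ℝ] ℝ} {G' : E' → E' →L[ℝ] E' →L[ℝ] ℝ}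
    (hG : IsMetricAt G s (F y)) (hst : MapsTo F t s) (ht : UniqueDiffOn ℝ t) (hy : y ∈ t)
    (hyt : y ∈ closure (interior t)) (hF : ContDiffWithinAt ℝ ∞ F t y)
    (hG' : DifferentiableWithinAt ℝ G' t y)
    (h : ∀ᶠ z in 𝓝[t] y, ∀ a b, G' z a b =
      G (F z) (fderivWithin ℝ F t z a) (fderivWithin ℝ F t z b)) [FiniteDimensional ℝ E]
    (a b c : E') :
    chrFst G' t y a b c = G (F y) (nab (chr G s) t F (fun y => fderivWithin ℝ F t y b) y a)
      (fderivWithin ℝ F t y c) := by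
  have hF2 : ∀ b, DifferentiableWithinAt ℝ (fun y => fderivWithin ℝ F t y b) t y := fun b =>
    ((hF.fderivWithin_right (m := 1) ht (by norm_cast) hy).differentiableWithinAt
      (by simp)).clm_apply (differentiableWithinAt_const b)
  have hF1 := hF.differentiableWithinAt (n := ∞) (by simp)
  have key : ∀ a b c, fderivWithin ℝ G' t y a b c =
      G (F y) (nab (chr G s) t F (fun y => fderivWithin ℝ F t y b) y a) (fderivWithin ℝ F t y c)
      + G (F y) (fderivWithin ℝ F t y b)
        (nab (chr G s) t F (fun y => fderivWithin ℝ F t y c) y a) := by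
    intro a b c
    rw [← nab_metric (ht y hy) hst hG.diff hG.compat hF1 (hF2 b) (hF2 c)]
    have h1 : fderivWithin ℝ G' t y a b c = fderivWithin ℝ (fun z => G' z b c) t y a := by
      rw [((hG'.hasFDerivWithinAt.clm_apply (hasFDerivWithinAt_const b y t)).clm_apply
        (hasFDerivWithinAt_const c y t)).fderivWithin (ht y hy)]
      simp
    rw [h1]
    congr 1
    apply Filter.EventuallyEq.fderivWithin_eq_of_mem _ hy
    filter_upwards [h] with z hz using hz b c
  -- Koszul's formula: the second derivatives of `F` that do not cancel are equal by symmetry.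
  rw [chrFst_apply, key, key, key]
  rw [nab_fderiv_symm hG.chr_symm ht hy hyt hF c a, nab_fderiv_symm hG.chr_symm ht hy hyt hF c b,
    nab_fderiv_symm hG.chr_symm ht hy hyt hF b a]
  simp only [hG.symm (F y) (fderivWithin ℝ F t y a)]
  simp only [hG.symm (F y) (fderivWithin ℝ F t y b)]
  ring

end Euclidean

/-! ### Volume forms -/

section ThreeDim

variable {E : Type*} [NormedAddCommGroup E] [NormedSpace ℝ E]

/-- The determinant of three vectors given by coordinates. -/
def det3 (a0 a1 a2 b0 b1 b2 c0 c1 c2 : ℝ) : ℝ :=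
  a0 * (b1 * c2 - b2 * c1) - a1 * (b0 * c2 - b2 * c0) + a2 * (b0 * c1 - b1 * c0)

lemma alt_swap_left {T : E →L[ℝ] E →L[ℝ] E →L[ℝ] ℝ} (h1 : ∀ a b, T a a b = 0) (a b c : E) :
    T b a c = - T a b c := by
  have := h1 (a + b) c
  simp [h1] at this
  linarith

lemma alt_swap_right {T : E →L[ℝ] E →L[ℝ] E →L[ℝ] ℝ} (h2 : ∀ a b, T a b b = 0) (a b c : E) :
    T a c b = - T a b c := by
  have := h2 a (b + c)
  simp [h2] at this
  linarith

/-- An alternating trilinear form on three linear combinations of `f0`, `f1`, `f2`. -/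
lemma alt_expand {T : E →L[ℝ] E →L[ℝ] E →L[ℝ] ℝ} (h1 : ∀ a b, T a a b = 0)
    (h2 : ∀ a b, T a b b = 0) (f0 f1 f2 : E) (a0 a1 a2 b0 b1 b2 c0 c1 c2 : ℝ) :
    T (a0 • f0 + a1 • f1 + a2 • f2) (b0 • f0 + b1 • f1 + b2 • f2) (c0 • f0 + c1 • f1 + c2 • f2) =
      det3 a0 a1 a2 b0 b1 b2 c0 c1 c2 * T f0 f1 f2 := by
  have h3 : ∀ a b, T a b a = 0 := fun a b => by rw [alt_swap_right h2, h1, neg_zero]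
  have e1 : T f1 f0 f2 = - T f0 f1 f2 := alt_swap_left h1 _ _ _
  have e2 : T f0 f2 f1 = - T f0 f1 f2 := alt_swap_right h2 _ _ _
  have e3 : T f1 f2 f0 = T f0 f1 f2 := by rw [alt_swap_right h2, e1, neg_neg]
  have e4 : T f2 f0 f1 = T f0 f1 f2 := by rw [alt_swap_left h1, e2, neg_neg]
  have e5 : T f2 f1 f0 = - T f0 f1 f2 := by rw [alt_swap_left h1, e3]
  simp only [map_add, map_smul, add_apply, smul_apply, smul_eq_mul, h1, h2, h3, e1, e2, e3, e4, e5,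
    det3]
  ring

/-- An orthonormal frame of a three-dimensional space with the inner product `g`. The equations
that follow from symmetry, and the expansion of a vector, are included as fields. -/
structure IsFrame (g : E →L[ℝ] E →L[ℝ] ℝ) (f0 f1 f2 : E) : Prop where
  h00 : g f0 f0 = 1
  h11 : g f1 f1 = 1
  h22 : g f2 f2 = 1
  h01 : g f0 f1 = 0
  h02 : g f0 f2 = 0
  h12 : g f1 f2 = 0
  h10 : g f1 f0 = 0
  h20 : g f2 f0 = 0
  h21 : g f2 f1 = 0
  expand : ∀ a, a = g a f0 • f0 + g a f1 • f1 + g a f2 • f2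

lemma isFrame_of_orthonormal {g : E →L[ℝ] E →L[ℝ] ℝ} (hsymm : ∀ a b, g a b = g b a)
    (h3 : Module.finrank ℝ E = 3) {f0 f1 f2 : E}
    (h00 : g f0 f0 = 1) (h11 : g f1 f1 = 1) (h22 : g f2 f2 = 1)
    (h01 : g f0 f1 = 0) (h02 : g f0 f2 = 0) (h12 : g f1 f2 = 0) : IsFrame g f0 f1 f2 := by
  have h10 : g f1 f0 = 0 := by rw [hsymm, h01]
  have h20 : g f2 f0 = 0 := by rw [hsymm, h02]
  have h21 : g f2 f1 = 0 := by rw [hsymm, h12]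
  have hli : LinearIndependent ℝ ![f0, f1, f2] := by
    rw [Fintype.linearIndependent_iff]
    intro c hc i
    simp [Fin.sum_univ_three] at hc
    have e0 := congrArg (fun x => g x f0) hc
    have e1 := congrArg (fun x => g x f1) hc
    have e2 := congrArg (fun x => g x f2) hc
    simp [h00, h11, h22, h01, h02, h12, h10, h20, h21] at e0 e1 e2
    fin_cases i <;> simp [e0, e1, e2]
  let bas := basisOfLinearIndependentOfCardEqFinrank hli (by simp [h3])
  refine ⟨h00, h11, h22, h01, h02, h12, h10, h20, h21, fun a => ?_⟩
  have ha := bas.sum_repr a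
  simp [Fin.sum_univ_three, bas] at ha
  set c0 := (bas.repr a) 0
  set c1 := (bas.repr a) 1
  set c2 := (bas.repr a) 2
  have hb : a = c0 • f0 + c1 • f1 + c2 • f2 := ha.symm
  have k0 : g a f0 = c0 := by rw [hb]; simp [h00, h10, h20]
  have k1 : g a f1 = c1 := by rw [hb]; simp [h01, h11, h21]
  have k2 : g a f2 = c2 := by rw [hb]; simp [h02, h12, h22]
  rw [k0, k1, k2]; exact hb

/-- The Gram-Schmidt process for an inner product given as a bilinear form. -/
lemma exists_isFrame {g : E →L[ℝ] E →L[ℝ] ℝ} (hsymm : ∀ a b, g a b = g b a)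
    (hpos : ∀ a, a ≠ 0 → 0 < g a a) (h3 : Module.finrank ℝ E = 3) :
    ∃ f0 f1 f2, IsFrame g f0 f1 f2 := by
  have : FiniteDimensional ℝ E := Module.finite_of_finrank_eq_succ h3
  let Bf : LinearMap.BilinForm ℝ E := LinearMap.mk₂ ℝ (fun a b => g a b) (by simp) (by simp)
    (by simp) (by simp)
  have hBf : ∀ a b, Bf a b = g a b := fun _ _ => rfl
  obtain ⟨v, hv⟩ := LinearMap.BilinForm.exists_orthogonal_basis (B := Bf)
    ⟨fun a b => by simpa [hBf] using hsymm a b⟩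
  let c : Fin 3 ≃ Fin (Module.finrank ℝ E) := finCongr h3.symm
  let r : Fin 3 → ℝ := fun i => (Real.sqrt (g (v (c i)) (v (c i))))⁻¹
  let w : Fin 3 → E := fun i => r i • v (c i)
  have hw0 : ∀ i j, i ≠ j → g (w i) (w j) = 0 := by
    intro i j hij
    have h : Bf (v (c i)) (v (c j)) = 0 := hv (fun h => hij (c.injective h))
    rw [hBf] at h
    simp [w, h]
  have hw1 : ∀ i, g (w i) (w i) = 1 := by
    intro i
    have hp := hpos _ (v.ne_zero (c i))
    have hs := Real.mul_self_sqrt hp.le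
    have hs0 := (Real.sqrt_pos.2 hp).ne'
    simp only [w, map_smul, smul_apply, smul_eq_mul, r]
    field_simp
    nlinarith
  exact ⟨w 0, w 1, w 2, isFrame_of_orthonormal hsymm h3 (hw1 0) (hw1 1) (hw1 2)
    (hw0 _ _ (by decide)) (hw0 _ _ (by decide)) (hw0 _ _ (by decide))⟩

/-- `V` is a unit volume form for the inner product `g`. -/
structure IsUnitVolume (g : E →L[ℝ] E →L[ℝ] ℝ) (V : E →L[ℝ] E →L[ℝ] E →L[ℝ] ℝ) : Prop where
  alt_left : ∀ a b, V a a b = 0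
  alt_right : ∀ a b, V a b b = 0
  unit : ∀ a b c, g a a = 1 → g b b = 1 → g c c = 1 →
    g a b = 0 → g a c = 0 → g b c = 0 → |V a b c| = 1

section
variable {g : E →L[ℝ] E →L[ℝ] ℝ} {V : E →L[ℝ] E →L[ℝ] E →L[ℝ] ℝ} {f0 f1 f2 : E}

lemma IsUnitVolume.frame_sq (hV : IsUnitVolume g V) (hf : IsFrame g f0 f1 f2) :
    V f0 f1 f2 * V f0 f1 f2 = 1 := by
  have := hV.unit f0 f1 f2 hf.h00 hf.h11 hf.h22 hf.h01 hf.h02 hf.h12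
  rw [← abs_mul_abs_self, this, one_mul]

lemma IsUnitVolume.expand (hV : IsUnitVolume g V) (hf : IsFrame g f0 f1 f2) (a b c : E) :
    V a b c = det3 (g a f0) (g a f1) (g a f2) (g b f0) (g b f1) (g b f2)
      (g c f0) (g c f1) (g c f2) * V f0 f1 f2 := by
  conv_lhs => rw [hf.expand a, hf.expand b, hf.expand c]
  exact alt_expand hV.alt_left hV.alt_right _ _ _ _ _ _ _ _ _ _ _ _

lemma IsFrame.inner (hf : IsFrame g f0 f1 f2) (a b : E) :
    g a b = g a f0 * g b f0 + g a f1 * g b f1 + g a f2 * g b f2 := by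
  conv_lhs => rw [hf.expand a, hf.expand b]
  simp only [map_add, map_smul, add_apply, smul_apply, smul_eq_mul, hf.h00, hf.h01, hf.h02,
    hf.h10, hf.h11, hf.h12, hf.h20, hf.h21, hf.h22]
  ring

/-- The square of the volume is the Gram determinant. -/
lemma IsUnitVolume.sq_eq_gram (hV : IsUnitVolume g V) (hf : IsFrame g f0 f1 f2) (a b c : E) :
    V a b c * V a b c = det3 (g a a) (g a b) (g a c) (g b a) (g b b) (g b c)
      (g c a) (g c b) (g c c) := by
  rw [hV.expand hf, hf.inner a a, hf.inner a b, hf.inner a c, hf.inner b a, hf.inner b b,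
    hf.inner b c, hf.inner c a, hf.inner c b, hf.inner c c]
  have h := hV.frame_sq hf
  unfold det3
  linear_combination (g a f0 * (g b f1 * g c f2 - g b f2 * g c f1)
    - g a f1 * (g b f0 * g c f2 - g b f2 * g c f0)
    + g a f2 * (g b f0 * g c f1 - g b f1 * g c f0)) ^ 2 * h

/-- Lagrange's identity for `V (a × k, c, d)`, where `x = a × k` is given through its inner
products. -/
lemma IsUnitVolume.lagrange (hV : IsUnitVolume g V) (hf : IsFrame g f0 f1 f2) {x a k : E}
    (hx : ∀ b, g x b = V a k b) (c d : E) :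
    V x c d = g a c * g k d - g k c * g a d := by
  have h := hV.frame_sq hf
  rw [hV.expand hf x c d, hx, hx, hx, hV.expand hf a k f0, hV.expand hf a k f1,
    hV.expand hf a k f2, hf.inner a c, hf.inner k d, hf.inner k c, hf.inner a d]
  simp only [hf.h00, hf.h01, hf.h02,
    hf.h10, hf.h11, hf.h12, hf.h20, hf.h21, hf.h22, det3]
  linear_combination ((g a f0 * g c f0 + g a f1 * g c f1 + g a f2 * g c f2) *
    (g k f0 * g d f0 + g k f1 * g d f1 + g k f2 * g d f2) -
    (g k f0 * g c f0 + g k f1 * g c f1 + g k f2 * g c f2) *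
    (g a f0 * g d f0 + g a f1 * g d f1 + g a f2 * g d f2)) * h

lemma IsUnitVolume.ext (hV : IsUnitVolume g V) (hf : IsFrame g f0 f1 f2) {x y : E}
    (h : ∀ c d, V x c d = V y c d) : x = y := by
  have h0 : V f0 f1 f2 ≠ 0 := fun h0 => by simpa [h0] using hV.frame_sq hf
  have e2 := h f0 f1
  have e0 := h f1 f2
  have e1 := h f2 f0
  rw [hV.expand hf, hV.expand hf y] at e0 e1 e2
  simp only [hf.h00, hf.h01, hf.h02,
    hf.h10, hf.h11, hf.h12, hf.h20, hf.h21, hf.h22, det3] at e0 e1 e2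
  have e0 := mul_right_cancel₀ h0 e0
  have e1 := mul_right_cancel₀ h0 e1
  have e2 := mul_right_cancel₀ h0 e2
  have k0 : g x f0 = g y f0 := by linarith
  have k1 : g x f1 = g y f1 := by linarith
  have k2 : g x f2 = g y f2 := by linarith
  rw [hf.expand x, hf.expand y, k0, k1, k2]

/-- The action of an endomorphism on a volume form is multiplication by its trace. -/
lemma IsUnitVolume.trace (hV : IsUnitVolume g V) (hf : IsFrame g f0 f1 f2) (L : E →L[ℝ] E)
    (b c d : E) :
    V (L b) c d + V b (L c) d + V b c (L d) =
      (g (L f0) f0 + g (L f1) f1 + g (L f2) f2) * V b c d := by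
  have hL : ∀ b f, g (L b) f =
      g b f0 * g (L f0) f + g b f1 * g (L f1) f + g b f2 * g (L f2) f := by
    intro b f
    conv_lhs => rw [hf.expand b]
    simp
  rw [hV.expand hf (L b) c d, hV.expand hf b (L c) d, hV.expand hf b c (L d), hV.expand hf b c d]
  rw [hL b f0, hL b f1, hL b f2, hL c f0, hL c f1, hL c f2, hL d f0, hL d f1, hL d f2]
  unfold det3
  ring

end

section
variable {G : E → E →L[ℝ] E →L[ℝ] ℝ} {V : E → E →L[ℝ] E →L[ℝ] E →L[ℝ] ℝ} {s : Set E} {z : E}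

/-- A unit volume form is parallel. Its derivative is again alternating, hence determined by its
value on an orthonormal frame; that value is found by differentiating the identity between the
square of the volume and the Gram determinant. -/
lemma volume_parallel (h3 : Module.finrank ℝ E = 3) (hG : ∀ᶠ x in 𝓝[s] z, IsMetricAt G s x)
    (hV : ∀ᶠ x in 𝓝[s] z, IsUnitVolume (G x) (V x)) (hz : z ∈ s)
    (hdV : DifferentiableWithinAt ℝ V s z) (a b c d : E) :
    fderivWithin ℝ V s z a b c d
      = V z (chr G s z a b) c d + V z b (chr G s z a c) d + V z b c (chr G s z a d) := by
  have : FiniteDimensional ℝ E := Module.finite_of_finrank_eq_succ h3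
  have hGz := hG.self_of_nhdsWithin hz
  have hVz := hV.self_of_nhdsWithin hz
  have hu := hGz.unique z hz
  obtain ⟨f0, f1, f2, hf⟩ := exists_isFrame (hGz.symm z) hGz.pos h3
  have hd : ∀ b c d, fderivWithin ℝ V s z a b c d = fderivWithin ℝ (fun x => V x b c d) s z a := by
    intro b c d
    rw [(((hdV.hasFDerivWithinAt.clm_apply (hasFDerivWithinAt_const b z s)).clm_apply
      (hasFDerivWithinAt_const c z s)).clm_apply (hasFDerivWithinAt_const d z s)).fderivWithin hu]
    simp
  have h1 : ∀ b c, fderivWithin ℝ V s z a b b c = 0 := by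
    intro b c
    rw [hd, Filter.EventuallyEq.fderivWithin_eq_of_mem (f := fun _ => (0 : ℝ)) _ hz]
    · simp
    · filter_upwards [hV] with x hx using hx.alt_left b c
  have h2 : ∀ b c, fderivWithin ℝ V s z a b c c = 0 := by
    intro b c
    rw [hd, Filter.EventuallyEq.fderivWithin_eq_of_mem (f := fun _ => (0 : ℝ)) _ hz]
    · simp
    · filter_upwards [hV] with x hx using hx.alt_right b c
  -- The derivative of `V` is alternating, by `h1` and `h2`.
  have hexp : fderivWithin ℝ V s z a b c d = det3 (G z b f0) (G z b f1) (G z b f2)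
      (G z c f0) (G z c f1) (G z c f2) (G z d f0) (G z d f1) (G z d f2)
      * fderivWithin ℝ V s z a f0 f1 f2 := by
    conv_lhs => rw [hf.expand b, hf.expand c, hf.expand d]
    exact alt_expand h1 h2 _ _ _ _ _ _ _ _ _ _ _ _
  have hdG : ∀ b c, HasFDerivWithinAt (fun x => G x b c)
      (((fderivWithin ℝ G s z).flip b).flip c) s z := by
    intro b c
    have := (hGz.diff.hasFDerivWithinAt.clm_apply (hasFDerivWithinAt_const b z s)).clm_apply
      (hasFDerivWithinAt_const c z s)
    refine this.congr_fderiv ?_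
    ext; simp
  have hdVf : HasFDerivWithinAt (fun x => V x f0 f1 f2)
      ((((fderivWithin ℝ V s z).flip f0).flip f1).flip f2) s z := by
    have := ((hdV.hasFDerivWithinAt.clm_apply (hasFDerivWithinAt_const f0 z s)).clm_apply
      (hasFDerivWithinAt_const f1 z s)).clm_apply (hasFDerivWithinAt_const f2 z s)
    refine this.congr_fderiv ?_
    ext; simp
  -- `V ^ 2` is the Gram determinant; differentiating it gives twice the trace of `∇`.
  have hgram : fderivWithin ℝ (fun x => V x f0 f1 f2 * V x f0 f1 f2) s z =
      fderivWithin ℝ (fun x => det3 (G x f0 f0) (G x f0 f1) (G x f0 f2) (G x f1 f0) (G x f1 f1)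
        (G x f1 f2) (G x f2 f0) (G x f2 f1) (G x f2 f2)) s z := by
    apply Filter.EventuallyEq.fderivWithin_eq_of_mem _ hz
    filter_upwards [hV, hG] with x hx hgx
    obtain ⟨k0, k1, k2, hk⟩ := exists_isFrame (hgx.symm x) hgx.pos h3
    exact hx.sq_eq_gram hk _ _ _
  have hgram := congrArg (fun L => L a) hgram
  rw [(hdVf.fun_mul hdVf).fderivWithin hu] at hgram
  unfold det3 at hgram
  rw [((((hdG f0 f0).fun_mul (((hdG f1 f1).fun_mul (hdG f2 f2)).fun_sub
      ((hdG f1 f2).fun_mul (hdG f2 f1)))).fun_sub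
    ((hdG f0 f1).fun_mul (((hdG f1 f0).fun_mul (hdG f2 f2)).fun_sub
      ((hdG f1 f2).fun_mul (hdG f2 f0))))).fun_add
    ((hdG f0 f2).fun_mul (((hdG f1 f0).fun_mul (hdG f2 f1)).fun_sub
      ((hdG f1 f1).fun_mul (hdG f2 f0))))).fderivWithin hu] at hgram
  simp [hf.h00, hf.h01, hf.h02, hf.h10, hf.h11, hf.h12, hf.h20, hf.h21, hf.h22, hGz.compat]
    at hgram
  rw [hGz.symm z f0 (chr G s z a f0), hGz.symm z f1 (chr G s z a f1),
    hGz.symm z f2 (chr G s z a f2)] at hgram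
  have hsq := hVz.frame_sq hf
  rw [hVz.trace hf (chr G s z a), hVz.expand hf b c d, hexp]
  have : fderivWithin ℝ V s z a f0 f1 f2 = (G z (chr G s z a f0) f0 + G z (chr G s z a f1) f1 +
      G z (chr G s z a f2) f2) * V z f0 f1 f2 := by
    linear_combination (-(fderivWithin ℝ V s z a f0 f1 f2)) * hsq + V z f0 f1 f2 / 2 * hgram
  rw [this]; ring

end

end ThreeDim

/-! ### Killing fields -/

section Killing

variable {E : Type*} [NormedAddCommGroup E] [NormedSpace ℝ E]
  {G : E → E →L[ℝ] E →L[ℝ] ℝ} {V : E → E →L[ℝ] E →L[ℝ] E →L[ℝ] ℝ} {s : Set E} {z : E}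

/-- In constant curvature `-1` the rotation part `w` of an infinitesimal isometry `k` satisfies
`∇_a w = a × k`. The trilinear form `⟨∇²_{a,b} k, c⟩` is skew in `b`, `c`, and its commutator in
`a`, `b` is given by the curvature; as in the uniqueness of the Levi-Civita connection this
determines it: `⟨∇²_{a,b} k, c⟩ = ⟨a, b⟩⟨k, c⟩ - ⟨k, b⟩⟨a, c⟩`. By Lagrange's identity this is
`vol (a × k, b, c)`, and it is also `vol (∇_a w, b, c)`, since `∇_b k = w × b` and the volume form
is parallel. -/
lemma killing_rotation (h3 : Module.finrank ℝ E = 3) (hG : ∀ᶠ x in 𝓝[s] z, IsMetricAt G s x)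
    (hV : ∀ᶠ x in 𝓝[s] z, IsUnitVolume (G x) (V x)) (hz : z ∈ s)
    (hzs : z ∈ closure (interior s))
    (hdV : DifferentiableWithinAt ℝ V s z)
    (hcurv : ∀ a b c, curv (chr G s) s z a b c = G z a c • b - G z b c • a) {k w : E → E}
    (hk : ContDiffWithinAt ℝ ∞ k s z)
    (hkw : ∀ᶠ x in 𝓝[s] z, ∀ a c, G x (nab (chr G s) s id k x a) c = V x (w x) a c) :
    DifferentiableWithinAt ℝ w s z ∧
      ∀ a c, G z (nab (chr G s) s id w z a) c = V z a (k z) c := by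
  have : FiniteDimensional ℝ E := Module.finite_of_finrank_eq_succ h3
  have hGz := hG.self_of_nhdsWithin hz
  have hVz := hV.self_of_nhdsWithin hz
  have hus := hGz.unique
  have hu := hus z hz
  have hΓ := hGz.chr_smooth.differentiableWithinAt (n := ∞) (by simp)
  have hid : DifferentiableWithinAt ℝ (id : E → E) s z := differentiableWithinAt_id
  have hcid : ContDiffWithinAt ℝ ∞ (id : E → E) s z := contDiffWithinAt_id
  have hst : MapsTo (id : E → E) s s := fun _ h => h
  obtain ⟨f0, f1, f2, hf⟩ := exists_isFrame (hGz.symm z) hGz.pos h3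
  have hkd := hk.differentiableWithinAt (n := ∞) (by simp)
  -- the fields `∇_b k`, for constant `b`, are differentiable
  have hP : ∀ b, DifferentiableWithinAt ℝ (fun x => nab (chr G s) s id k x b) s z := by
    intro b
    have hk2 : DifferentiableWithinAt ℝ (fun y => fderivWithin ℝ k s y b) s z :=
      ((hk.fderivWithin_right (m := 1) hus (by norm_cast) hz).differentiableWithinAt
        (by simp)).clm_apply (differentiableWithinAt_const b)
    have hid2 : DifferentiableWithinAt ℝ (fun y => fderivWithin ℝ id s y b) s z :=
      ((hcid.fderivWithin_right (m := 1) hus (by norm_cast) hz).differentiableWithinAt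
        (by simp)).clm_apply (differentiableWithinAt_const b)
    exact hk2.add ((hΓ.clm_apply hid2).clm_apply hkd)
  have hcst : ∀ b : E, DifferentiableWithinAt ℝ (fun _ : E => b) s z := fun b =>
    differentiableWithinAt_const b
  have hnabc : ∀ a b, nab (chr G s) s id (fun _ => b) z a = chr G s z a b := by
    intro a b
    simp [nab_apply, fderivWithin_id hu]
  -- the rotation part, which is not assumed to be smooth, is differentiable: its components
  -- are obtained from `∇ k`
  have hw : DifferentiableWithinAt ℝ w s z := by
    have hν : DifferentiableWithinAt ℝ (fun x => V x f0 f1 f2) s z :=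
      ((hdV.clm_apply (hcst f0)).clm_apply (hcst f1)).clm_apply (hcst f2)
    have hν0 : V z f0 f1 f2 ≠ 0 := fun h0 => by simpa [h0] using hVz.frame_sq hf
    have hν1 : ∀ᶠ x in 𝓝[s] z, V x f0 f1 f2 ≠ 0 := hν.continuousWithinAt.eventually_ne hν0
    have hc : ∀ a c, DifferentiableWithinAt ℝ
        (fun x => G x (nab (chr G s) s id k x a) c * (V x f0 f1 f2)⁻¹) s z := fun a c =>
      ((hGz.diff.clm_apply (hP a)).clm_apply (hcst c)).mul (hν.fun_inv hν0)
    have hw' := (((hc f1 f2).smul (hcst f0)).add ((hc f2 f0).smul (hcst f1))).add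
      ((hc f0 f1).smul (hcst f2))
    refine hw'.congr_of_eventuallyEq_of_mem ?_ hz
    filter_upwards [hkw, hν1, hV] with x hx hx1 hVx
    simp only [hx, Pi.add_apply, Pi.smul_apply']
    have hwx := hf.expand (w x)
    have h3' : ∀ a b, V x a b a = 0 := fun a b => by
      rw [alt_swap_right hVx.alt_right, hVx.alt_left, neg_zero]
    have e3 : V x f1 f2 f0 = V x f0 f1 f2 := by
      rw [alt_swap_right hVx.alt_right, alt_swap_left hVx.alt_left, neg_neg]
    have e4 : V x f2 f0 f1 = V x f0 f1 f2 := by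
      rw [alt_swap_left hVx.alt_left, alt_swap_right hVx.alt_right, neg_neg]
    have k0 : V x (w x) f1 f2 = G z (w x) f0 * V x f0 f1 f2 := by
      conv_lhs => rw [hwx]
      simp [hVx.alt_left, h3']
    have k1 : V x (w x) f2 f0 = G z (w x) f1 * V x f0 f1 f2 := by
      conv_lhs => rw [hwx]
      simp [hVx.alt_left, h3', e3]
    have k2 : V x (w x) f0 f1 = G z (w x) f2 * V x f0 f1 f2 := by
      conv_lhs => rw [hwx]
      simp [hVx.alt_left, h3', e4]
    rw [k0, k1, k2, mul_inv_cancel_right₀ hx1, mul_inv_cancel_right₀ hx1,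
      mul_inv_cancel_right₀ hx1]
    exact hwx
  refine ⟨hw, ?_⟩
  let P : E → E := fun b => nab (chr G s) s id k z b
  let D : E → E → E := fun a b => nab (chr G s) s id (fun x => nab (chr G s) s id k x b) z a
  have hPskew : ∀ᶠ x in 𝓝[s] z, ∀ b c, G x (nab (chr G s) s id k x b) c =
      - G x b (nab (chr G s) s id k x c) := by
    filter_upwards [hkw, hV, hG] with x hx hVx hGx
    intro b c
    rw [hGx.symm x b, hx, hx, alt_swap_right hVx.alt_right]
  have hPskew' := hPskew.self_of_nhdsWithin hz
  have hmet : ∀ a b c, fderivWithin ℝ (fun x => G x (nab (chr G s) s id k x b) c) s z a =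
      G z (D a b) c + G z (P b) (chr G s z a c) := by
    intro a b c
    have := nab_metric (X := fun x => nab (chr G s) s id k x b) (Y := fun _ => c) hu hst
      hGz.diff hGz.compat hid (hP b) (hcst c) a
    rw [hnabc] at this
    exact this
  -- `D a b - P (Γ a b)` is the second covariant derivative `∇²_{a,b} k`, and it is skew in the
  -- last two arguments
  have hskew : ∀ a b c, G z (D a b - P (chr G s z a b)) c =
      - G z (D a c - P (chr G s z a c)) b := by
    intro a b c
    have h1 := hmet a b c
    have h2 := hmet a c b
    have h4 : fderivWithin ℝ (fun x => G x (nab (chr G s) s id k x b) c) s z a =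
        - fderivWithin ℝ (fun x => G x (nab (chr G s) s id k x c) b) s z a := by
      have hd : DifferentiableWithinAt ℝ (fun x => G x (nab (chr G s) s id k x c) b) s z :=
        (hGz.diff.clm_apply (hP c)).clm_apply (hcst b)
      have := hd.hasFDerivWithinAt.fun_neg.fderivWithin hu
      rw [← neg_apply, ← this]
      congr 1
      apply Filter.EventuallyEq.fderivWithin_eq_of_mem _ hz
      filter_upwards [hPskew, hG] with x hx hGx
      rw [hx, hGx.symm x b]
    have h5 : G z (P b) (chr G s z a c) = - G z (P (chr G s z a c)) b := by
      rw [hPskew' b, hGz.symm z b]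
    have h6 : G z (P c) (chr G s z a b) = - G z (P (chr G s z a b)) c := by
      rw [hPskew' c, hGz.symm z c]
    simp only [map_sub, sub_apply]
    linarith
  -- its antisymmetrisation in the first two arguments is the curvature
  have hcomm : ∀ a b c, G z (D a b - P (chr G s z a b)) c - G z (D b a - P (chr G s z b a)) c =
      G z a (k z) * G z b c - G z b (k z) * G z a c := by
    intro a b c
    have := nab_comm (Γ := chr G s) (F := id) hΓ hst hus hz hzs hcid hk a b
    rw [fderivWithin_id hu] at this
    simp only [id, ContinuousLinearMap.coe_id'] at this
    have h2 : D a b - D b a = G z a (k z) • b - G z b (k z) • a := by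
      rw [← hcurv]; exact this
    rw [hGz.chr_symm b a]
    have h3 := congrArg (fun x => G z x c) h2
    simp at h3 ⊢
    linarith
  -- `hskew` and `hcomm`, each taken with its cyclic permutations, determine it
  have hQ : ∀ a b c, G z (D a b - P (chr G s z a b)) c =
      G z a b * G z (k z) c - G z (k z) b * G z a c := by
    intro a b c
    have h1 := hcomm a b c
    have h2 := hcomm b c a
    have h3 := hcomm c a b
    have k1 := hskew a b c
    have k2 := hskew b c a
    have k3 := hskew c a b
    have e1 := hGz.symm z a b
    have e2 := hGz.symm z b c
    have e3 := hGz.symm z c a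
    rw [hGz.symm z b a, hGz.symm z c a, hGz.symm z c b, hGz.symm z a (k z), hGz.symm z b (k z),
      hGz.symm z c (k z)] at *
    linarith
  intro a c
  have hder : ∀ b c, V z (nab (chr G s) s id w z a) b c =
      G z (D a b - P (chr G s z a b)) c := by
    intro b c
    have h1 := hmet a b c
    have h2 := nab_trilinear (X := w) (Y := fun _ => b) (Z := fun _ => c) (F := id) hu hst hdV
      (volume_parallel h3 hG hV hz hdV) hid hw (hcst b) (hcst c) a
    rw [hnabc, hnabc] at h2
    have h4 : fderivWithin ℝ (fun x => G x (nab (chr G s) s id k x b) c) s z a =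
        fderivWithin ℝ (fun y => V (id y) (w y) b c) s z a := by
      congr 1
      apply Filter.EventuallyEq.fderivWithin_eq_of_mem _ hz
      filter_upwards [hkw] with x hx using hx b c
    have h5 := (hkw.self_of_nhdsWithin hz) (chr G s z a b) c
    have h6 := (hkw.self_of_nhdsWithin hz) b (chr G s z a c)
    simp only [id_eq] at h2 h4
    simp only [map_sub, sub_apply]
    change _ = G z (D a b) c - G z (nab (chr G s) s id k z (chr G s z a b)) c
    change _ = G z (D a b) c + G z (nab (chr G s) s id k z b) _ at h1
    linarith
  let x : E := (G z).inverse (V z a (k z))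
  have hx : ∀ b, G z x b = V z a (k z) b := fun b => by
    rw [metric_inverse_apply hGz.inv]
  have : nab (chr G s) s id w z a = x := by
    apply hVz.ext hf
    intro c d
    rw [hder, hQ, hVz.lagrange hf hx]
  rw [this, hx]

end Killing

/-! ### Vector fields and metrics in charts -/

section Charts

variable {E : Type*} [NormedAddCommGroup E] [NormedSpace ℝ E] [FiniteDimensional ℝ E]
  {H : Type*} [TopologicalSpace H] {I : ModelWithCorners ℝ E H}
  {M : Type*} [TopologicalSpace M] [ChartedSpace H M]

/-- `coordFrame`, as an endomorphism of the model space. -/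
def fr (I : ModelWithCorners ℝ E H) (x : M) (y : E) : E →L[ℝ] E := coordFrame I x y

/-- Coordinates of the vector field `Y` in the preferred chart at `x`, as the function of the
point `y` of the model space that `covDeriv` differentiates. -/
def vc (I : ModelWithCorners ℝ E H) (Y : VField I M) (x : M) (y : E) : E :=
  VectorField.mpullbackWithin 𝓘(ℝ, E) I (extChartAt I x).symm Y (range I) y

/-- The change of charts from the preferred chart at `x` to the preferred chart at `q`. -/
def tr (I : ModelWithCorners ℝ E H) (x q : M) : E → E :=
  extChartAt I q ∘ (extChartAt I x).symm

/-- A field of bilinear forms as a function with values in the bilinear forms on the model space.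
Here and below, such a name for a value at a point only forgets that the fibre `TangentSpace I p`
is more than a copy of `E`; the algebra of `E` then applies as it stands. -/
def bil (g : MetricField I M) (p : M) : E →L[ℝ] E →L[ℝ] ℝ := g p

/-- A vector field as a function with values in the model space. -/
def vf (Y : VField I M) (p : M) : E := Y p

/-- The covariant derivative as a function with values in the endomorphisms of the model space. -/
def cd (g : MetricField I M) (Y : VField I M) (p : M) : E →L[ℝ] E := covDeriv g Y p

lemma coordMetric_apply (g : MetricField I M) (x : M) (y a b : E) :
    coordMetric g x y a b = bil g ((extChartAt I x).symm y) (fr I x y a) (fr I x y b) := rfl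

lemma vc_eq (Y : VField I M) (x : M) (y : E) :
    vc I Y x y = (fr I x y).inverse (vf Y ((extChartAt I x).symm y)) := rfl

lemma tr_mem_range (x q : M) : MapsTo (tr I x q) (range I) (range I) := fun y _ => by
  simp [tr, extChartAt]

variable [IsManifold I ∞ M]

/-- The coordinate frame at the image of a point is the change of trivialisations of the tangent
bundle. -/
lemma fr_ext {x q : M} (hq : q ∈ (extChartAt I x).source) :
    fr I x (extChartAt I x q) = tangentCoordChange I x q q := by
  have hq' : q ∈ (chartAt H x).source := by rwa [← extChartAt_source I]
  have h1 := TangentBundle.symmL_trivializationAt (I := I) hq'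
  have h2 := TangentBundle.symmL_trivializationAt_eq_core (I := I) hq'
  unfold fr coordFrame
  erw [← h1, h2]

lemma fr_eq {x : M} {y : E} (hy : y ∈ (extChartAt I x).target) :
    fr I x y = tangentCoordChange I x ((extChartAt I x).symm y) ((extChartAt I x).symm y) := by
  rw [← fr_ext ((extChartAt I x).map_target hy), (extChartAt I x).right_inv hy]

lemma fr_self (x : M) : fr I x (extChartAt I x x) = ContinuousLinearMap.id ℝ E := by
  ext v
  rw [fr_ext (mem_extChartAt_source x)]
  exact tangentCoordChange_self (mem_extChartAt_source x)

lemma fr_isInvertible {x : M} {y : E} (hy : y ∈ (extChartAt I x).target) :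
    (fr I x y).IsInvertible := isInvertible_mfderivWithin_extChartAt_symm hy

lemma fr_injective {x : M} {y : E} (hy : y ∈ (extChartAt I x).target) :
    Function.Injective (fr I x y) := (fr_isInvertible hy).bijective.1

/-- The coordinates of a vector field are its coordinates with respect to the coordinate frame. -/
lemma fr_vc (Y : VField I M) {x : M} {y : E} (hy : y ∈ (extChartAt I x).target) :
    fr I x y (vc I Y x y) = vf Y ((extChartAt I x).symm y) := by
  rw [vc_eq]
  obtain ⟨e, he⟩ := fr_isInvertible (I := I) hy
  rw [← he, ContinuousLinearMap.inverse_equiv]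
  exact e.apply_symm_apply _

lemma tr_smooth {x q : M} {y : E} (hy : y ∈ (extChartAt I x).target)
    (hq : (extChartAt I x).symm y ∈ (extChartAt I q).source) :
    ContDiffWithinAt ℝ ∞ (tr I x q) (range I) y := by
  apply contDiffWithinAt_ext_coord_change q x
  simp at *
  tauto

/-- The frames of two charts differ by the differential of the change of charts. -/
lemma fr_change {x q : M} {y : E} (hy : y ∈ (extChartAt I x).target)
    (hq : (extChartAt I x).symm y ∈ (extChartAt I q).source) :
    fr I x y = fr I q (tr I x q y) ∘L fderivWithin ℝ (tr I x q) (range I) y := by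
  have h1 : fderivWithin ℝ (tr I x q) (range I) y =
      tangentCoordChange I x q ((extChartAt I x).symm y) := by
    rw [tangentCoordChange_def, (extChartAt I x).right_inv hy]; rfl
  rw [fr_eq hy, h1]
  change _ = fr I q (extChartAt I q ((extChartAt I x).symm y)) ∘L _
  rw [fr_ext hq]
  ext v
  exact (tangentCoordChange_comp
    ⟨⟨(extChartAt I x).map_target hy, hq⟩, mem_extChartAt_source _⟩).symm

lemma tr_eventually {x q : M} {y : E} (hy : y ∈ (extChartAt I x).target)
    (hq : (extChartAt I x).symm y ∈ (extChartAt I q).source) :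
    ∀ᶠ y' in 𝓝[range I] y, y' ∈ (extChartAt I x).target ∧
      (extChartAt I x).symm y' ∈ (extChartAt I q).source := by
  have h1 := extChartAt_target_mem_nhdsWithin_of_mem hy
  have h2 := (continuousOn_extChartAt_symm (I := I) x y hy)
  have h3 := h2.preimage_mem_nhdsWithin ((isOpen_extChartAt_source (I := I) q).mem_nhds hq)
  rw [nhdsWithin_extChartAt_target_eq_of_mem hy] at h3
  filter_upwards [h1, h3] with y' h h' using ⟨h, h'⟩

lemma symm_tr {x q : M} {y : E}
    (hq : (extChartAt I x).symm y ∈ (extChartAt I q).source) :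
    (extChartAt I q).symm (tr I x q y) = (extChartAt I x).symm y :=
  (extChartAt I q).left_inv hq

lemma tr_mem_target {x q : M} {y : E}
    (hq : (extChartAt I x).symm y ∈ (extChartAt I q).source) :
    tr I x q y ∈ (extChartAt I q).target :=
  (extChartAt I q).map_source hq

lemma coordMetric_change (g : MetricField I M) {x q : M} {y : E} (hy : y ∈ (extChartAt I x).target)
    (hq : (extChartAt I x).symm y ∈ (extChartAt I q).source) (a b : E) :
    coordMetric g x y a b = coordMetric g q (tr I x q y)
      (fderivWithin ℝ (tr I x q) (range I) y a) (fderivWithin ℝ (tr I x q) (range I) y b) := by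
  rw [coordMetric_apply, coordMetric_apply, symm_tr hq, fr_change hy hq]; rfl

lemma vc_change (Y : VField I M) {x q : M} {y : E} (hy : y ∈ (extChartAt I x).target)
    (hq : (extChartAt I x).symm y ∈ (extChartAt I q).source) :
    vc I Y q (tr I x q y) = fderivWithin ℝ (tr I x q) (range I) y (vc I Y x y) := by
  apply fr_injective (tr_mem_target hq)
  rw [fr_vc Y (tr_mem_target hq), ← ContinuousLinearMap.comp_apply, ← fr_change hy hq, fr_vc Y hy,
    symm_tr hq]

lemma vc_smooth {Y : VField I M} {U : Set M} (hU : IsOpen U) (hY : SmoothFieldOn Y U) {x : M}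
    {y : E} (hy : y ∈ (extChartAt I x).target) (hyU : (extChartAt I x).symm y ∈ U) :
    ContDiffWithinAt ℝ ∞ (vc I Y x) (range I) y := by
  apply (contMDiffWithinAt_vectorSpace_iff_contDiffWithinAt (V := vc I Y x)).1
  apply ContMDiffWithinAt.mpullbackWithin_vectorField_of_mem (n := ∞) (t := U) (hY _ hyU)
  · exact (contMDiffOn_extChartAt_symm x y hy).mono_of_mem_nhdsWithin
      (extChartAt_target_mem_nhdsWithin_of_mem hy)
  · exact isInvertible_mfderivWithin_extChartAt_symm hy
  · exact extChartAt_target_subset_range x hy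
  · exact I.uniqueDiffOn.uniqueMDiffOn
  · simp
  · have h2 := (continuousOn_extChartAt_symm (I := I) x y hy)
    have h3 := h2.preimage_mem_nhdsWithin (hU.mem_nhds hyU)
    rwa [nhdsWithin_extChartAt_target_eq_of_mem hy] at h3

/-- The coordinate vector fields of the preferred chart at `x`. -/
def frameField (I : ModelWithCorners ℝ E H) (x : M) (a : E) : VField I M :=
  fun q => fr I x (extChartAt I x q) a

lemma frameField_smooth (x : M) (a : E) :
    SmoothFieldOn (frameField I x a) (extChartAt I x).source := by
  have h : ContMDiffOn (I.prod 𝓘(ℝ, E)) (I.prod 𝓘(ℝ, E)) ∞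
      (trivializationAt E (TangentSpace I) x).toOpenPartialHomeomorph.symm
      (trivializationAt E (TangentSpace I) x).target :=
    Bundle.Trivialization.contMDiffOn_symm _
  have h2 : ContMDiffOn I (I.prod 𝓘(ℝ, E)) ∞ (fun q : M => (q, a)) (extChartAt I x).source :=
    contMDiffOn_id.prodMk contMDiffOn_const
  have h3 := h.comp h2 (fun q hq => by
    rw [extChartAt_source] at hq
    simp [Bundle.Trivialization.target_eq, hq])
  refine h3.congr fun q hq => ?_
  have hq' : q ∈ (chartAt H x).source := by rwa [← extChartAt_source I]
  have h1 := TangentBundle.symmL_trivializationAt (I := I) hq'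
  simp only [Function.comp_apply]
  rw [← Bundle.Trivialization.mk_symm _ (by simpa using hq')]
  congr 1
  exact (congrArg (fun L => L a) h1).symm.trans (Bundle.Trivialization.symmL_apply _
    (by simpa using hq') _)

end Charts

/-! ### The covariant derivative in charts -/

section Charts

variable {E : Type*} [NormedAddCommGroup E] [NormedSpace ℝ E] [FiniteDimensional ℝ E]
  {H : Type*} [TopologicalSpace H] {I : ModelWithCorners ℝ E H}
  {M : Type*} [TopologicalSpace M] [ChartedSpace H M]

/-- The metric field is a smooth Riemannian metric, expressed in charts. -/
def IsSmoothMetric (g : MetricField I M) : Prop :=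
  ∀ x : M, ∀ y ∈ (extChartAt I x).target, IsMetricAt (coordMetric g x) (range I) y

variable [IsManifold I ∞ M]

/-- A metric is smooth in a chart if its coefficients are. -/
lemma isMetricAt_of_contDiffOn {g : MetricField I M} (hsymm : ∀ p a b, bil g p a b = bil g p b a)
    (hpos : ∀ p a, a ≠ 0 → 0 < bil g p a a) {x : M}
    (hsm : ∀ a b, ContDiffOn ℝ ∞ (fun y => coordMetric g x y a b) (extChartAt I x).target)
    {y : E} (hy : y ∈ (extChartAt I x).target) : IsMetricAt (coordMetric g x) (range I) y where
  symm z a b := hsymm _ _ _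
  pos a ha := hpos _ _ (fun h => ha (fr_injective hy (Eq.trans h (map_zero (fr I x y)).symm)))
  smooth := by
    have h : ContDiffOn ℝ ∞ (coordMetric g x) (extChartAt I x).target :=
      contDiffOn_clm_apply.2 fun a => contDiffOn_clm_apply.2 fun b => hsm a b
    exact (h y hy).mono_of_mem_nhdsWithin (extChartAt_target_mem_nhdsWithin_of_mem hy)
  unique := I.uniqueDiffOn
  mem := extChartAt_target_subset_range x hy

lemma isSmoothMetric_contMDiff
    (g : Bundle.ContMDiffRiemannianMetric I ∞ E (fun x : M => TangentSpace I x)) :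
    IsSmoothMetric (I := I) g.inner := by
  intro x y hy
  refine isMetricAt_of_contDiffOn (fun p a b => g.symm p a b) (fun p a ha => g.pos p a ha) ?_ hy
  intro a b
  have h1 : ContMDiffOn I (I.prod 𝓘(ℝ)) ∞
      (fun q => Bundle.TotalSpace.mk' ℝ (E := Bundle.Trivial M ℝ) q
        (g.inner q (frameField I x a q) (frameField I x b q))) (extChartAt I x).source := by
    apply ContMDiffOn.clm_bundle_apply₂ (F₁ := E) (F₂ := E)
    · exact g.contMDiff.contMDiffOn
    · exact frameField_smooth x a
    · exact frameField_smooth x b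
  have h2 : ContMDiffOn I 𝓘(ℝ) ∞ (fun q => g.inner q (frameField I x a q) (frameField I x b q))
      (extChartAt I x).source := by
    intro q hq
    have := h1 q hq
    simp only [Bundle.contMDiffWithinAt_totalSpace] at this
    exact this.2
  have h3 := h2.comp (contMDiffOn_extChartAt_symm (n := ∞) x)
    (fun z hz => (extChartAt I x).map_target hz)
  refine h3.contDiffOn.congr fun z hz => ?_
  simp only [Function.comp_apply, frameField, (extChartAt I x).right_inv hz]
  rfl

lemma coordMetric_self (g : MetricField I M) (p : M) :
    coordMetric g p (extChartAt I p p) = bil g p := by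
  ext a b
  rw [coordMetric_apply, fr_self, extChartAt_to_inv]; rfl

/-- The definition of `curvature` differentiates the components of the Christoffel symbols, that
of `curv` the Christoffel symbols themselves. -/
lemma curvature_eq_curv {g : MetricField I M} (hg : IsSmoothMetric g) (p : M) (a b c : E) :
    (curvature g p a b c : E) =
      curv (chr (coordMetric g p) (range I)) (range I) (extChartAt I p p) a b c := by
  have hG := hg p _ (mem_extChartAt_target p)
  have hΓ := hG.chr_smooth.differentiableWithinAt (n := ∞) (by simp)
  have key : ∀ a b c, fderivWithin ℝ (fun y => chr (coordMetric g p) (range I) y b c)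
      (range I) (extChartAt I p p) a =
      fderivWithin ℝ (chr (coordMetric g p) (range I)) (range I) (extChartAt I p p) a b c := by
    intro a b c
    rw [((hΓ.hasFDerivWithinAt.clm_apply (hasFDerivWithinAt_const b _ _)).clm_apply
      (hasFDerivWithinAt_const c _ _)).fderivWithin (hG.unique _ hG.mem)]
    simp
  rw [HypBdry.curv, ← key, ← key]
  rfl

lemma vc_self (Y : VField I M) (q : M) : vc I Y q (extChartAt I q q) = vf Y q := by
  have h2 := fr_vc Y (mem_extChartAt_target (I := I) q)
  rw [fr_self, extChartAt_to_inv] at h2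
  exact h2

/-- In the preferred chart at the point itself, `covDeriv` is the covariant derivative of the
coordinates, by definition. -/
lemma covDeriv_self (g : MetricField I M) (Y : VField I M) (q : M) (a : E) :
    cd g Y q a = nab (chr (coordMetric g q) (range I)) (range I) id (vc I Y q)
      (extChartAt I q q) a := by
  rw [nab_apply, vc_self, fderivWithin_id (I.uniqueDiffOn _
    (extChartAt_target_subset_range q (mem_extChartAt_target (I := I) q)))]
  rfl

/-- The covariant derivative, defined at `q` by the preferred chart at `q`, can be computed in any
of the preferred charts. This turns the pointwise definition into one in a neighbourhood, which
can be differentiated again. -/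
lemma covDeriv_chart {g : MetricField I M} (hg : IsSmoothMetric g) {Y : VField I M} {U : Set M}
    (hU : IsOpen U) (hY : SmoothFieldOn Y U) {x q : M} {y : E}
    (hy : y ∈ (extChartAt I x).target) (hq : (extChartAt I x).symm y = q) (hqU : q ∈ U) (a : E) :
    cd g Y q (fr I x y a) =
      fr I x y (nab (chr (coordMetric g x) (range I)) (range I) id (vc I Y x) y a) := by
  have hys : (extChartAt I x).symm y ∈ (extChartAt I q).source := by
    rw [hq]; exact mem_extChartAt_source q
  have hyr : y ∈ range I := extChartAt_target_subset_range x hy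
  have hu := I.uniqueDiffOn y hyr
  have hF : tr I x q y = extChartAt I q q := by rw [← hq]; rfl
  have hF1 := tr_smooth hy hys
  have hFd := hF1.differentiableWithinAt (n := ∞) (by simp)
  have hGq : IsMetricAt (coordMetric g q) (range I) (tr I x q y) := hg q _ (tr_mem_target hys)
  have hGx := hg x y hy
  have hfr : fr I x y = fderivWithin ℝ (tr I x q) (range I) y := by
    rw [fr_change hy hys, hF, fr_self, ContinuousLinearMap.id_comp]
  have hF2 : ∀ b, DifferentiableWithinAt ℝ (fun y => fderivWithin ℝ (tr I x q) (range I) y b)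
      (range I) y := fun b =>
    ((hF1.fderivWithin_right (m := 1) I.uniqueDiffOn (by norm_cast) hyr).differentiableWithinAt
      (by simp)).clm_apply (differentiableWithinAt_const b)
  have hX : DifferentiableWithinAt ℝ (vc I Y x) (range I) y :=
    (vc_smooth hU hY hy (by rwa [hq])).differentiableWithinAt (n := ∞) (by simp)
  have hY' : DifferentiableWithinAt ℝ (vc I Y q) (range I) (tr I x q y) :=
    (vc_smooth hU hY (tr_mem_target hys) (by rwa [symm_tr hys, hq])).differentiableWithinAt
      (n := ∞) (by simp)
  -- the transformation law of the Christoffel symbols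
  have hΓ : ∀ b, fderivWithin ℝ (tr I x q) (range I) y
      (chr (coordMetric g x) (range I) y a b) =
      nab (chr (coordMetric g q) (range I)) (range I) (tr I x q)
        (fun y => fderivWithin ℝ (tr I x q) (range I) y b) y a := by
    intro b
    apply metric_ext hGq.pos
    intro c
    obtain ⟨c', rfl⟩ := (fr_isInvertible hy).bijective.2 c
    rw [hfr, ← chrFst_pullback hGq (tr_mem_range x q) I.uniqueDiffOn hyr
      (I.range_subset_closure_interior hyr) hF1 hGx.diff, ← chr_spec hGx.inv,
      coordMetric_change g hy hys]
    filter_upwards [tr_eventually hy hys] with z hz a b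
    exact coordMetric_change g hz.1 hz.2 a b
  have hcomp : fderivWithin ℝ (vc I Y q ∘ tr I x q) (range I) y a =
      fderivWithin ℝ (fun z => fderivWithin ℝ (tr I x q) (range I) z (vc I Y x z))
        (range I) y a := by
    congr 1
    apply Filter.EventuallyEq.fderivWithin_eq_of_mem _ hyr
    filter_upwards [tr_eventually hy hys] with z hz
    exact vc_change Y hz.1 hz.2
  have hF3 : DifferentiableWithinAt ℝ (fderivWithin ℝ (tr I x q) (range I)) (range I) y :=
    (hF1.fderivWithin_right (m := 1) I.uniqueDiffOn (by norm_cast) hyr).differentiableWithinAt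
      (by simp)
  have hF4 : ∀ b, fderivWithin ℝ (fun y => fderivWithin ℝ (tr I x q) (range I) y b)
      (range I) y a = fderivWithin ℝ (fderivWithin ℝ (tr I x q) (range I)) (range I) y a b := by
    intro b
    rw [(hF3.hasFDerivWithinAt.clm_apply (hasFDerivWithinAt_const b y _)).fderivWithin hu]
    simp
  rw [fderivWithin_comp y hY' hFd (tr_mem_range x q) hu,
    (hF3.hasFDerivWithinAt.clm_apply hX.hasFDerivWithinAt).fderivWithin hu] at hcomp
  simp only [ContinuousLinearMap.comp_apply, add_apply, ContinuousLinearMap.flip_apply] at hcomp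
  rw [covDeriv_self, nab_apply, nab_apply, ← hF, hfr, hcomp,
    fderivWithin_id (I.uniqueDiffOn _ (tr_mem_range x q hyr)),
    fderivWithin_id hu, vc_change Y hy hys]
  simp only [id, ContinuousLinearMap.coe_id', map_add]
  rw [hΓ, nab_apply, hF4]
  abel

end Charts

/-! ### The components of the coboundary -/

section Sums

variable {E E' : Type*} [NormedAddCommGroup E] [NormedSpace ℝ E] [NormedAddCommGroup E']
  [NormedSpace ℝ E']
  {Γ : E → E →L[ℝ] E →L[ℝ] E} {t : Set E'} {F : E' → E} {y : E'}

/-- The covariant derivative depends only on the germ of the vector field. -/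
lemma nab_congr {X Y : E' → E} (h : X =ᶠ[𝓝[t] y] Y) (hy : y ∈ t) :
    nab Γ t F X y = nab Γ t F Y y := by
  rw [nab, nab, h.fderivWithin_eq_of_mem hy, h.self_of_nhdsWithin hy]

lemma nab_sum_smul {m : ℕ} {f : Fin m → E' → ℝ} {X : Fin m → E' → E}
    (ht : UniqueDiffWithinAt ℝ t y)
    (hf : ∀ j, DifferentiableWithinAt ℝ (f j) t y) (hX : ∀ j, DifferentiableWithinAt ℝ (X j) t y)
    (a : E') :
    nab Γ t F (fun y => ∑ j, f j y • X j y) y a =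
      ∑ j, (f j y • nab Γ t F (X j) y a + fderivWithin ℝ (f j) t y a • X j y) := by
  have h : fderivWithin ℝ (fun y => ∑ j, f j y • X j y) t y a =
      ∑ j, (f j y • fderivWithin ℝ (X j) t y a + fderivWithin ℝ (f j) t y a • X j y) := by
    rw [(HasFDerivWithinAt.fun_sum fun j _ =>
      (hf j).hasFDerivWithinAt.fun_smul (hX j).hasFDerivWithinAt).fderivWithin ht]
    simp
  rw [nab_apply, h, map_sum, ← Finset.sum_add_distrib]
  refine Finset.sum_congr rfl fun j _ => ?_
  rw [nab_apply, map_smul, smul_add]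
  abel

end Sums

section Vol

variable {M : Type*} [TopologicalSpace M] [ChartedSpace (EuclideanHalfSpace 3) M]
  [IsManifold (𝓡∂ 3) ∞ M]

/-- Euclidean 3-space. -/
abbrev E3 := EuclideanSpace ℝ (Fin 3)

/-- Fields of trilinear forms on the tangent spaces. -/
abbrev TriField (M : Type*) [TopologicalSpace M] [ChartedSpace (EuclideanHalfSpace 3) M] :=
  Π x : M, TangentSpace (𝓡∂ 3) x →L[ℝ] TangentSpace (𝓡∂ 3) x →L[ℝ]
      TangentSpace (𝓡∂ 3) x →L[ℝ] ℝ

/-- A field of trilinear forms as a function with values in the trilinear forms on the model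
space. -/
def tri (vol : TriField M) (p : M) : E3 →L[ℝ] E3 →L[ℝ] E3 →L[ℝ] ℝ := vol p

/-- A field of trilinear forms, in the coordinates of the preferred chart at `x`. -/
def coordTri (vol : TriField M) (x : M) (y : E3) : E3 →L[ℝ] E3 →L[ℝ] E3 →L[ℝ] ℝ :=
  (ContinuousLinearMap.compL ℝ E3 (E3 →L[ℝ] ℝ) (E3 →L[ℝ] ℝ)
    (ContinuousLinearMap.precomp ℝ (fr (𝓡∂ 3) x y))) ∘L
  (ContinuousLinearMap.precomp (E3 →L[ℝ] ℝ) (fr (𝓡∂ 3) x y)) ∘L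
  (tri vol ((extChartAt (𝓡∂ 3) x).symm y)) ∘L (fr (𝓡∂ 3) x y)

lemma coordTri_apply (vol : TriField M) (x : M) (y a b c : E3) :
    coordTri vol x y a b c = tri vol ((extChartAt (𝓡∂ 3) x).symm y)
      (fr (𝓡∂ 3) x y a) (fr (𝓡∂ 3) x y b) (fr (𝓡∂ 3) x y c) := rfl

variable {g : MetricField (𝓡∂ 3) M} {vol : TriField M}

lemma IsVolumeForm.coordTri_unit (hvol : IsVolumeForm g vol) {x : M} (y : E3) :
    IsUnitVolume (coordMetric g x y) (coordTri vol x y) where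
  alt_left a b := by
    rw [coordTri_apply]
    exact hvol.alt_left ((extChartAt (𝓡∂ 3) x).symm y) (fr (𝓡∂ 3) x y a) (fr (𝓡∂ 3) x y b)
  alt_right a b := by
    rw [coordTri_apply]
    exact hvol.alt_right ((extChartAt (𝓡∂ 3) x).symm y) (fr (𝓡∂ 3) x y a) (fr (𝓡∂ 3) x y b)
  unit a b c h1 h2 h3 h4 h5 h6 := by
    rw [coordMetric_apply] at h1 h2 h3 h4 h5 h6
    rw [coordTri_apply]
    exact hvol.unit ((extChartAt (𝓡∂ 3) x).symm y) (fr (𝓡∂ 3) x y a) (fr (𝓡∂ 3) x y b)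
      (fr (𝓡∂ 3) x y c) h1 h2 h3 h4 h5 h6

/-- The definition of a volume form tests smoothness on global vector fields. The coordinate
fields are local, so they are cut off by a bump function. -/
lemma IsVolumeForm.coordTri_smooth [T2Space M] (hvol : IsVolumeForm g vol) {x : M} {y : E3}
    (hy : y ∈ (extChartAt (𝓡∂ 3) x).target) :
    ContDiffWithinAt ℝ ∞ (coordTri vol x) (range (𝓡∂ 3)) y := by
  have key : ∀ a b c, ContDiffOn ℝ ∞ (fun y => coordTri vol x y a b c)
      (extChartAt (𝓡∂ 3) x).target := by
    intro a b c y hy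
    set q := (extChartAt (𝓡∂ 3) x).symm y with hq
    have hqs : q ∈ (extChartAt (𝓡∂ 3) x).source := (extChartAt (𝓡∂ 3) x).map_target hy
    obtain ⟨ρ, -, hρ⟩ := (SmoothBumpFunction.nhds_basis_tsupport (I := 𝓡∂ 3) q).mem_iff.1
      ((isOpen_extChartAt_source (I := 𝓡∂ 3) x).mem_nhds hqs)
    have hX : ∀ a, SmoothFieldOn (fun p => ρ p • frameField (𝓡∂ 3) x a p) univ := by
      intro a
      have := ContMDiffOn.smul_section_of_tsupport (ρ.contMDiff.contMDiffOn)
        (isOpen_extChartAt_source (I := 𝓡∂ 3) x) hρ (frameField_smooth (I := 𝓡∂ 3) x a)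
      exact this.contMDiffOn
    have hsm := hvol.smooth _ _ _ (hX a) (hX b) (hX c)
    have h3 := (hsm.contMDiffOn (s := univ)).comp
      (contMDiffOn_extChartAt_symm (n := ∞) (I := 𝓡∂ 3) x) (fun _ _ => mem_univ _)
    refine (h3.contDiffOn y hy).congr_of_eventuallyEq_of_mem ?_ hy
    have h4 := (continuousOn_extChartAt_symm (I := 𝓡∂ 3) x y hy).eventually ρ.eventuallyEq_one
    filter_upwards [h4, self_mem_nhdsWithin] with z hz hzt
    simp only [Function.comp_apply, hz, Pi.one_apply, one_smul]
    simp only [frameField, (extChartAt (𝓡∂ 3) x).right_inv hzt]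
    rfl
  have h : ContDiffOn ℝ ∞ (coordTri vol x) (extChartAt (𝓡∂ 3) x).target :=
    contDiffOn_clm_apply.2 fun a => contDiffOn_clm_apply.2 fun b =>
      contDiffOn_clm_apply.2 fun c => key a b c
  exact (h y hy).mono_of_mem_nhdsWithin (extChartAt_target_mem_nhdsWithin_of_mem hy)

lemma bil_cross (hg : IsSmoothMetric g) (p : M) (a b c : E3) :
    bil g p (cross g vol p a b : E3) c = tri vol p a b c := by
  have h := (hg p _ (mem_extChartAt_target p)).inv
  rw [coordMetric_self] at h
  have h3 : ((cross g vol p a b : E3) : E3) = (bil g p).inverse (tri vol p a b) := rfl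
  rw [h3, metric_inverse_apply h]

lemma coordTri_self (vol : TriField M) (p : M) :
    coordTri vol p (extChartAt (𝓡∂ 3) p p) = tri vol p := by
  ext a b c
  rw [coordTri_apply, fr_self, extChartAt_to_inv]; rfl

lemma IsHyperbolic.curv (hh : IsHyperbolic g) (hg : IsSmoothMetric g) (p : M) (a b c : E3) :
    curv (chr (coordMetric g p) (range (𝓡∂ 3))) (range (𝓡∂ 3)) (extChartAt (𝓡∂ 3) p p) a b c =
      bil g p a c • b - bil g p b c • a :=
  (curvature_eq_curv hg p a b c).symm.trans (hh p a b c)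

lemma finrank_E3 : Module.finrank ℝ E3 = 3 := by simp

lemma eventually_target (p : M) : ∀ᶠ y in 𝓝[range (𝓡∂ 3)] (extChartAt (𝓡∂ 3) p p),
    y ∈ (extChartAt (𝓡∂ 3) p).target := extChartAt_target_mem_nhdsWithin p

lemma eventually_symm_mem {p : M} {U : Set M} (hU : IsOpen U) (hp : p ∈ U) :
    ∀ᶠ y in 𝓝[range (𝓡∂ 3)] (extChartAt (𝓡∂ 3) p p), (extChartAt (𝓡∂ 3) p).symm y ∈ U := by
  have h2 := (continuousOn_extChartAt_symm (I := 𝓡∂ 3) p _ (mem_extChartAt_target p))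
  have h3 := h2.preimage_mem_nhdsWithin (hU.mem_nhds (by rwa [extChartAt_to_inv]))
  rwa [nhdsWithin_extChartAt_target_eq_of_mem (mem_extChartAt_target p)] at h3

/-- The derivative of the rotation part `W` of an infinitesimal isometry `K` is
`∇_a W = a × K`. -/
lemma rotationPart_deriv [T2Space M] (hg : IsSmoothMetric g) (hh : IsHyperbolic g)
    (hvol : IsVolumeForm g vol)
    {U : Set M} (hU : IsOpen U) {K W : VField (𝓡∂ 3) M} (hK : IsKillingOn g U K)
    (hW : IsRotationPart g vol U K W) {p : M} (hp : p ∈ U) :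
    DifferentiableWithinAt ℝ (vc (𝓡∂ 3) W p) (range (𝓡∂ 3)) (extChartAt (𝓡∂ 3) p p) ∧
    ∀ a c, bil g p (cd g W p a) c = tri vol p a (vf K p) c := by
  set z := extChartAt (𝓡∂ 3) p p with hz
  have hzt := mem_extChartAt_target (I := 𝓡∂ 3) p
  have hzr : z ∈ range (𝓡∂ 3) := extChartAt_target_subset_range p hzt
  have := killing_rotation (G := coordMetric g p) (V := coordTri vol p) (s := range (𝓡∂ 3))
    (z := z) (k := vc (𝓡∂ 3) K p) (w := vc (𝓡∂ 3) W p) finrank_E3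
    (by filter_upwards [eventually_target p] with y hy using hg p y hy)
    (by filter_upwards with y using hvol.coordTri_unit y)
    hzr ((𝓡∂ 3).range_subset_closure_interior hzr)
    ((hvol.coordTri_smooth hzt).differentiableWithinAt (by simp))
    (by rw [coordMetric_self]; exact hh.curv hg p)
    (vc_smooth hU hK.smooth hzt (by rwa [extChartAt_to_inv]))
    (by
      filter_upwards [eventually_target p, eventually_symm_mem hU hp] with y hy hyU a c
      have h1 := covDeriv_chart hg hU hK.smooth hy rfl hyU a
      rw [coordMetric_apply, ← h1, coordTri_apply, fr_vc W hy]
      have h2 : cd g K ((extChartAt (𝓡∂ 3) p).symm y) (fr (𝓡∂ 3) p y a) = _ :=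
        hW _ hyU (fr (𝓡∂ 3) p y a)
      rw [h2]
      exact bil_cross hg _ _ _ _)
  refine ⟨this.1, fun a c => ?_⟩
  rw [cd, ← vc_self K, ← coordMetric_self, ← coordTri_self, ← this.2]
  congr 2
  exact covDeriv_self g W p a

lemma mvfderiv_eq {f : M → ℝ} {p : M} (hf : MDifferentiableAt (𝓡∂ 3) 𝓘(ℝ, ℝ) f p) (a : E3) :
    mvfderiv (𝓡∂ 3) f p a = fderivWithin ℝ (f ∘ (extChartAt (𝓡∂ 3) p).symm) (range (𝓡∂ 3))
      (extChartAt (𝓡∂ 3) p p) a := by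
  simp only [mvfderiv, mfderiv, hf]
  rfl

/-- The Leibniz rule for the covariant derivative of a combination of vector fields. -/
lemma cd_sum_smul {u : VField (𝓡∂ 3) M} {U : Set M} (hU : IsOpen U) {p : M} (hp : p ∈ U) {m : ℕ}
    {K : Fin m → VField (𝓡∂ 3) M} {f : Fin m → M → ℝ}
    (hf : ∀ j, ContMDiffOn (𝓡∂ 3) 𝓘(ℝ, ℝ) ∞ (f j) U)
    (hu : ∀ q ∈ U, u q = ∑ j, f j q • K j q)
    (hK : ∀ j, DifferentiableWithinAt ℝ (vc (𝓡∂ 3) (K j) p) (range (𝓡∂ 3))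
      (extChartAt (𝓡∂ 3) p p)) (a : E3) :
    cd g u p a = ∑ j, (f j p • cd g (K j) p a + mvfderiv (𝓡∂ 3) (f j) p a • vf (K j) p) := by
  have hzt := mem_extChartAt_target (I := 𝓡∂ 3) p
  have hzr := extChartAt_target_subset_range p hzt
  have hfm : ∀ j, MDifferentiableAt (𝓡∂ 3) 𝓘(ℝ, ℝ) (f j) p := fun j =>
    ((hf j).contMDiffAt (hU.mem_nhds hp)).mdifferentiableAt (by simp)
  have hfd : ∀ j, DifferentiableWithinAt ℝ (f j ∘ (extChartAt (𝓡∂ 3) p).symm) (range (𝓡∂ 3))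
      (extChartAt (𝓡∂ 3) p p) := fun j => by
    have := (mdifferentiableAt_iff _ _).1 (hfm j)
    exact this.2
  rw [covDeriv_self]
  have h1 : vc (𝓡∂ 3) u p =ᶠ[𝓝[range (𝓡∂ 3)] (extChartAt (𝓡∂ 3) p p)]
      fun y => ∑ j, (f j ∘ (extChartAt (𝓡∂ 3) p).symm) y • vc (𝓡∂ 3) (K j) p y := by
    filter_upwards [eventually_symm_mem hU hp] with y hy
    rw [vc_eq]
    have : vf u ((extChartAt (𝓡∂ 3) p).symm y) =
      ∑ j, f j ((extChartAt (𝓡∂ 3) p).symm y) • vf (K j) ((extChartAt (𝓡∂ 3) p).symm y) := hu _ hy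
    rw [this, map_sum]
    simp only [map_smul]
    rfl
  rw [nab_congr h1 hzr, nab_sum_smul ((𝓡∂ 3).uniqueDiffOn _ hzr) hfd hK]
  refine Finset.sum_congr rfl fun j _ => ?_
  rw [vc_self, mvfderiv_eq (hfm j), covDeriv_self, Function.comp_apply,
    extChartAt_to_inv]

/-- The components of `d_E s` are `η = ∇ u - u' ×` and `η' = ∇ u' + u ×`: both sides of each
equation satisfy the same Leibniz rule, and on parallel sections both vanish because `∇ K = W ×`
and `∇ W = -K ×`. -/
lemma IsCoboundary.eq [T2Space M] (hg : IsSmoothMetric g) (hh : IsHyperbolic g)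
    (hvol : IsVolumeForm g vol) {u u' : VField (𝓡∂ 3) M}
    {η η' : Π x : M, TangentSpace (𝓡∂ 3) x →L[ℝ] TangentSpace (𝓡∂ 3) x}
    (hη : IsCoboundary g vol u u' η η') (p : M) (a c : E3) :
    bil g p (η p a : E3) c = bil g p (cd g u p a) c - tri vol p (vf u' p) a c ∧
    bil g p (η' p a : E3) c = bil g p (cd g u' p a) c + tri vol p (vf u p) a c := by
  obtain ⟨U, hU, hp, m, K, W, f, hK, hW, hf, hu, hη⟩ := hη p
  have hrot := fun j => rotationPart_deriv hg hh hvol hU (hK j) (hW j) hp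
  have hzt := mem_extChartAt_target (I := 𝓡∂ 3) p
  have hKd : ∀ j, DifferentiableWithinAt ℝ (vc (𝓡∂ 3) (K j) p) (range (𝓡∂ 3))
      (extChartAt (𝓡∂ 3) p p) := fun j =>
    (vc_smooth hU (hK j).smooth hzt (by rwa [extChartAt_to_inv])).differentiableWithinAt
      (n := ∞) (by simp)
  have h1 := cd_sum_smul (g := g) hU hp hf (fun q hq => (hu q hq).1) hKd a
  have h2 := cd_sum_smul (g := g) hU hp hf (fun q hq => (hu q hq).2) (fun j => (hrot j).1) a
  have e1 : (η p a : E3) = ∑ j, mvfderiv (𝓡∂ 3) (f j) p a • vf (K j) p := (hη a).1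
  have e2 : (η' p a : E3) = ∑ j, mvfderiv (𝓡∂ 3) (f j) p a • vf (W j) p := (hη a).2
  have u1 : vf u p = ∑ j, f j p • vf (K j) p := (hu p hp).1
  have u2 : vf u' p = ∑ j, f j p • vf (W j) p := (hu p hp).2
  have hcd : ∀ j, bil g p (cd g (K j) p a) c = tri vol p (vf (W j) p) a c := fun j => by
    have : cd g (K j) p a = _ := hW j p hp a
    rw [this]
    exact bil_cross hg _ _ _ _
  have hcd' : ∀ j, bil g p (cd g (W j) p a) c = - tri vol p (vf (K j) p) a c := fun j => by
    rw [(hrot j).2]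
    exact alt_swap_left (T := tri vol p) (hvol.alt_left p) _ _ _
  rw [h1, h2, e1, e2, u1, u2]
  simp only [map_sum, map_add, map_smul, sum_apply, add_apply, smul_apply,
    smul_eq_mul, hcd, hcd', Finset.sum_add_distrib]
  constructor
  · ring
  · simp only [mul_neg, Finset.sum_neg_distrib]; ring

end Vol

/-! ### The inclusion of the boundary in charts -/

section Boundary

variable {M : Type*} [TopologicalSpace M] [ChartedSpace (EuclideanHalfSpace 3) M]
  [IsManifold (𝓡∂ 3) ∞ M]
  {B : Type*} [TopologicalSpace B] [ChartedSpace (EuclideanSpace ℝ (Fin 2)) B]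
  [IsManifold (𝓡 2) ∞ B]

/-- Euclidean 2-space. -/
abbrev E2 := EuclideanSpace ℝ (Fin 2)

/-- The map `ι`, in the preferred charts at `x` and `p`. -/
def bF (ι : B → M) (x : B) (p : M) : E2 → E3 :=
  extChartAt (𝓡∂ 3) p ∘ ι ∘ (extChartAt (𝓡 2) x).symm

/-- The open set on which `bF` is the coordinate expression of `ι`. -/
def bT (ι : B → M) (x : B) (p : M) : Set E2 :=
  {y | y ∈ (extChartAt (𝓡 2) x).target ∧ ι ((extChartAt (𝓡 2) x).symm y) ∈
    (extChartAt (𝓡∂ 3) p).source}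

/-- The differential of `ι`, as a map of the model spaces. -/
def di (ι : B → M) (x : B) : E2 →L[ℝ] E3 := dincl ι x

lemma isOpen_target2 (x : B) : IsOpen (extChartAt (𝓡 2) x).target :=
  isOpen_extChartAt_target x

lemma bF_mem_range (ι : B → M) (x : B) (p : M) (t : Set E2) :
    MapsTo (bF ι x p) t (range (𝓡∂ 3)) := fun y _ => by
  simp [bF, extChartAt]

variable {ι : B → M}

lemma bF_symm {x : B} {p : M} {y : E2} (hy : y ∈ bT ι x p) :
    (extChartAt (𝓡∂ 3) p).symm (bF ι x p y) = ι ((extChartAt (𝓡 2) x).symm y) :=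
  (extChartAt (𝓡∂ 3) p).left_inv hy.2

lemma bF_mem_target {x : B} {p : M} {y : E2} (hy : y ∈ bT ι x p) :
    bF ι x p y ∈ (extChartAt (𝓡∂ 3) p).target :=
  (extChartAt (𝓡∂ 3) p).map_source hy.2

lemma isOpen_bT (hι : IsBoundaryInclusion ι) (x : B) (p : M) : IsOpen (bT ι x p) := by
  have h : ContinuousOn (ι ∘ (extChartAt (𝓡 2) x).symm) (extChartAt (𝓡 2) x).target :=
    hι.smooth.continuous.comp_continuousOn (continuousOn_extChartAt_symm x)
  exact h.isOpen_inter_preimage (isOpen_target2 x) (isOpen_extChartAt_source p)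

lemma bF_smooth (hι : IsBoundaryInclusion ι) {x : B} {p : M} {y : E2} (hy : y ∈ bT ι x p) :
    ContDiffAt ℝ ∞ (bF ι x p) y := by
  have h1 : ContMDiffOn 𝓘(ℝ, E2) (𝓡∂ 3) ∞ (ι ∘ (extChartAt (𝓡 2) x).symm)
      (bT ι x p) := by
    refine hι.smooth.comp_contMDiffOn ?_
    exact (contMDiffOn_extChartAt_symm (n := ∞) x).mono (fun y hy => hy.1)
  have h2 : ContMDiffOn 𝓘(ℝ, E2) 𝓘(ℝ, E3) ∞ (bF ι x p) (bT ι x p) := by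
    refine (contMDiffOn_extChartAt (n := ∞) (I := 𝓡∂ 3) (x := p)).comp h1 fun y hy => ?_
    have := hy.2
    rwa [extChartAt_source] at this
  exact h2.contDiffOn.contDiffAt ((isOpen_bT hι x p).mem_nhds hy)

/-- The differential of `ι` in the frames of the charts is the differential of `bF`. -/
lemma di_fr (hι : IsBoundaryInclusion ι) {x : B} {p : M} {y : E2} (hy : y ∈ bT ι x p) (a : E2) :
    di ι ((extChartAt (𝓡 2) x).symm y) (fr (𝓡 2) x y a) =
      fr (𝓡∂ 3) p (bF ι x p y) (fderivWithin ℝ (bF ι x p) univ y a) := by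
  have hB : MDifferentiableAt 𝓘(ℝ, E2) (𝓡 2) (extChartAt (𝓡 2) x).symm y :=
    ((contMDiffOn_extChartAt_symm (n := ∞) x).contMDiffAt
      ((isOpen_target2 x).mem_nhds hy.1)).mdifferentiableAt (by simp)
  have hι' : MDifferentiableAt (𝓡 2) (𝓡∂ 3) ι ((extChartAt (𝓡 2) x).symm y) :=
    hι.smooth.contMDiffAt.mdifferentiableAt (by simp)
  have h1 := mfderiv_comp y hι' hB
  have hM : MDifferentiableWithinAt 𝓘(ℝ, E3) (𝓡∂ 3) (extChartAt (𝓡∂ 3) p).symm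
      (range (𝓡∂ 3)) (bF ι x p y) := mdifferentiableWithinAt_extChartAt_symm (bF_mem_target hy)
  have hF : MDifferentiableWithinAt 𝓘(ℝ, E2) 𝓘(ℝ, E3) (bF ι x p) univ y :=
    ((bF_smooth hι hy).differentiableAt (by simp)).mdifferentiableAt.mdifferentiableWithinAt
  have h2 := mfderivWithin_comp y hM hF (bF_mem_range ι x p univ)
    (uniqueMDiffWithinAt_univ 𝓘(ℝ, E2))
  have h3 : mfderivWithin 𝓘(ℝ, E2) (𝓡∂ 3) ((extChartAt (𝓡∂ 3) p).symm ∘ bF ι x p) univ y =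
      mfderiv 𝓘(ℝ, E2) (𝓡∂ 3) (ι ∘ (extChartAt (𝓡 2) x).symm) y := by
    rw [mfderivWithin_univ]
    apply Filter.EventuallyEq.mfderiv_eq
    filter_upwards [(isOpen_bT hι x p).mem_nhds hy] with z hz using bF_symm hz
  have h4 : fr (𝓡 2) x y = mfderiv 𝓘(ℝ, E2) (𝓡 2) (extChartAt (𝓡 2) x).symm y := by
    unfold fr coordFrame
    rw [modelWithCornersSelf_coe, range_id, mfderivWithin_univ]
  rw [mfderivWithin_eq_fderivWithin] at h2
  have h5 := congrArg (fun L : E2 →L[ℝ] E3 => L a) (h2.symm.trans (h3.trans h1))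
  rw [h4]
  exact h5.symm

end Boundary

/-! ### Forms on an oriented surface -/

section Surface

variable {B : Type*} [TopologicalSpace B] [ChartedSpace (EuclideanSpace ℝ (Fin 2)) B]

lemma range2 : range (𝓡 2) = univ := by rw [modelWithCornersSelf_coe, range_id]

/-- The 1-form `α`, in the coordinates of the preferred chart at `x`. -/
def lf (α : OneForm B) (x : B) (y : E2) : E2 →L[ℝ] ℝ :=
  (show E2 →L[ℝ] ℝ from α ((extChartAt (𝓡 2) x).symm y)) ∘L fr (𝓡 2) x y

/-- The value of a 1-form, as a linear form on the model space. -/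
def vl (α : OneForm B) (x : B) : E2 →L[ℝ] ℝ := α x

lemma lf_apply (α : OneForm B) (x : B) (y a : E2) :
    lf α x y a = vl α ((extChartAt (𝓡 2) x).symm y) (fr (𝓡 2) x y a) := rfl

/-- Smooth functions on the surface, expressed in charts. -/
def Smooth0 (f : B → ℝ) : Prop :=
  ∀ x : B, ∀ y ∈ (extChartAt (𝓡 2) x).target,
    ContDiffAt ℝ ∞ (fun y => f ((extChartAt (𝓡 2) x).symm y)) y

/-- Smooth 1-forms on the surface, expressed in charts. -/
def Smooth1 (α : OneForm B) : Prop :=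
  ∀ x : B, ∀ y ∈ (extChartAt (𝓡 2) x).target, ContDiffAt ℝ ∞ (lf α x) y

lemma Smooth0.add {f k : B → ℝ} (hf : Smooth0 f) (hk : Smooth0 k) :
    Smooth0 (fun x => f x + k x) := fun x y hy => (hf x y hy).add (hk x y hy)

lemma Smooth0.sub {f k : B → ℝ} (hf : Smooth0 f) (hk : Smooth0 k) :
    Smooth0 (fun x => f x - k x) := fun x y hy => (hf x y hy).sub (hk x y hy)

lemma Smooth0.mul {f k : B → ℝ} (hf : Smooth0 f) (hk : Smooth0 k) :
    Smooth0 (fun x => f x * k x) := fun x y hy => (hf x y hy).mul (hk x y hy)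

lemma Smooth0.neg {f : B → ℝ} (hf : Smooth0 f) :
    Smooth0 (fun x => - f x) := fun x y hy => (hf x y hy).neg

lemma Smooth0.const (c : ℝ) : Smooth0 (fun _ : B => c) := fun _ _ _ => contDiffAt_const

lemma Smooth1.add {α β : OneForm B} (hα : Smooth1 α) (hβ : Smooth1 β) :
    Smooth1 (fun x => α x + β x) := fun x y hy => (hα x y hy).add (hβ x y hy)

lemma Smooth1.sub {α β : OneForm B} (hα : Smooth1 α) (hβ : Smooth1 β) :
    Smooth1 (fun x => α x - β x) := fun x y hy => (hα x y hy).sub (hβ x y hy)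

lemma Smooth1.neg {α : OneForm B} (hα : Smooth1 α) :
    Smooth1 (fun x => - α x) := fun x y hy => (hα x y hy).neg

lemma Smooth1.smul {f : B → ℝ} {α : OneForm B} (hf : Smooth0 f) (hα : Smooth1 α) :
    Smooth1 (fun x => f x • α x) := fun x y hy => (hf x y hy).smul (hα x y hy)

lemma d1_apply (α : OneForm B) (x : B) (a b : E2) :
    d1 α x a b = fderiv ℝ (lf α x) (extChartAt (𝓡 2) x x) a b -
      fderiv ℝ (lf α x) (extChartAt (𝓡 2) x x) b a := rfl

variable [IsManifold (𝓡 2) ∞ B]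

lemma Smooth0.continuous {f : B → ℝ} (hf : Smooth0 f) : Continuous f := by
  rw [continuous_iff_continuousAt]
  intro x
  have h1 := (hf x _ (mem_extChartAt_target x)).continuousAt.comp
    (continuousAt_extChartAt (I := 𝓡 2) x)
  refine h1.congr ?_
  filter_upwards [extChartAt_source_mem_nhds (I := 𝓡 2) x] with z hz
  simp only [Function.comp_apply, (extChartAt (𝓡 2) x).left_inv hz]

lemma d0_apply {f : B → ℝ} (hf : Smooth0 f) (x : B) (a : E2) :
    d0 f x a = fderiv ℝ (fun y => f ((extChartAt (𝓡 2) x).symm y)) (extChartAt (𝓡 2) x x) a := by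
  have h : MDifferentiableAt (𝓡 2) 𝓘(ℝ, ℝ) f x := by
    rw [mdifferentiableAt_iff]
    refine ⟨hf.continuous.continuousAt, ?_⟩
    exact ((hf x _ (mem_extChartAt_target x)).differentiableAt (by simp)).differentiableWithinAt
  simp only [d0, mvfderiv, mfderiv, h]
  rw [← fderivWithin_univ, ← range2]
  rfl

lemma fr_change2 {x q : B} {y : E2} (hy : y ∈ (extChartAt (𝓡 2) x).target)
    (hq : (extChartAt (𝓡 2) x).symm y ∈ (extChartAt (𝓡 2) q).source) (a : E2) :
    fr (𝓡 2) x y a = fr (𝓡 2) q (tr (𝓡 2) x q y) (fderiv ℝ (tr (𝓡 2) x q) y a) := by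
  rw [fr_change hy hq, range2, fderivWithin_univ]; rfl

lemma tr_smooth2 {x q : B} {y : E2} (hy : y ∈ (extChartAt (𝓡 2) x).target)
    (hq : (extChartAt (𝓡 2) x).symm y ∈ (extChartAt (𝓡 2) q).source) :
    ContDiffAt ℝ ∞ (tr (𝓡 2) x q) y := by
  have := tr_smooth (I := 𝓡 2) hy hq
  rwa [range2, contDiffWithinAt_univ] at this

lemma tr_eventually2 {x q : B} {y : E2} (hy : y ∈ (extChartAt (𝓡 2) x).target)
    (hq : (extChartAt (𝓡 2) x).symm y ∈ (extChartAt (𝓡 2) q).source) :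
    ∀ᶠ y' in 𝓝 y, y' ∈ (extChartAt (𝓡 2) x).target ∧
      (extChartAt (𝓡 2) x).symm y' ∈ (extChartAt (𝓡 2) q).source := by
  have := tr_eventually (I := 𝓡 2) hy hq
  rwa [range2, nhdsWithin_univ] at this

lemma lf_change (α : OneForm B) {x q : B} {y : E2} (hy : y ∈ (extChartAt (𝓡 2) x).target)
    (hq : (extChartAt (𝓡 2) x).symm y ∈ (extChartAt (𝓡 2) q).source) (a : E2) :
    lf α x y a = lf α q (tr (𝓡 2) x q y) (fderiv ℝ (tr (𝓡 2) x q) y a) := by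
  rw [lf_apply, lf_apply, symm_tr hq, fr_change2 hy hq]

lemma fderiv_apply_const {f : E2 → E2 →L[ℝ] ℝ} {y : E2} (hf : DifferentiableAt ℝ f y) (a b : E2) :
    fderiv ℝ f y a b = fderiv ℝ (fun y => f y b) y a := by
  rw [(hf.hasFDerivAt.clm_apply (hasFDerivAt_const b y)).fderiv]
  simp

/-- The exterior derivative, defined at a point by the preferred chart there, can be computed in
any of the preferred charts. -/
lemma d1_chart {α : OneForm B} (hα : Smooth1 α) {x : B} {y : E2}
    (hy : y ∈ (extChartAt (𝓡 2) x).target) (a b : E2) :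
    d1 α ((extChartAt (𝓡 2) x).symm y) (fr (𝓡 2) x y a) (fr (𝓡 2) x y b) =
      fderiv ℝ (lf α x) y a b - fderiv ℝ (lf α x) y b a := by
  set q := (extChartAt (𝓡 2) x).symm y with hq
  have hqs : (extChartAt (𝓡 2) x).symm y ∈ (extChartAt (𝓡 2) q).source := mem_extChartAt_source q
  have hF : tr (𝓡 2) x q y = extChartAt (𝓡 2) q q := rfl
  have hT := tr_smooth2 hy hqs
  have hT1 := hT.differentiableAt (n := ∞) (by simp)
  have hT2 : DifferentiableAt ℝ (fderiv ℝ (tr (𝓡 2) x q)) y :=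
    (hT.fderiv_right (m := 1) (by norm_cast)).differentiableAt (by simp)
  have hα1 := (hα q (tr (𝓡 2) x q y) (mem_extChartAt_target q)).differentiableAt (n := ∞) (by simp)
  have hfr : ∀ a, fr (𝓡 2) x y a = fderiv ℝ (tr (𝓡 2) x q) y a := fun a => by
    rw [fr_change2 hy hqs, hF, fr_self]; rfl
  have key : ∀ a b, fderiv ℝ (lf α x) y a b =
      fderiv ℝ (lf α q) (tr (𝓡 2) x q y) (fderiv ℝ (tr (𝓡 2) x q) y a)
        (fderiv ℝ (tr (𝓡 2) x q) y b) +
      lf α q (tr (𝓡 2) x q y) (fderiv ℝ (fderiv ℝ (tr (𝓡 2) x q)) y a b) := by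
    intro a b
    rw [fderiv_apply_const ((hα x y hy).differentiableAt (by simp))]
    have h1 : (fun y => lf α x y b) =ᶠ[𝓝 y]
        fun z => lf α q (tr (𝓡 2) x q z) (fderiv ℝ (tr (𝓡 2) x q) z b) := by
      filter_upwards [tr_eventually2 hy hqs] with z hz using lf_change α hz.1 hz.2 b
    have h2 := ((hα1.hasFDerivAt.comp y hT1.hasFDerivAt).clm_apply
      (hT2.hasFDerivAt.clm_apply (hasFDerivAt_const b y))).fderiv
    simp only [Function.comp_apply] at h2
    rw [h1.fderiv_eq, h2]
    simp
    ring
  -- the terms with second derivatives of the change of charts cancel by symmetry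
  have hsymm : fderiv ℝ (fderiv ℝ (tr (𝓡 2) x q)) y a b =
      fderiv ℝ (fderiv ℝ (tr (𝓡 2) x q)) y b a :=
    (hT.isSymmSndFDerivAt (by simpa using by norm_cast)).eq a b
  rw [key, key, hfr, hfr, hsymm, d1_apply, ← hF]
  ring

lemma d1_add {α β : OneForm B} (hα : Smooth1 α) (hβ : Smooth1 β) (x : B) (a b : E2) :
    d1 (fun x => α x + β x) x a b = d1 α x a b + d1 β x a b := by
  have hx := mem_extChartAt_target (I := 𝓡 2) x
  have h : fderiv ℝ (lf (fun x => α x + β x) x) (extChartAt (𝓡 2) x x) =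
      fderiv ℝ (lf α x) (extChartAt (𝓡 2) x x) + fderiv ℝ (lf β x) (extChartAt (𝓡 2) x x) :=
    fderiv_fun_add ((hα x _ hx).differentiableAt (by simp)) ((hβ x _ hx).differentiableAt (by simp))
  rw [d1_apply, d1_apply, d1_apply, h]
  simp only [add_apply]
  ring

lemma d1_smul {f : B → ℝ} {α : OneForm B} (hf : Smooth0 f) (hα : Smooth1 α) (x : B) (a b : E2) :
    d1 (fun x => f x • α x) x a b =
      d0 f x a * vl α x b - d0 f x b * vl α x a + f x * d1 α x a b := by
  have hx := mem_extChartAt_target (I := 𝓡 2) x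
  have h : fderiv ℝ (lf (fun x => f x • α x) x) (extChartAt (𝓡 2) x x) = _ :=
    fderiv_fun_smul (𝕜 := ℝ) ((hf x _ hx).differentiableAt (by simp))
      ((hα x _ hx).differentiableAt (by simp))
  have h2 : lf α x (extChartAt (𝓡 2) x x) = vl α x := by
    ext a
    rw [lf_apply, fr_self, extChartAt_to_inv]; rfl
  rw [d1_apply, d1_apply, d0_apply hf, d0_apply hf, h, h2, extChartAt_to_inv]
  simp
  ring

/-- The linear map `J` is the rotation by a right angle for the inner product `g` of the plane,
and `f1`, `f2` is an oriented orthonormal frame. -/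
structure RotFrame (g : E2 →L[ℝ] E2 →L[ℝ] ℝ) (J : E2 →L[ℝ] E2) (f1 f2 : E2) : Prop where
  h11 : g f1 f1 = 1
  h12 : g f1 f2 = 0
  h21 : g f2 f1 = 0
  h22 : g f2 f2 = 1
  J1 : J f1 = f2
  J2 : J f2 = -f1
  expand : ∀ a, a = g a f1 • f1 + g a f2 • f2

section
variable {g : E2 →L[ℝ] E2 →L[ℝ] ℝ} {J : E2 →L[ℝ] E2} {f1 f2 : E2}

lemma RotFrame.area (h : RotFrame g J f1 f2) (a b : E2) :
    g (J a) b = g a f1 * g b f2 - g a f2 * g b f1 := by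
  conv_lhs => rw [h.expand a, h.expand b]
  simp [h.h11, h.h12, h.h21, h.h22, h.J1, h.J2]
  ring

lemma RotFrame.sq (h : RotFrame g J f1 f2) (a : E2) : J (J a) = -a := by
  rw [h.expand a]
  simp [h.J1, h.J2]
  abel

lemma RotFrame.inner (h : RotFrame g J f1 f2) (a b : E2) :
    g a b = g a f1 * g b f1 + g a f2 * g b f2 := by
  conv_lhs => rw [h.expand a, h.expand b]
  simp [h.h11, h.h12, h.h21, h.h22]

/-- An alternating form on the plane is a multiple of the area form. -/
lemma RotFrame.alt (h : RotFrame g J f1 f2) (β : E2 →L[ℝ] E2 →L[ℝ] ℝ) (a b : E2) :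
    β a b - β b a = g (J a) b * (β f1 f2 - β f2 f1) := by
  rw [h.area]
  conv_lhs => rw [h.expand a, h.expand b]
  simp
  ring

/-- The area of the coordinate parallelogram, the denominator in `star2`, does not vanish. -/
lemma RotFrame.area_ne_zero (h : RotFrame g J f1 f2) :
    g (J (EuclideanSpace.single 0 1)) (EuclideanSpace.single 1 1) ≠ 0 := by
  rw [h.area]
  set e0 : E2 := EuclideanSpace.single 0 1 with he0
  set e1 : E2 := EuclideanSpace.single 1 1 with he1
  intro h0
  have k1 : g e1 f2 • e0 - g e0 f2 • e1 = 0 := by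
    have : g e1 f2 • e0 - g e0 f2 • e1 =
        (g e0 f1 * g e1 f2 - g e0 f2 * g e1 f1) • f1 := by
      conv_lhs => rw [h.expand e0, h.expand e1]
      simp [h.h12, h.h22]
      module
    rw [this, h0, zero_smul]
  have k2 : g e1 f1 • e0 - g e0 f1 • e1 = 0 := by
    have : g e1 f1 • e0 - g e0 f1 • e1 =
        -(g e0 f1 * g e1 f2 - g e0 f2 * g e1 f1) • f2 := by
      conv_lhs => rw [h.expand e0, h.expand e1]
      simp [h.h11, h.h21]
      module
    rw [this, h0, neg_zero, zero_smul]
  have j1 := congrArg (fun v : E2 => v 0) k1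
  have j2 := congrArg (fun v : E2 => v 0) k2
  simp [he0, he1] at j1 j2
  have := h.expand e1
  rw [he1, j1, j2] at this
  have := congrArg (fun v : E2 => v 1) this
  simp at this

end

/-- An endomorphism field as a function with values in the endomorphisms of the model space. -/
def en (J : EndField B) (x : B) : E2 →L[ℝ] E2 := J x

/-- `J` is the rotation by a right angle for the metric `gB`: at each point there is an
orthonormal frame `f1`, `f2 = J f1`. -/
def IsRot (gB : MetricField (𝓡 2) B) (J : EndField B) : Prop :=
  ∀ x, ∃ f1 f2, RotFrame (bil gB x) (en J x) f1 f2

variable {gB : MetricField (𝓡 2) B} {J : EndField B}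

/-- An alternating form is its star times the area form. -/
lemma star2_mul (hJ : IsRot gB J) {θ : TwoForm B} {x : B} {β : E2 →L[ℝ] E2 →L[ℝ] ℝ}
    (hβ : ∀ a b : E2, θ x a b = β a b - β b a) (a b : E2) :
    θ x a b = star2 gB J θ x * bil gB x (en J x a) b := by
  obtain ⟨f1, f2, hf⟩ := hJ x
  have h0 := hf.area_ne_zero
  have h1 : star2 gB J θ x = (β (EuclideanSpace.single 0 1) (EuclideanSpace.single 1 1) -
      β (EuclideanSpace.single 1 1) (EuclideanSpace.single 0 1)) /
      bil gB x (en J x (EuclideanSpace.single 0 1)) (EuclideanSpace.single 1 1) := by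
    rw [← hβ]; rfl
  rw [h1, hf.alt, hβ, hf.alt]
  rw [mul_div_cancel_left₀ _ h0, mul_comm]

/-- In an oriented orthonormal frame the star of a 2-form is its value on the frame; the frame
need not come from a chart. -/
lemma star2_eq (hJ : IsRot gB J) {θ : TwoForm B} {x : B} {β : E2 →L[ℝ] E2 →L[ℝ] ℝ}
    (hβ : ∀ a b : E2, θ x a b = β a b - β b a) {f1 f2 : E2}
    (hf : RotFrame (bil gB x) (en J x) f1 f2) :
    star2 gB J θ x = θ x f1 f2 := by
  rw [star2_mul hJ hβ]
  have : bil gB x (en J x f1) f2 = 1 := by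
    have := hf.area f1 f2
    rw [hf.h11, hf.h22, hf.h12] at this
    simpa using this
  rw [this, mul_one]

lemma star2_d1_eq (hJ : IsRot gB J) (α : OneForm B) {x : B} {f1 f2 : E2}
    (hf : RotFrame (bil gB x) (en J x) f1 f2) :
    star2 gB J (d1 α) x = d1 α x f1 f2 :=
  star2_eq hJ (d1_apply α x) hf

lemma star2_wedge_eq (hJ : IsRot gB J) (α β : OneForm B) {x : B} {f1 f2 : E2}
    (hf : RotFrame (bil gB x) (en J x) f1 f2) :
    star2 gB J (wedge α β) x = vl α x f1 * vl β x f2 - vl α x f2 * vl β x f1 := by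
  refine star2_eq (β := (vl α x).smulRight (vl β x)) hJ (fun a b => ?_) hf
  have h1 : ∀ a b, ((vl α x).smulRight (vl β x)) a b = vl α x a * vl β x b := fun a b => by simp
  rw [h1, h1]
  rfl

lemma star1_apply (α : OneForm B) (x : B) (a : E2) :
    vl (star1 J α) x a = - vl α x (en J x a) := rfl

lemma star1_star1 (hJ : IsRot gB J) (α : OneForm B) : star1 J (star1 J α) = fun x => - α x := by
  funext x
  obtain ⟨f1, f2, hf⟩ := hJ x
  have h : ∀ a : E2, vl (star1 J (star1 J α)) x a = - vl α x a := fun a => by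
    rw [star1_apply, star1_apply, hf.sq, map_neg]
    simp
  exact ContinuousLinearMap.ext h

/-- The integrand of `inner1` is the inner product of the two 1-forms. -/
lemma star2_inner1 (hJ : IsRot gB J) (α β : OneForm B) {x : B} {f1 f2 : E2}
    (hf : RotFrame (bil gB x) (en J x) f1 f2) :
    star2 gB J (wedge α (star1 J β)) x = vl α x f1 * vl β x f1 + vl α x f2 * vl β x f2 := by
  rw [star2_wedge_eq hJ _ _ hf, star1_apply, star1_apply]
  have h1 : en J x f1 = f2 := hf.J1
  have h2 : en J x f2 = -f1 := hf.J2
  rw [h1, h2, map_neg]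
  ring

lemma star2_inner0 (hJ : IsRot gB J) (f k : B → ℝ) (x : B) :
    star2 gB J (fun x a b => f x * star0 gB J k x a b) x = f x * k x := by
  obtain ⟨f1, f2, hf⟩ := hJ x
  have h0 := hf.area_ne_zero
  have h1 : star2 gB J (fun x a b => f x * star0 gB J k x a b) x =
    (f x * (k x * bil gB x (en J x (EuclideanSpace.single 0 1)) (EuclideanSpace.single 1 1))) /
      bil gB x (en J x (EuclideanSpace.single 0 1)) (EuclideanSpace.single 1 1) := rfl
  rw [h1]
  field_simp

lemma star2_inner2 (θ τ : TwoForm B) (x : B) :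
    star2 gB J (fun x a b => star2 gB J τ x * θ x a b) x =
      star2 gB J τ x * star2 gB J θ x := by
  simp only [star2]
  ring

/-- Smooth endomorphism fields on the surface, expressed in charts. -/
def SmoothEnd (J : EndField B) : Prop :=
  ∀ x : B, ∀ y ∈ (extChartAt (𝓡 2) x).target, ContDiffAt ℝ ∞
    (fun y => (fr (𝓡 2) x y).inverse ∘L en J ((extChartAt (𝓡 2) x).symm y) ∘L fr (𝓡 2) x y) y

lemma fr_inverse {x : B} {y : E2} (hy : y ∈ (extChartAt (𝓡 2) x).target) (a : E2) :
    fr (𝓡 2) x y ((fr (𝓡 2) x y).inverse a) = a := by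
  obtain ⟨e, he⟩ := fr_isInvertible hy
  rw [← he, ContinuousLinearMap.inverse_equiv]
  exact e.apply_symm_apply a

lemma Smooth1.act {S : EndField B} (hS : SmoothEnd S) {α : OneForm B} (hα : Smooth1 α) :
    Smooth1 (actOn S α) := by
  intro x y hy
  refine ((hα x y hy).clm_comp (hS x y hy)).congr_of_eventuallyEq ?_
  filter_upwards [(isOpen_target2 x).mem_nhds hy] with z hz
  ext a
  simp only [ContinuousLinearMap.comp_apply, lf_apply, fr_inverse hz]
  rfl

lemma Smooth1.star (hJ : SmoothEnd J) {α : OneForm B} (hα : Smooth1 α) :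
    Smooth1 (star1 J α) := (hα.act hJ).neg

/-- The signed area of the coordinate parallelogram in the chart at `x`: positive or negative
according to whether the chart agrees with the orientation. -/
def ar (gB : MetricField (𝓡 2) B) (J : EndField B) (x : B) (y : E2) : ℝ :=
  bil gB ((extChartAt (𝓡 2) x).symm y) (en J ((extChartAt (𝓡 2) x).symm y)
    (fr (𝓡 2) x y (EuclideanSpace.single 0 1))) (fr (𝓡 2) x y (EuclideanSpace.single 1 1))

lemma ar_vec (hJ : IsRot gB J) (x : B) (y v w : E2) :
    bil gB ((extChartAt (𝓡 2) x).symm y)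
      (en J ((extChartAt (𝓡 2) x).symm y) (fr (𝓡 2) x y v)) (fr (𝓡 2) x y w) =
      (v 0 * w 1 - v 1 * w 0) * ar gB J x y := by
  obtain ⟨f1, f2, hf⟩ := hJ ((extChartAt (𝓡 2) x).symm y)
  have hv : ∀ v : E2, v = v 0 • (EuclideanSpace.single 0 1 : E2) +
      v 1 • (EuclideanSpace.single 1 1 : E2) := fun v => by
    ext i; fin_cases i <;> simp
  rw [ar, hf.area, hf.area]
  conv_lhs => rw [hv v, hv w]
  simp only [map_add, map_smul, add_apply, smul_apply, smul_eq_mul]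
  ring

lemma ar_ne_zero (hJ : IsRot gB J) {x : B} {y : E2} (hy : y ∈ (extChartAt (𝓡 2) x).target) :
    ar gB J x y ≠ 0 := by
  intro h0
  obtain ⟨f1, f2, hf⟩ := hJ ((extChartAt (𝓡 2) x).symm y)
  obtain ⟨a, ha⟩ := (fr_isInvertible hy).bijective.2 (EuclideanSpace.single 0 1 : E2)
  obtain ⟨b, hb⟩ := (fr_isInvertible hy).bijective.2 (EuclideanSpace.single 1 1 : E2)
  have := ar_vec hJ x y a b
  rw [h0, mul_zero, ha, hb] at this
  exact hf.area_ne_zero this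

lemma ar_smooth (hg : IsSmoothMetric gB) (hJs : SmoothEnd J) {x : B} {y : E2}
    (hy : y ∈ (extChartAt (𝓡 2) x).target) : ContDiffAt ℝ ∞ (ar gB J x) y := by
  have hG : ContDiffAt ℝ ∞ (coordMetric gB x) y := by
    have := (hg x y hy).smooth
    rwa [range2, contDiffWithinAt_univ] at this
  refine ((hG.clm_apply ((hJs x y hy).clm_apply (contDiffAt_const (c :=
    (EuclideanSpace.single 0 1 : E2))))).clm_apply (contDiffAt_const (c :=
    (EuclideanSpace.single 1 1 : E2)))).congr_of_eventuallyEq ?_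
  filter_upwards [(isOpen_target2 x).mem_nhds hy] with z hz
  simp only [coordMetric_apply, ContinuousLinearMap.comp_apply, fr_inverse hz]
  rfl

/-- The coordinate expression of `dα`, in terms of its star. -/
lemma fderiv_lf_eq (hJ : IsRot gB J) {α : OneForm B} (hα : Smooth1 α) {x : B} {y : E2}
    (hy : y ∈ (extChartAt (𝓡 2) x).target) :
    fderiv ℝ (lf α x) y (EuclideanSpace.single 0 1) (EuclideanSpace.single 1 1) -
      fderiv ℝ (lf α x) y (EuclideanSpace.single 1 1) (EuclideanSpace.single 0 1) =
      star2 gB J (d1 α) ((extChartAt (𝓡 2) x).symm y) * ar gB J x y := by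
  rw [← d1_chart hα hy, star2_mul hJ (d1_apply α _)]
  rfl

lemma smooth0_star2_d1 (hg : IsSmoothMetric gB) (hJ : IsRot gB J) (hJs : SmoothEnd J)
    {α : OneForm B} (hα : Smooth1 α) : Smooth0 (star2 gB J (d1 α)) := by
  intro x y hy
  have hD : ContDiffAt ℝ ∞ (fun y =>
      fderiv ℝ (lf α x) y (EuclideanSpace.single 0 1) (EuclideanSpace.single 1 1) -
      fderiv ℝ (lf α x) y (EuclideanSpace.single 1 1) (EuclideanSpace.single 0 1)) y := by
    have h := (hα x y hy).fderiv_right (m := ∞) (by simp)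
    exact ((h.clm_apply contDiffAt_const).clm_apply contDiffAt_const).sub
      ((h.clm_apply contDiffAt_const).clm_apply contDiffAt_const)
  refine (hD.div (ar_smooth hg hJs hy) (ar_ne_zero hJ hy)).congr_of_eventuallyEq ?_
  filter_upwards [(isOpen_target2 x).mem_nhds hy] with z hz
  simp only [Pi.div_apply]
  rw [fderiv_lf_eq hJ hα hz, mul_div_cancel_right₀ _ (ar_ne_zero hJ hz)]

end Surface

/-! ### The area measure -/

section Area

variable {B : Type*} [TopologicalSpace B] [ChartedSpace (EuclideanSpace ℝ (Fin 2)) B]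
  [IsManifold (𝓡 2) ∞ B] {gB : MetricField (𝓡 2) B} {J : EndField B}

lemma det_eq_E2 (T : E2 →L[ℝ] E2) :
    T.det = T (EuclideanSpace.single 0 1) 0 * T (EuclideanSpace.single 1 1) 1 -
      T (EuclideanSpace.single 0 1) 1 * T (EuclideanSpace.single 1 1) 0 := by
  rw [ContinuousLinearMap.det, ← LinearMap.det_toMatrix (EuclideanSpace.basisFun (Fin 2) ℝ).toBasis,
    Matrix.det_fin_two]
  simp [LinearMap.toMatrix_apply]
  ring

/-- The density of the area measure in the chart at `x`. -/
def dens (gB : MetricField (𝓡 2) B) (x : B) (y : E2) : ℝ :=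
  Real.sqrt (Matrix.det (Matrix.of fun i j : Fin 2 =>
      coordMetric gB x y (EuclideanSpace.single i 1) (EuclideanSpace.single j 1)))

/-- The density of the area measure is the absolute value of the signed area of the coordinate
parallelogram. -/
lemma dens_eq (hJ : IsRot gB J) (x : B) (y : E2) : dens gB x y = |ar gB J x y| := by
  obtain ⟨f1, f2, hf⟩ := hJ ((extChartAt (𝓡 2) x).symm y)
  rw [← Real.sqrt_sq_eq_abs, dens, Matrix.det_fin_two, ar, hf.area]
  congr 1
  simp only [Matrix.of_apply, coordMetric_apply]
  generalize fr (𝓡 2) x y (EuclideanSpace.single 0 1) = a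
  generalize fr (𝓡 2) x y (EuclideanSpace.single 1 1) = b
  rw [hf.inner a b, hf.inner b a, hf.inner a a, hf.inner b b]
  ring

lemma ar_change (hJ : IsRot gB J) {x q : B} {y : E2} (hy : y ∈ (extChartAt (𝓡 2) x).target)
    (hq : (extChartAt (𝓡 2) x).symm y ∈ (extChartAt (𝓡 2) q).source) :
    ar gB J x y = (fderiv ℝ (tr (𝓡 2) x q) y).det * ar gB J q (tr (𝓡 2) x q y) := by
  have h := ar_vec hJ q (tr (𝓡 2) x q y) (fderiv ℝ (tr (𝓡 2) x q) y (EuclideanSpace.single 0 1))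
    (fderiv ℝ (tr (𝓡 2) x q) y (EuclideanSpace.single 1 1))
  rw [← fr_change2 hy hq, ← fr_change2 hy hq, symm_tr hq] at h
  rw [det_eq_E2, ← h]
  rfl

variable [MeasurableSpace B] [BorelSpace B]

lemma chartArea_eq (gB : MetricField (𝓡 2) B) (x : B) :
    chartArea gB x = ((volume.restrict (extChartAt (𝓡 2) x).target).withDensity
      (fun y => ENNReal.ofReal (dens gB x y))).map (extChartAt (𝓡 2) x).symm := rfl

lemma aemeasurable_symm (x : B) : AEMeasurable (extChartAt (𝓡 2) x).symm
    ((volume.restrict (extChartAt (𝓡 2) x).target).withDensity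
      (fun y => ENNReal.ofReal (dens gB x y))) :=
  ((continuousOn_extChartAt_symm x).aemeasurable (isOpen_target2 x).measurableSet).mono_ac
    (withDensity_absolutelyContinuous _ _)

lemma chartArea_apply (gB : MetricField (𝓡 2) B) (x : B) {s : Set B} (hs : MeasurableSet s) :
    chartArea gB x s = ∫⁻ y in (extChartAt (𝓡 2) x).symm ⁻¹' s ∩ (extChartAt (𝓡 2) x).target,
      ENNReal.ofReal (dens gB x y) := by
  rw [chartArea_eq, Measure.map_apply_of_aemeasurable (aemeasurable_symm x) hs, withDensity_apply',
    Measure.restrict_restrict' (isOpen_target2 x).measurableSet]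

lemma chartArea_inter_source (gB : MetricField (𝓡 2) B) (x : B) {s : Set B} (hs : MeasurableSet s) :
    chartArea gB x s = chartArea gB x (s ∩ (extChartAt (𝓡 2) x).source) := by
  rw [chartArea_apply gB x hs,
    chartArea_apply gB x (hs.inter (isOpen_extChartAt_source x).measurableSet)]
  congr 2
  ext y
  simp only [mem_inter_iff, mem_preimage]
  exact ⟨fun h => ⟨⟨h.1, (extChartAt (𝓡 2) x).map_target h.2⟩, h.2⟩, fun h => ⟨h.1.1, h.2⟩⟩

lemma measurableSet_symm_preimage (x : B) {s : Set B} (hs : MeasurableSet s) :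
    MeasurableSet ((extChartAt (𝓡 2) x).symm ⁻¹' s ∩ (extChartAt (𝓡 2) x).target) := by
  have h1 : Measurable ((extChartAt (𝓡 2) x).target.domRestrict (extChartAt (𝓡 2) x).symm) :=
    (continuousOn_extChartAt_symm x).domRestrict.measurable
  have h2 := (isOpen_target2 x).measurableSet.subtype_image (h1 hs)
  convert h2 using 1
  ext y
  simp

/-- On the overlap of two charts the two chart areas agree, by the change of variables formula. -/
lemma chartArea_overlap (hJ : IsRot gB J) (x q : B) {s : Set B} (hs : MeasurableSet s)
    (hx : s ⊆ (extChartAt (𝓡 2) x).source) (hq : s ⊆ (extChartAt (𝓡 2) q).source) :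
    chartArea gB x s = chartArea gB q s := by
  rw [chartArea_apply gB x hs, chartArea_apply gB q hs]
  set V := (extChartAt (𝓡 2) x).symm ⁻¹' s ∩ (extChartAt (𝓡 2) x).target with hV
  have himg : (extChartAt (𝓡 2) q).symm ⁻¹' s ∩ (extChartAt (𝓡 2) q).target =
      tr (𝓡 2) x q '' V := by
    ext z
    constructor
    · rintro ⟨h1, h2⟩
      refine ⟨extChartAt (𝓡 2) x ((extChartAt (𝓡 2) q).symm z), ⟨?_, ?_⟩, ?_⟩
      · rw [mem_preimage, (extChartAt (𝓡 2) x).left_inv (hx h1)]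
        exact h1
      · exact (extChartAt (𝓡 2) x).map_source (hx h1)
      · rw [tr, Function.comp_apply, (extChartAt (𝓡 2) x).left_inv (hx h1),
          (extChartAt (𝓡 2) q).right_inv h2]
    · rintro ⟨y, ⟨h1, h2⟩, rfl⟩
      exact ⟨by rw [mem_preimage, symm_tr (hq h1)]; exact h1, tr_mem_target (hq h1)⟩
  have hinj : InjOn (tr (𝓡 2) x q) V := by
    rintro y ⟨h1, h2⟩ z ⟨h3, h4⟩ h
    have := congrArg (extChartAt (𝓡 2) q).symm h
    rw [symm_tr (hq h1), symm_tr (hq h3)] at this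
    exact (extChartAt (𝓡 2) x).symm.injOn h2 h4 this
  rw [himg, lintegral_image_eq_lintegral_abs_det_fderiv_mul volume
    (measurableSet_symm_preimage x hs) (fun y hy =>
      ((tr_smooth2 hy.2 (hq hy.1)).differentiableAt (by simp)).hasFDerivAt.hasFDerivWithinAt) hinj]
  refine setLIntegral_congr_fun (measurableSet_symm_preimage x hs) fun y hy => ?_
  rw [← ENNReal.ofReal_mul (abs_nonneg _), dens_eq hJ, dens_eq hJ, ← abs_mul,
    ← ar_change hJ hy.2 (hq hy.1)]

/-- The area measure is the chart area on each chart domain: the supremum in its definition is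
taken over measures that agree on overlaps. -/
lemma area_apply (hJ : IsRot gB J) (x : B) {s : Set B} (hs : MeasurableSet s)
    (hx : s ⊆ (extChartAt (𝓡 2) x).source) : area gB s = chartArea gB x s := by
  refine le_antisymm ?_ (Measure.le_iff'.1 (le_iSup (chartArea gB) x) s)
  have hU := (isOpen_extChartAt_source (I := 𝓡 2) x).measurableSet
  -- the chart area, extended by infinity outside the chart, dominates every chart area
  have hle : area gB ≤ chartArea gB x + (⊤ : Measure B).restrict (extChartAt (𝓡 2) x).sourceᶜ := by
    refine iSup_le fun q => Measure.le_iff.2 fun t ht => ?_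
    rw [← measure_inter_add_sdiff t hU, Measure.add_apply]
    refine add_le_add ?_ ?_
    · rw [chartArea_inter_source gB q (ht.inter hU), chartArea_overlap hJ q x
        ((ht.inter hU).inter (isOpen_extChartAt_source q).measurableSet) inter_subset_right
        (inter_subset_left.trans inter_subset_right)]
      exact measure_mono (inter_subset_left.trans inter_subset_left)
    · rw [Measure.restrict_apply ht]
      exact Measure.le_iff'.1 le_top _
  refine (Measure.le_iff'.1 hle s).trans_eq ?_
  rw [Measure.add_apply, Measure.restrict_apply hs, ← sdiff_eq, sdiff_eq_empty.2 hx, measure_empty,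
    add_zero]

lemma area_restrict (hJ : IsRot gB J) (x : B) :
    (area gB).restrict (extChartAt (𝓡 2) x).source = chartArea gB x := by
  ext s hs
  have hU := (isOpen_extChartAt_source (I := 𝓡 2) x).measurableSet
  rw [Measure.restrict_apply hs, area_apply hJ x (hs.inter hU) inter_subset_right,
    ← chartArea_inter_source gB x hs]

lemma dens_continuousOn (hg : IsSmoothMetric gB) (hJ : IsRot gB J) (hJs : SmoothEnd J) (x : B) :
    ContinuousOn (dens gB x) (extChartAt (𝓡 2) x).target := fun y hy => by
  have h := (ar_smooth hg hJs hy).continuousAt.abs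
  exact (h.congr (Filter.Eventually.of_forall fun z => (dens_eq hJ x z).symm)).continuousWithinAt

lemma area_locallyFinite (hg : IsSmoothMetric gB) (hJ : IsRot gB J) (hJs : SmoothEnd J) :
    IsLocallyFiniteMeasure (area gB) := by
  refine ⟨fun x => ?_⟩
  have h0 := mem_extChartAt_target (I := 𝓡 2) x
  have hc := ((dens_continuousOn hg hJ hJs x).continuousAt ((isOpen_target2 x).mem_nhds h0))
  obtain ⟨r, hr, hball⟩ := Metric.mem_nhds_iff.1 (Filter.inter_mem
    ((isOpen_target2 x).mem_nhds h0) (hc.eventually (gt_mem_nhds (lt_add_one _))))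
  have hopen : IsOpen ((extChartAt (𝓡 2) x).source ∩
      extChartAt (𝓡 2) x ⁻¹' Metric.ball (extChartAt (𝓡 2) x x) r) :=
    (continuousOn_extChartAt x).isOpen_inter_preimage (isOpen_extChartAt_source x)
      Metric.isOpen_ball
  refine ⟨_, hopen.mem_nhds ⟨mem_extChartAt_source x, Metric.mem_ball_self hr⟩, ?_⟩
  rw [area_apply hJ x hopen.measurableSet inter_subset_left,
    chartArea_apply gB x hopen.measurableSet]
  set C := dens gB x (extChartAt (𝓡 2) x x) + 1
  have hsub : (extChartAt (𝓡 2) x).symm ⁻¹' ((extChartAt (𝓡 2) x).source ∩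
      extChartAt (𝓡 2) x ⁻¹' Metric.ball (extChartAt (𝓡 2) x x) r) ∩ (extChartAt (𝓡 2) x).target ⊆
      Metric.ball (extChartAt (𝓡 2) x x) r := by
    rintro z ⟨h1, h2⟩
    have := h1.2
    rwa [mem_preimage, (extChartAt (𝓡 2) x).right_inv h2] at this
  calc _ ≤ ∫⁻ y in Metric.ball (extChartAt (𝓡 2) x x) r, ENNReal.ofReal (dens gB x y) :=
        lintegral_mono_set hsub
    _ ≤ ∫⁻ y in Metric.ball (extChartAt (𝓡 2) x x) r, ENNReal.ofReal C :=
        setLIntegral_mono' Metric.isOpen_ball.measurableSet fun y hy =>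
          ENNReal.ofReal_le_ofReal (hball hy).2.le
    _ < ⊤ := by
        rw [setLIntegral_const]
        exact ENNReal.mul_lt_top ENNReal.ofReal_lt_top Metric.isBounded_ball.measure_lt_top

/-- The integral of a function supported in the domain of a chart. -/
lemma integral_area (hg : IsSmoothMetric gB) (hJ : IsRot gB J) (hJs : SmoothEnd J) (x : B)
    {f : B → ℝ} (hf : Continuous f) (h0 : ∀ q ∉ (extChartAt (𝓡 2) x).source, f q = 0) :
    ∫ q, f q ∂(area gB) =
      ∫ y in (extChartAt (𝓡 2) x).target, dens gB x y * f ((extChartAt (𝓡 2) x).symm y) := by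
  rw [← setIntegral_eq_integral_of_forall_compl_eq_zero h0, area_restrict hJ x, chartArea_eq,
    integral_map (aemeasurable_symm x) hf.measurable.aestronglyMeasurable,
    integral_withDensity_eq_integral_toReal_smul₀]
  · refine setIntegral_congr_fun (isOpen_target2 x).measurableSet fun y _ => ?_
    simp only [smul_eq_mul, dens]
    rw [ENNReal.toReal_ofReal (Real.sqrt_nonneg _)]
  · exact ((dens_continuousOn hg hJ hJs x).aemeasurable
      (isOpen_target2 x).measurableSet).ennreal_ofReal
  · exact Filter.Eventually.of_forall fun _ => ENNReal.ofReal_lt_top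

lemma integrable_area [CompactSpace B] (hg : IsSmoothMetric gB) (hJ : IsRot gB J)
    (hJs : SmoothEnd J) {f : B → ℝ} (hf : Continuous f) : Integrable f (area gB) := by
  have := area_locallyFinite hg hJ hJs
  exact hf.integrable_of_hasCompactSupport (HasCompactSupport.of_compactSpace f)

end Area

/-! ### Stokes' theorem -/

section Stokes

/-- The divergence theorem for a function with compact support in the plane. -/
lemma integral_fderiv_eq_zero {f : E2 → ℝ} (hf : ContDiff ℝ 1 f) (hc : HasCompactSupport f)
    (v : E2) : ∫ y, fderiv ℝ f y v = 0 := by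
  have h1 : Continuous fun y => fderiv ℝ f y v :=
    (hf.continuous_fderiv (by simp)).clm_apply continuous_const
  have h2 : HasCompactSupport fun y => fderiv ℝ f y v := hc.fderiv_apply (𝕜 := ℝ) v
  have h := integral_mul_fderiv_eq_neg_fderiv_mul_of_integrable (μ := (volume : Measure E2))
    (f := fun _ => (1 : ℝ)) (g := f) (v := v) (by simp)
    (by simpa using h1.integrable_of_hasCompactSupport h2)
    (by simpa using hf.continuous.integrable_of_hasCompactSupport hc)
    (fun x _ => differentiableAt_const _)
    (fun x _ => (hf.differentiable (by simp)).differentiableAt)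
  simpa using h

variable {B : Type*} [TopologicalSpace B] [ChartedSpace (EuclideanSpace ℝ (Fin 2)) B]
  [IsManifold (𝓡 2) ∞ B] {gB : MetricField (𝓡 2) B} {J : EndField B}

lemma star2_d1_eq_zero {α : OneForm B} {q : B} (h : ∀ᶠ p in 𝓝 q, α p = 0) :
    star2 gB J (d1 α) q = 0 := by
  have h1 : lf α q =ᶠ[𝓝 (extChartAt (𝓡 2) q q)] fun _ => 0 := by
    have hc := continuousAt_extChartAt_symm (I := 𝓡 2) q
    rw [ContinuousAt, extChartAt_to_inv] at hc
    filter_upwards [hc.eventually h] with z hz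
    rw [lf, hz]
    exact ContinuousLinearMap.zero_comp _
  have h2 : ∀ a b : E2, d1 α q a b = 0 := fun a b => by
    rw [d1_apply, h1.fderiv_eq]
    simp
  rw [star2]
  have := h2 (EuclideanSpace.single 0 1) (EuclideanSpace.single 1 1)
  rw [show d1 α q (coordVec q 0) (coordVec q 1) = 0 from this, zero_div]

variable [MeasurableSpace B] [BorelSpace B] [T2Space B]

/-- Stokes' theorem for a 1-form with compact support in the domain of a chart. The chart need not
respect the orientation; since it need not be connected either, its sign is carried along as the
locally constant function `|ar| / ar`. -/
lemma stokes_of_subset_source (hg : IsSmoothMetric gB) (hJ : IsRot gB J) (hJs : SmoothEnd J)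
    {α : OneForm B} (hα : Smooth1 α) {x : B} {K : Set B} (hK : IsCompact K)
    (hKx : K ⊆ (extChartAt (𝓡 2) x).source) (h0 : ∀ q ∉ K, α q = 0) :
    ∫ q, star2 gB J (d1 α) q ∂(area gB) = 0 := by
  have hz : ∀ q ∉ K, star2 gB J (d1 α) q = 0 := fun q hq => star2_d1_eq_zero (by
    filter_upwards [hK.isClosed.isOpen_compl.mem_nhds hq] with p hp using h0 p hp)
  rw [integral_area hg hJ hJs x (smooth0_star2_d1 hg hJ hJs hα).continuous
    (fun q hq => hz q fun h => hq (hKx h))]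
  set K' := extChartAt (𝓡 2) x '' K with hK'
  have hK'c : IsCompact K' := hK.image_of_continuousOn ((continuousOn_extChartAt x).mono hKx)
  -- the coefficients of the form, with the sign of the chart, extended by zero
  let c : E2 → E2 → ℝ := fun v =>
    (extChartAt (𝓡 2) x).target.indicator fun y => |ar gB J x y| / ar gB J x y * lf α x y v
  have c_zero : ∀ v, ∀ y ∉ K', c v y = 0 := by
    intro v y hy
    refine indicator_apply_eq_zero.2 fun hyt => ?_
    have : (extChartAt (𝓡 2) x).symm y ∉ K := fun h =>
      hy ⟨_, h, (extChartAt (𝓡 2) x).right_inv hyt⟩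
    rw [lf, h0 _ this]
    exact mul_zero _
  have c_local : ∀ v, ∀ y ∈ (extChartAt (𝓡 2) x).target,
      c v =ᶠ[𝓝 y] fun z => |ar gB J x y| / ar gB J x y * lf α x z v := by
    intro v y hy
    have hc := (ar_smooth hg hJs hy).continuousAt
    have hsign : ∀ᶠ z in 𝓝 y, |ar gB J x z| / ar gB J x z = |ar gB J x y| / ar gB J x y := by
      rcases lt_or_gt_of_ne (ar_ne_zero hJ hy) with h | h
      · filter_upwards [hc.eventually (gt_mem_nhds h)] with z hz
        rw [abs_of_neg hz, abs_of_neg h, neg_div_self hz.ne, neg_div_self h.ne]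
      · filter_upwards [hc.eventually (lt_mem_nhds h)] with z hz
        rw [abs_of_pos hz, abs_of_pos h, div_self hz.ne', div_self h.ne']
    filter_upwards [hsign, (isOpen_target2 x).mem_nhds hy] with z hz hzt
    simp only [c, indicator_of_mem hzt, hz]
  have c_far : ∀ v, ∀ y ∉ (extChartAt (𝓡 2) x).target, c v =ᶠ[𝓝 y] fun _ => 0 := by
    intro v y hy
    have : y ∉ K' := by
      rintro ⟨q, hq, rfl⟩
      exact hy ((extChartAt (𝓡 2) x).map_source (hKx hq))
    filter_upwards [hK'c.isClosed.isOpen_compl.mem_nhds this] with z hz using c_zero v z hz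
  have c_smooth : ∀ v, ContDiff ℝ 1 (c v) := by
    intro v
    rw [contDiff_iff_contDiffAt]
    intro y
    by_cases hy : y ∈ (extChartAt (𝓡 2) x).target
    · refine ContDiffAt.congr_of_eventuallyEq ?_ (c_local v y hy)
      exact contDiffAt_const.mul (((hα x y hy).clm_apply contDiffAt_const).of_le (by simp))
    · exact contDiffAt_const.congr_of_eventuallyEq (c_far v y hy)
  have c_supp : ∀ v, HasCompactSupport (c v) := fun v =>
    HasCompactSupport.intro hK'c (c_zero v)
  have key : ∀ y ∈ (extChartAt (𝓡 2) x).target,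
      dens gB x y * star2 gB J (d1 α) ((extChartAt (𝓡 2) x).symm y) =
      fderiv ℝ (c (EuclideanSpace.single 1 1)) y (EuclideanSpace.single 0 1) -
      fderiv ℝ (c (EuclideanSpace.single 0 1)) y (EuclideanSpace.single 1 1) := by
    intro y hy
    have hd : ∀ v w, fderiv ℝ (c v) y w =
        |ar gB J x y| / ar gB J x y * fderiv ℝ (lf α x) y w v := by
      intro v w
      have hda := (hα x y hy).differentiableAt (n := ∞) (by simp)
      rw [(c_local v y hy).fderiv_eq, fderiv_apply_const hda, fderiv_const_mul
        (hda.clm_apply (differentiableAt_const v))]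
      rfl
    rw [hd, hd, ← mul_sub, fderiv_lf_eq hJ hα hy, dens_eq hJ]
    have := ar_ne_zero hJ hy
    field_simp
  rw [setIntegral_congr_fun (isOpen_target2 x).measurableSet key,
    setIntegral_eq_integral_of_forall_compl_eq_zero (fun y hy => by
      rw [(c_far _ y hy).fderiv_eq, (c_far _ y hy).fderiv_eq]; simp),
    integral_sub, integral_fderiv_eq_zero (c_smooth _) (c_supp _),
    integral_fderiv_eq_zero (c_smooth _) (c_supp _), sub_zero]
  all_goals
    refine Continuous.integrable_of_hasCompactSupport ?_ ((c_supp _).fderiv_apply (𝕜 := ℝ) _)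
    exact ((c_smooth _).continuous_fderiv (by simp)).clm_apply continuous_const

lemma Smooth0.of_contMDiff {f : B → ℝ} (hf : ContMDiff (𝓡 2) 𝓘(ℝ, ℝ) ∞ f) : Smooth0 f := by
  intro x y hy
  have h := hf.comp_contMDiffOn (contMDiffOn_extChartAt_symm (I := 𝓡 2) (n := ∞) x)
  exact h.contDiffOn.contDiffAt ((isOpen_target2 x).mem_nhds hy)

/-- The exterior derivative is additive over finite sums. -/
lemma Smooth1.sum {ι : Type*} (t : Finset ι) {β : ι → OneForm B} (hβ : ∀ i, Smooth1 (β i)) :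
    Smooth1 (fun x => ∑ i ∈ t, β i x) ∧
      ∀ x, ∀ a b : E2, d1 (fun x => ∑ i ∈ t, β i x) x a b = ∑ i ∈ t, d1 (β i) x a b := by
  classical
  induction t using Finset.induction_on with
  | empty =>
    have h0 : ∀ x, lf (fun x : B => ∑ i ∈ (∅ : Finset ι), β i x) x = fun _ => 0 := fun x => by
      funext y
      exact ContinuousLinearMap.zero_comp _
    refine ⟨fun x y _ => by rw [h0]; exact contDiffAt_const, fun x a b => ?_⟩
    rw [d1_apply, h0]
    simp
  | insert i t hi ih =>
    have h1 : (fun x : B => ∑ j ∈ insert i t, β j x) = fun x => β i x + ∑ j ∈ t, β j x := by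
      funext x
      rw [Finset.sum_insert hi]
    rw [h1]
    refine ⟨(hβ i).add ih.1, fun x a b => ?_⟩
    rw [d1_add (hβ i) ih.1, ih.2, Finset.sum_insert hi]

/-- Stokes' theorem on a closed surface, by a partition of unity. -/
theorem stokes [CompactSpace B] (hg : IsSmoothMetric gB) (hJ : IsRot gB J) (hJs : SmoothEnd J)
    {α : OneForm B} (hα : Smooth1 α) : ∫ q, star2 gB J (d1 α) q ∂(area gB) = 0 := by
  obtain ⟨f, hf⟩ := SmoothPartitionOfUnity.exists_isSubordinate_chartAt_source (𝓡 2) B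
  have hfin : {i | (Function.support (f i)).Nonempty}.Finite :=
    f.locallyFinite.finite_nonempty_of_compact
  set t := hfin.toFinset with ht
  have hsum : ∀ x, ∑ i ∈ t, f i x = 1 := by
    intro x
    rw [← f.sum_eq_one (mem_univ x), finsum_eq_sum_of_support_subset]
    intro i hi
    simp only [ht, Finite.coe_toFinset, mem_ofPred_eq]
    exact ⟨x, hi⟩
  have hs : ∀ i, Smooth1 (fun x => f i x • α x) := fun i =>
    hα.smul (Smooth0.of_contMDiff (f i).contMDiff)
  have hsplit : α = fun x => ∑ i ∈ t, f i x • α x := by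
    funext x
    rw [← Finset.sum_smul, hsum, one_smul]
  have hstar : ∀ q, star2 gB J (d1 α) q = ∑ i ∈ t, star2 gB J (d1 (fun x => f i x • α x)) q := by
    intro q
    have h1 := (Smooth1.sum t hs).2 q (coordVec q 0) (coordVec q 1)
    rw [← hsplit] at h1
    simp only [star2, ← Finset.sum_div]
    exact congrArg (· / areaForm gB J q (coordVec q 0) (coordVec q 1)) h1
  simp only [hstar]
  rw [integral_finsetSum]
  · refine Finset.sum_eq_zero fun i _ => ?_
    refine stokes_of_subset_source hg hJ hJs (hs i) (x := i) (K := tsupport (f i))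
      (isClosed_tsupport _).isCompact ?_ ?_
    · rw [extChartAt_source]; exact hf i
    · intro q hq
      rw [image_eq_zero_of_notMem_tsupport hq, zero_smul]
  · exact fun i _ => integrable_area hg hJ hJs (smooth0_star2_d1 hg hJ hJs (hs i)).continuous

end Stokes

/-! ### Differentiation along the boundary -/

section Along

variable {M : Type*} [TopologicalSpace M] [ChartedSpace (EuclideanHalfSpace 3) M]
  [IsManifold (𝓡∂ 3) ∞ M]
  {B : Type*} [TopologicalSpace B] [ChartedSpace (EuclideanSpace ℝ (Fin 2)) B]
  [IsManifold (𝓡 2) ∞ B] {g : MetricField (𝓡∂ 3) M} {vol : TriField M} {ι : B → M}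

lemma mem_bT {x : B} {y : E2} (hy : y ∈ (extChartAt (𝓡 2) x).target) :
    y ∈ bT ι x (ι ((extChartAt (𝓡 2) x).symm y)) :=
  ⟨hy, mem_extChartAt_source _⟩

lemma mem_bT_self (x : B) : extChartAt (𝓡 2) x x ∈ bT ι x (ι x) :=
  ⟨mem_extChartAt_target x, by rw [extChartAt_to_inv]; exact mem_extChartAt_source _⟩

lemma bF_self (x : B) : bF ι x (ι x) (extChartAt (𝓡 2) x x) = extChartAt (𝓡∂ 3) (ι x) (ι x) := by
  simp only [bF, Function.comp_apply, extChartAt_to_inv]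

/-- The differential of `ι`, in charts. -/
def bD (ι : B → M) (x : B) (p : M) (y : E2) : E2 →L[ℝ] E3 := fderivWithin ℝ (bF ι x p) univ y

/-- The vector field `Y` along `ι`, in charts. -/
def al (ι : B → M) (Y : VField (𝓡∂ 3) M) (x : B) (p : M) (y : E2) : E3 :=
  vc (𝓡∂ 3) Y p (bF ι x p y)

/-- The covariant derivative, along `ι` and in charts, of the vector field `Y`. -/
def cv (g : MetricField (𝓡∂ 3) M) (ι : B → M) (Y : VField (𝓡∂ 3) M) (x : B) (p : M) (y : E2) :
    E2 →L[ℝ] E3 :=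
  nab (chr (coordMetric g p) (range (𝓡∂ 3))) univ (bF ι x p) (al ι Y x p) y

/-- The vector field is smooth near the boundary. This is what is known of the normal field
`n`. -/
def SmoothAlong (ι : B → M) (Y : VField (𝓡∂ 3) M) : Prop :=
  ∃ U : Set M, IsOpen U ∧ range ι ⊆ U ∧ SmoothFieldOn Y U

lemma contDiffAt_comp_bF {G : Type*} [NormedAddCommGroup G] [NormedSpace ℝ G] {f : E3 → G}
    (hι : IsBoundaryInclusion ι) {x : B} {p : M} {y : E2} (hy : y ∈ bT ι x p)
    (hf : ContDiffWithinAt ℝ ∞ f (range (𝓡∂ 3)) (bF ι x p y)) :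
    ContDiffAt ℝ ∞ (fun y => f (bF ι x p y)) y := by
  have h := hf.comp y (bF_smooth hι hy).contDiffWithinAt (bF_mem_range ι x p univ)
  rwa [contDiffWithinAt_univ] at h

lemma bD_smooth (hι : IsBoundaryInclusion ι) {x : B} {p : M} {y : E2} (hy : y ∈ bT ι x p) :
    ContDiffAt ℝ ∞ (bD ι x p) y := by
  have h : bD ι x p = fderiv ℝ (bF ι x p) := by
    funext z
    rw [bD, fderivWithin_univ]
  rw [h]
  exact (bF_smooth hι hy).fderiv_right (m := ∞) (by simp)

lemma SmoothAlong.al_smooth (hι : IsBoundaryInclusion ι) {Y : VField (𝓡∂ 3) M}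
    (hY : SmoothAlong ι Y) {x : B} {p : M} {y : E2}
    (hy : y ∈ bT ι x p) : ContDiffAt ℝ ∞ (al ι Y x p) y := by
  obtain ⟨U, hU, hUι, hs⟩ := hY
  exact contDiffAt_comp_bF hι hy (vc_smooth hU hs (bF_mem_target hy)
    (by rw [bF_symm hy]; exact hUι (mem_range_self _)))

lemma SmoothAlong.cv_smooth (hg : IsSmoothMetric g) (hι : IsBoundaryInclusion ι)
    {Y : VField (𝓡∂ 3) M} (hY : SmoothAlong ι Y) {x : B} {p : M} {y : E2}
    (hy : y ∈ bT ι x p) (a : E2) : ContDiffAt ℝ ∞ (fun y => cv g ι Y x p y a) y := by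
  have hal := hY.al_smooth hι hy
  have h1 : (fun y => cv g ι Y x p y a) = fun y => fderiv ℝ (al ι Y x p) y a +
      chr (coordMetric g p) (range (𝓡∂ 3)) (bF ι x p y) (bD ι x p y a) (al ι Y x p y) := by
    funext z
    rw [cv, nab_apply, fderivWithin_univ]
    rfl
  rw [h1]
  exact ((hal.fderiv_right (m := ∞) (by simp)).clm_apply contDiffAt_const).add
    (((contDiffAt_comp_bF hι hy (hg p _ (bF_mem_target hy)).chr_smooth).clm_apply
      ((bD_smooth hι hy).clm_apply contDiffAt_const)).clm_apply hal)

lemma coordMetric_bF {x : B} {p : M} {y : E2} (hy : y ∈ bT ι x p)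
    (a b : E3) : coordMetric g p (bF ι x p y) a b =
      bil g (ι ((extChartAt (𝓡 2) x).symm y)) (fr (𝓡∂ 3) p (bF ι x p y) a)
        (fr (𝓡∂ 3) p (bF ι x p y) b) := by
  rw [coordMetric_apply, bF_symm hy]

lemma coordTri_bF {x : B} {p : M} {y : E2} (hy : y ∈ bT ι x p)
    (a b c : E3) : coordTri vol p (bF ι x p y) a b c =
      tri vol (ι ((extChartAt (𝓡 2) x).symm y)) (fr (𝓡∂ 3) p (bF ι x p y) a)
        (fr (𝓡∂ 3) p (bF ι x p y) b) (fr (𝓡∂ 3) p (bF ι x p y) c) := by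
  rw [coordTri_apply, bF_symm hy]

lemma fr_bD (hι : IsBoundaryInclusion ι) {x : B} {p : M} {y : E2} (hy : y ∈ bT ι x p) (a : E2) :
    fr (𝓡∂ 3) p (bF ι x p y) (bD ι x p y a) =
      di ι ((extChartAt (𝓡 2) x).symm y) (fr (𝓡 2) x y a) := (di_fr hι hy a).symm

lemma fr_al (Y : VField (𝓡∂ 3) M) {x : B} {p : M} {y : E2} (hy : y ∈ bT ι x p) :
    fr (𝓡∂ 3) p (bF ι x p y) (al ι Y x p y) = vf Y (ι ((extChartAt (𝓡 2) x).symm y)) := by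
  rw [al, fr_vc Y (bF_mem_target hy), bF_symm hy]

/-- The covariant derivative along `ι` is the restriction of the covariant derivative in `M`:
although the latter is taken on a half space, it only sees tangential directions. -/
lemma SmoothAlong.fr_cv (hg : IsSmoothMetric g) (hι : IsBoundaryInclusion ι)
    {Y : VField (𝓡∂ 3) M} (hY : SmoothAlong ι Y) {x : B} {p : M} {y : E2}
    (hy : y ∈ bT ι x p) (a : E2) :
    fr (𝓡∂ 3) p (bF ι x p y) (cv g ι Y x p y a) =
      cd g Y (ι ((extChartAt (𝓡 2) x).symm y)) (di ι ((extChartAt (𝓡 2) x).symm y)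
        (fr (𝓡 2) x y a)) := by
  obtain ⟨U, hU, hUι, hs⟩ := hY
  have hyU : ι ((extChartAt (𝓡 2) x).symm y) ∈ U := hUι (mem_range_self _)
  rw [← fr_bD hι hy, covDeriv_chart hg hU hs (bF_mem_target hy) (bF_symm hy) hyU]
  congr 1
  have hv : DifferentiableWithinAt ℝ (vc (𝓡∂ 3) Y p) (range (𝓡∂ 3)) (bF ι x p y) :=
    (vc_smooth hU hs (bF_mem_target hy) (by rwa [bF_symm hy])).differentiableWithinAt
      (n := ∞) (by simp)
  have hF : DifferentiableWithinAt ℝ (bF ι x p) univ y :=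
    ((bF_smooth hι hy).differentiableAt (by simp)).differentiableWithinAt
  rw [cv, nab_apply, nab_apply, fderivWithin_id ((𝓡∂ 3).uniqueDiffOn _
    (extChartAt_target_subset_range p (bF_mem_target hy)))]
  have := fderivWithin_comp y hv hF (bF_mem_range ι x p univ) uniqueDiffWithinAt_univ
  rw [show al ι Y x p = vc (𝓡∂ 3) Y p ∘ bF ι x p from rfl, this]
  rfl

lemma al_self (Y : VField (𝓡∂ 3) M) (x : B) :
    al ι Y x (ι x) (extChartAt (𝓡 2) x x) = vf Y (ι x) := by
  rw [al, bF_self, vc_self]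

lemma bD_self (hι : IsBoundaryInclusion ι) (x : B) :
    bD ι x (ι x) (extChartAt (𝓡 2) x x) = di ι x := by
  ext1 a
  have h := fr_bD hι (mem_bT_self x) a
  rw [bF_self, fr_self, fr_self, extChartAt_to_inv] at h
  exact h

lemma SmoothAlong.cv_self (hg : IsSmoothMetric g) (hι : IsBoundaryInclusion ι)
    {Y : VField (𝓡∂ 3) M} (hY : SmoothAlong ι Y) (x : B) (a : E2) :
    cv g ι Y x (ι x) (extChartAt (𝓡 2) x x) a = cd g Y (ι x) (di ι x a) := by
  have h := hY.fr_cv hg hι (mem_bT_self x) a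
  rw [bF_self, fr_self, fr_self, extChartAt_to_inv] at h
  exact h

/-- Differentiation of an inner product along the boundary. -/
lemma fderiv_metric_along (hg : IsSmoothMetric g) (hι : IsBoundaryInclusion ι) {x : B} {p : M}
    {y : E2} (hy : y ∈ bT ι x p) {X Y : E2 → E3} (hX : DifferentiableAt ℝ X y)
    (hY : DifferentiableAt ℝ Y y) (a : E2) :
    fderiv ℝ (fun y => coordMetric g p (bF ι x p y) (X y) (Y y)) y a =
      coordMetric g p (bF ι x p y)
        (nab (chr (coordMetric g p) (range (𝓡∂ 3))) univ (bF ι x p) X y a) (Y y) +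
      coordMetric g p (bF ι x p y) (X y)
        (nab (chr (coordMetric g p) (range (𝓡∂ 3))) univ (bF ι x p) Y y a) := by
  have hG := hg p _ (bF_mem_target hy)
  rw [← fderivWithin_univ]
  exact nab_metric uniqueDiffWithinAt_univ (bF_mem_range ι x p univ) hG.diff hG.compat
    ((bF_smooth hι hy).differentiableAt (by simp)).differentiableWithinAt
    hX.differentiableWithinAt hY.differentiableWithinAt a

/-- Differentiation of a volume along the boundary. -/
lemma fderiv_volume_along [T2Space M] (hg : IsSmoothMetric g) (hvol : IsVolumeForm g vol)
    (hι : IsBoundaryInclusion ι) {x : B} {p : M}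
    {y : E2} (hy : y ∈ bT ι x p) {X Y Z : E2 → E3} (hX : DifferentiableAt ℝ X y)
    (hY : DifferentiableAt ℝ Y y) (hZ : DifferentiableAt ℝ Z y) (a : E2) :
    fderiv ℝ (fun y => coordTri vol p (bF ι x p y) (X y) (Y y) (Z y)) y a =
      coordTri vol p (bF ι x p y)
        (nab (chr (coordMetric g p) (range (𝓡∂ 3))) univ (bF ι x p) X y a) (Y y) (Z y) +
      coordTri vol p (bF ι x p y) (X y)
        (nab (chr (coordMetric g p) (range (𝓡∂ 3))) univ (bF ι x p) Y y a) (Z y) +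
      coordTri vol p (bF ι x p y) (X y) (Y y)
        (nab (chr (coordMetric g p) (range (𝓡∂ 3))) univ (bF ι x p) Z y a) := by
  have hyt := bF_mem_target hy
  have hd : DifferentiableWithinAt ℝ (coordTri vol p) (range (𝓡∂ 3)) (bF ι x p y) :=
    (hvol.coordTri_smooth hyt).differentiableWithinAt (by simp)
  rw [← fderivWithin_univ]
  refine nab_trilinear uniqueDiffWithinAt_univ (bF_mem_range ι x p univ) hd
    (volume_parallel finrank_E3 ?_ ?_ (extChartAt_target_subset_range p hyt) hd)
    ((bF_smooth hι hy).differentiableAt (by simp)).differentiableWithinAt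
    hX.differentiableWithinAt hY.differentiableWithinAt hZ.differentiableWithinAt a
  · filter_upwards [extChartAt_target_mem_nhdsWithin_of_mem hyt] with z hz using hg p z hz
  · filter_upwards with z using hvol.coordTri_unit z

lemma bD_differentiable (hι : IsBoundaryInclusion ι) {x : B} {p : M} {y : E2}
    (hy : y ∈ bT ι x p) (b : E2) : DifferentiableAt ℝ (fun y => bD ι x p y b) y :=
  ((bD_smooth hι hy).clm_apply contDiffAt_const).differentiableAt (n := ∞) (by simp)

/-- The second covariant derivative of `ι` is symmetric. -/
lemma nab_bD_symm (hg : IsSmoothMetric g) (hι : IsBoundaryInclusion ι) {x : B} {p : M} {y : E2}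
    (hy : y ∈ bT ι x p) (a b : E2) :
    nab (chr (coordMetric g p) (range (𝓡∂ 3))) univ (bF ι x p) (fun y => bD ι x p y b) y a =
    nab (chr (coordMetric g p) (range (𝓡∂ 3))) univ (bF ι x p) (fun y => bD ι x p y a) y b :=
  nab_fderiv_symm (hg p _ (bF_mem_target hy)).chr_symm uniqueDiffOn_univ (mem_univ y) (by simp)
    (bF_smooth hι hy).contDiffWithinAt a b

lemma smooth1_of_apply {α : OneForm B} (h : ∀ x : B, ∀ y ∈ (extChartAt (𝓡 2) x).target, ∀ a : E2,
    ContDiffAt ℝ ∞ (fun y => lf α x y a) y) : Smooth1 α := by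
  intro x y hy
  have h2 : ContDiffOn ℝ ∞ (lf α x) (extChartAt (𝓡 2) x).target :=
    contDiffOn_clm_apply.2 fun a z hz => (h x z hz a).contDiffWithinAt
  exact h2.contDiffAt ((isOpen_target2 x).mem_nhds hy)

end Along

/-! ### Forms induced on the boundary -/

section Forms

variable {M : Type*} [TopologicalSpace M] [ChartedSpace (EuclideanHalfSpace 3) M]
  [IsManifold (𝓡∂ 3) ∞ M]
  {B : Type*} [TopologicalSpace B] [ChartedSpace (EuclideanSpace ℝ (Fin 2)) B]
  [IsManifold (𝓡 2) ∞ B] {g : MetricField (𝓡∂ 3) M} {vol : TriField M} {ι : B → M}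

/-- The 1-form `X ↦ ⟨u, X⟩` on the boundary, dual to the tangential part of `u`. -/
def flatB (g : MetricField (𝓡∂ 3) M) (ι : B → M) (u : VField (𝓡∂ 3) M) : OneForm B := fun q =>
  (bil g (ι q) (vf u (ι q)) ∘L di ι q : E2 →L[ℝ] ℝ)

/-- The 1-form `X ↦ ⟨u, ∇_X w⟩` on the boundary. -/
def connForm (g : MetricField (𝓡∂ 3) M) (ι : B → M) (u w : VField (𝓡∂ 3) M) : OneForm B := fun q =>
  (bil g (ι q) (vf u (ι q)) ∘L cd g w (ι q) ∘L di ι q : E2 →L[ℝ] ℝ)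

/-- The 1-form `X ↦ -vol (n, X, u)` on the boundary: by `star1_flatB` it is the star of
`flatB g ι u`. In this form it can be differentiated without differentiating the tangential
projection. -/
def twistForm (vol : TriField M) (ι : B → M) (n u : VField (𝓡∂ 3) M) : OneForm B := fun q =>
  (-((tri vol (ι q) (vf n (ι q))).flip (vf u (ι q)) ∘L di ι q) : E2 →L[ℝ] ℝ)

/-- The function `⟨u, w⟩` on the boundary; for `w = n` it is the normal part of `u`. -/
def pairing (g : MetricField (𝓡∂ 3) M) (ι : B → M) (u w : VField (𝓡∂ 3) M) (q : B) : ℝ :=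
  bil g (ι q) (vf u (ι q)) (vf w (ι q))

section Smoothness

variable {u w n : VField (𝓡∂ 3) M}

lemma SmoothAlong.al_diff (hι : IsBoundaryInclusion ι) (hu : SmoothAlong ι u) {x : B} {p : M}
    {y : E2} (hy : y ∈ bT ι x p) : DifferentiableAt ℝ (al ι u x p) y :=
  (hu.al_smooth hι hy).differentiableAt (by simp)

lemma lf_flatB (hι : IsBoundaryInclusion ι) (u : VField (𝓡∂ 3) M) {x : B} {p : M} {y : E2}
    (hy : y ∈ bT ι x p) (a : E2) : lf (flatB g ι u) x y a =
      coordMetric g p (bF ι x p y) (al ι u x p y) (bD ι x p y a) := by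
  rw [coordMetric_bF hy, fr_al u hy, fr_bD hι hy]; rfl

lemma lf_connForm (hg : IsSmoothMetric g) (hι : IsBoundaryInclusion ι) (u : VField (𝓡∂ 3) M)
    (hw : SmoothAlong ι w) {x : B} {p : M} {y : E2}
    (hy : y ∈ bT ι x p) (a : E2) : lf (connForm g ι u w) x y a =
      coordMetric g p (bF ι x p y) (al ι u x p y) (cv g ι w x p y a) := by
  rw [coordMetric_bF hy, fr_al u hy, hw.fr_cv hg hι hy]; rfl

lemma lf_twistForm (hι : IsBoundaryInclusion ι) (n u : VField (𝓡∂ 3) M) {x : B} {p : M} {y : E2}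
    (hy : y ∈ bT ι x p) (a : E2) : lf (twistForm vol ι n u) x y a =
      -coordTri vol p (bF ι x p y) (al ι n x p y) (bD ι x p y a) (al ι u x p y) := by
  rw [coordTri_bF hy, fr_al u hy, fr_al n hy, fr_bD hι hy]; rfl

lemma pairing_chart (u w : VField (𝓡∂ 3) M) {x : B} {p : M} {y : E2}
    (hy : y ∈ bT ι x p) : pairing g ι u w ((extChartAt (𝓡 2) x).symm y) =
      coordMetric g p (bF ι x p y) (al ι u x p y) (al ι w x p y) := by
  rw [coordMetric_bF hy, fr_al u hy, fr_al w hy]; rfl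

lemma metric_bF_smooth (hg : IsSmoothMetric g) (hι : IsBoundaryInclusion ι) {x : B} {p : M}
    {y : E2} (hy : y ∈ bT ι x p) :
    ContDiffAt ℝ ∞ (fun y => coordMetric g p (bF ι x p y)) y :=
  contDiffAt_comp_bF hι hy (hg p _ (bF_mem_target hy)).smooth

lemma tri_bF_smooth [T2Space M] (hvol : IsVolumeForm g vol) (hι : IsBoundaryInclusion ι) {x : B}
    {p : M} {y : E2} (hy : y ∈ bT ι x p) :
    ContDiffAt ℝ ∞ (fun y => coordTri vol p (bF ι x p y)) y :=
  contDiffAt_comp_bF hι hy (hvol.coordTri_smooth (bF_mem_target hy))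

lemma bD_apply_smooth (hι : IsBoundaryInclusion ι) {x : B} {p : M} {y : E2}
    (hy : y ∈ bT ι x p) (b : E2) : ContDiffAt ℝ ∞ (fun y => bD ι x p y b) y :=
  (bD_smooth hι hy).clm_apply contDiffAt_const

lemma bT_nhds (hι : IsBoundaryInclusion ι) {x : B} {p : M} {y : E2} (hy : y ∈ bT ι x p) :
    ∀ᶠ z in 𝓝 y, z ∈ bT ι x p := (isOpen_bT hι x p).mem_nhds hy

lemma smooth_flatB (hg : IsSmoothMetric g) (hι : IsBoundaryInclusion ι) (hu : SmoothAlong ι u) :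
    Smooth1 (flatB g ι u) := by
  refine smooth1_of_apply fun x y hy a => ?_
  have hb := mem_bT (ι := ι) hy
  refine (((metric_bF_smooth hg hι hb).clm_apply (hu.al_smooth hι hb)).clm_apply
    (bD_apply_smooth hι hb a)).congr_of_eventuallyEq ?_
  filter_upwards [bT_nhds hι hb] with z hz using lf_flatB hι u hz a

lemma smooth_connForm (hg : IsSmoothMetric g) (hι : IsBoundaryInclusion ι) (hu : SmoothAlong ι u)
    (hw : SmoothAlong ι w) : Smooth1 (connForm g ι u w) := by
  refine smooth1_of_apply fun x y hy a => ?_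
  have hb := mem_bT (ι := ι) hy
  refine (((metric_bF_smooth hg hι hb).clm_apply (hu.al_smooth hι hb)).clm_apply
    (hw.cv_smooth hg hι hb a)).congr_of_eventuallyEq ?_
  filter_upwards [bT_nhds hι hb] with z hz using lf_connForm hg hι u hw hz a

lemma smooth_twistForm [T2Space M] (hvol : IsVolumeForm g vol) (hι : IsBoundaryInclusion ι)
    (hn : SmoothAlong ι n) (hu : SmoothAlong ι u) : Smooth1 (twistForm vol ι n u) := by
  refine smooth1_of_apply fun x y hy a => ?_
  have hb := mem_bT (ι := ι) hy
  refine ((((tri_bF_smooth hvol hι hb).clm_apply (hn.al_smooth hι hb)).clm_apply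
    (bD_apply_smooth hι hb a)).clm_apply (hu.al_smooth hι hb)).neg.congr_of_eventuallyEq ?_
  filter_upwards [bT_nhds hι hb] with z hz using lf_twistForm hι n u hz a

lemma smooth_pairing (hg : IsSmoothMetric g) (hι : IsBoundaryInclusion ι) (hu : SmoothAlong ι u)
    (hw : SmoothAlong ι w) : Smooth0 (pairing g ι u w) := by
  intro x y hy
  have hb := mem_bT (ι := ι) hy
  refine (((metric_bF_smooth hg hι hb).clm_apply (hu.al_smooth hι hb)).clm_apply
    (hw.al_smooth hι hb)).congr_of_eventuallyEq ?_
  filter_upwards [bT_nhds hι hb] with z hz using pairing_chart u w hz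

/-- The differential of an inner product. -/
lemma d0_pairing (hg : IsSmoothMetric g) (hι : IsBoundaryInclusion ι) (hu : SmoothAlong ι u)
    (hw : SmoothAlong ι w) (x : B) (a : E2) :
    d0 (pairing g ι u w) x a = bil g (ι x) (cd g u (ι x) (di ι x a)) (vf w (ι x)) +
      bil g (ι x) (vf u (ι x)) (cd g w (ι x) (di ι x a)) := by
  have hb := mem_bT_self (ι := ι) x
  have h1 : (fun y => pairing g ι u w ((extChartAt (𝓡 2) x).symm y)) =ᶠ[𝓝 (extChartAt (𝓡 2) x x)]
      fun y => coordMetric g (ι x) (bF ι x (ι x) y) (al ι u x (ι x) y) (al ι w x (ι x) y) := by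
    filter_upwards [bT_nhds hι hb] with z hz using pairing_chart u w hz
  rw [d0_apply (smooth_pairing hg hι hu hw), h1.fderiv_eq,
    fderiv_metric_along hg hι hb (hu.al_diff hι hb) (hw.al_diff hι hb)]
  have e1 := hu.cv_self hg hι x a
  have e2 := hw.cv_self hg hι x a
  rw [cv] at e1 e2
  rw [e1, e2, al_self, al_self, bF_self, coordMetric_self]

/-- The exterior derivative of `X ↦ -vol (n, X, u)`: the volume form is parallel, and the
derivatives of the argument `X` cancel by symmetry. -/
lemma d1_twistForm [T2Space M] (hg : IsSmoothMetric g) (hvol : IsVolumeForm g vol)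
    (hι : IsBoundaryInclusion ι) (hn : SmoothAlong ι n)
    (hu : SmoothAlong ι u) (x : B) (a b : E2) :
    d1 (twistForm vol ι n u) x a b =
      tri vol (ι x) (cd g n (ι x) (di ι x b)) (di ι x a) (vf u (ι x)) +
        tri vol (ι x) (vf n (ι x)) (di ι x a) (cd g u (ι x) (di ι x b)) -
      (tri vol (ι x) (cd g n (ι x) (di ι x a)) (di ι x b) (vf u (ι x)) +
        tri vol (ι x) (vf n (ι x)) (di ι x b) (cd g u (ι x) (di ι x a))) := by
  have hb := mem_bT_self (ι := ι) x
  have hd := (smooth_twistForm hvol hι hn hu x _ (mem_extChartAt_target x)).differentiableAt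
    (n := ∞) (by simp)
  have e1 := fun a => hu.cv_self hg hι x a
  have e2 := fun a => hn.cv_self hg hι x a
  simp only [cv] at e1 e2
  have key : ∀ a b : E2, fderiv ℝ (lf (twistForm vol ι n u) x) (extChartAt (𝓡 2) x x) a b =
      -(tri vol (ι x) (cd g n (ι x) (di ι x a)) (di ι x b) (vf u (ι x)) +
        tri vol (ι x) (vf n (ι x)) (nab (chr (coordMetric g (ι x)) (range (𝓡∂ 3))) univ
          (bF ι x (ι x)) (fun y => bD ι x (ι x) y b) (extChartAt (𝓡 2) x x) a)
          (vf u (ι x)) +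
        tri vol (ι x) (vf n (ι x)) (di ι x b) (cd g u (ι x) (di ι x a))) := by
    intro a b
    have h1 : (fun y => lf (twistForm vol ι n u) x y b) =ᶠ[𝓝 (extChartAt (𝓡 2) x x)]
        fun y => -coordTri vol (ι x) (bF ι x (ι x) y) (al ι n x (ι x) y) (bD ι x (ι x) y b)
          (al ι u x (ι x) y) := by
      filter_upwards [bT_nhds hι hb] with z hz using lf_twistForm hι n u hz b
    rw [fderiv_apply_const hd, h1.fderiv_eq, fderiv_fun_neg, neg_apply,
      fderiv_volume_along hg hvol hι hb (hn.al_diff hι hb) (bD_differentiable hι hb b)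
      (hu.al_diff hι hb), e1, e2, bD_self hι, bF_self, coordTri_self, al_self, al_self]
  rw [d1_apply, key, key, nab_bD_symm hg hι hb b a]
  ring

/-- The exterior derivative of `X ↦ ⟨u, ∇_X w⟩` is `⟨∇u ∧ ∇w⟩` and a curvature term, which is
explicit because the metric is hyperbolic. -/
lemma d1_connForm (hg : IsSmoothMetric g) (hh : IsHyperbolic g) (hι : IsBoundaryInclusion ι)
    (hu : SmoothAlong ι u) (hw : SmoothAlong ι w) (x : B) (a b : E2) :
    d1 (connForm g ι u w) x a b =
      bil g (ι x) (cd g u (ι x) (di ι x a)) (cd g w (ι x) (di ι x b)) -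
      bil g (ι x) (cd g u (ι x) (di ι x b)) (cd g w (ι x) (di ι x a)) +
      (bil g (ι x) (di ι x a) (vf w (ι x)) * bil g (ι x) (vf u (ι x)) (di ι x b) -
      bil g (ι x) (di ι x b) (vf w (ι x)) * bil g (ι x) (vf u (ι x)) (di ι x a)) := by
  have hb := mem_bT_self (ι := ι) x
  have hG := hg (ι x) _ (bF_mem_target hb)
  have hd := (smooth_connForm hg hι hu hw x _ (mem_extChartAt_target x)).differentiableAt (n := ∞)
    (by simp)
  have e2 := fun a => hw.cv_self hg hι x a
  have e1 : ∀ a, nab (chr (coordMetric g (ι x)) (range (𝓡∂ 3))) univ (bF ι x (ι x))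
    (al ι u x (ι x)) (extChartAt (𝓡 2) x x) a = cd g u (ι x) (di ι x a) := fun a =>
    hu.cv_self hg hι x a
  have key : ∀ a b : E2, fderiv ℝ (lf (connForm g ι u w) x) (extChartAt (𝓡 2) x x) a b =
      bil g (ι x) (cd g u (ι x) (di ι x a)) (cd g w (ι x) (di ι x b)) +
      bil g (ι x) (vf u (ι x))
        (nab (chr (coordMetric g (ι x)) (range (𝓡∂ 3))) univ (bF ι x (ι x))
          (fun y => cv g ι w x (ι x) y b) (extChartAt (𝓡 2) x x) a) := by
    intro a b
    have h1 : (fun y => lf (connForm g ι u w) x y b) =ᶠ[𝓝 (extChartAt (𝓡 2) x x)]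
        fun y => coordMetric g (ι x) (bF ι x (ι x) y) (al ι u x (ι x) y)
          (cv g ι w x (ι x) y b) := by
      filter_upwards [bT_nhds hι hb] with z hz using lf_connForm hg hι u hw hz b
    rw [fderiv_apply_const hd, h1.fderiv_eq,
      fderiv_metric_along hg hι hb (hu.al_diff hι hb)
      ((hw.cv_smooth hg hι hb b).differentiableAt (by simp)), e1, e2, al_self, bF_self,
      coordMetric_self]
  have hcomm := nab_comm (hG.chr_smooth.differentiableWithinAt (by simp))
    (bF_mem_range ι x (ι x) univ) uniqueDiffOn_univ (mem_univ _) (by simp)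
    (bF_smooth hι hb).contDiffWithinAt (hw.al_smooth hι hb).contDiffWithinAt a b
  have hc2 := congrArg (coordMetric g (ι x) (bF ι x (ι x) (extChartAt (𝓡 2) x x))
    (al ι u x (ι x) (extChartAt (𝓡 2) x x))) hcomm
  change _ = coordMetric g (ι x) (bF ι x (ι x) (extChartAt (𝓡 2) x x)) _
    (curv _ _ _ (bD ι x (ι x) (extChartAt (𝓡 2) x x) a) (bD ι x (ι x) (extChartAt (𝓡 2) x x) b) _)
    at hc2
  rw [bF_self, bD_self hι, al_self, al_self, hh.curv hg, coordMetric_self, map_sub, map_sub,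
    map_smul, map_smul, smul_eq_mul, smul_eq_mul] at hc2
  rw [d1_apply, key, key]
  simp only [cv]
  linear_combination hc2

end Smoothness
end Forms

/-! ### Adapted frames and the shape operator -/

section Frame

variable {M : Type*} [TopologicalSpace M] [ChartedSpace (EuclideanHalfSpace 3) M]
  [IsManifold (𝓡∂ 3) ∞ M]
  {B : Type*} [TopologicalSpace B] [ChartedSpace (EuclideanSpace ℝ (Fin 2)) B]
  [IsManifold (𝓡 2) ∞ B] {g : MetricField (𝓡∂ 3) M} {vol : TriField M} {ι : B → M}
  {n : VField (𝓡∂ 3) M}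

lemma IsSmoothMetric.bil_symm (hg : IsSmoothMetric g) (p : M) (a b : E3) :
    bil g p a b = bil g p b a := by
  rw [← coordMetric_self]
  exact (hg p _ (mem_extChartAt_target p)).symm _ a b

lemma IsSmoothMetric.bil_pos (hg : IsSmoothMetric g) (p : M) (a : E3) (ha : a ≠ 0) :
    0 < bil g p a a := by
  rw [← coordMetric_self]
  exact (hg p _ (mem_extChartAt_target p)).pos a ha

lemma bil_inducedMetric (q : B) (a b : E2) :
    bil (inducedMetric g ι) q a b = bil g (ι q) (di ι q a) (di ι q b) := rfl

lemma di_injective (hι : IsBoundaryInclusion ι) (q : B) : Function.Injective (di ι q) :=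
  hι.immersion q

lemma bil_inducedMetric_pos (hg : IsSmoothMetric g) (hι : IsBoundaryInclusion ι) (q : B) (a : E2)
    (ha : a ≠ 0) : 0 < bil (inducedMetric g ι) q a a :=
  hg.bil_pos _ _ fun h => ha (di_injective hι q (h.trans (map_zero _).symm))

lemma coordMetric_induced (hι : IsBoundaryInclusion ι) {x : B} {p : M} {y : E2}
    (hy : y ∈ bT ι x p) (a b : E2) : coordMetric (inducedMetric g ι) x y a b =
      coordMetric g p (bF ι x p y) (bD ι x p y a) (bD ι x p y b) := by
  rw [coordMetric_apply, bil_inducedMetric, coordMetric_bF hy, fr_bD hι hy, fr_bD hι hy]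

lemma isSmoothMetric_induced (hg : IsSmoothMetric g) (hι : IsBoundaryInclusion ι) :
    IsSmoothMetric (inducedMetric g ι) := by
  intro x y hy
  refine isMetricAt_of_contDiffOn (g := inducedMetric g ι) (fun p a b => hg.bil_symm (ι p) _ _)
    (bil_inducedMetric_pos hg hι) (fun a b z hz => ?_) hy
  have hb := mem_bT (ι := ι) hz
  refine ContDiffAt.contDiffWithinAt ((((metric_bF_smooth hg hι hb).clm_apply
    (bD_apply_smooth hι hb a)).clm_apply (bD_apply_smooth hι hb b)).congr_of_eventuallyEq ?_)
  filter_upwards [bT_nhds hι hb] with z hz using coordMetric_induced hι hz a b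

/-- The tangential projection, as a map of the model spaces. -/
def tp (g : MetricField (𝓡∂ 3) M) (ι : B → M) (q : B) : E3 →L[ℝ] E2 := tangProj g ι q

lemma bil_tp (hg : IsSmoothMetric g) (hι : IsBoundaryInclusion ι) (q : B) (w : E3) (b : E2) :
    bil (inducedMetric g ι) q (tp g ι q w) b = bil g (ι q) w (di ι q b) := by
  have h : tp g ι q w = (bil (inducedMetric g ι) q).inverse (bil g (ι q) w ∘L di ι q) := rfl
  rw [h, metric_inverse_apply (metric_isInvertible (bil_inducedMetric_pos hg hι q))]
  rfl

lemma bil_rotJ (hg : IsSmoothMetric g) (hι : IsBoundaryInclusion ι) (q : B) (a b : E2) :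
    bil (inducedMetric g ι) q (en (rotJ g vol ι n) q a) b =
      tri vol (ι q) (vf n (ι q)) (di ι q a) (di ι q b) := by
  have h := bil_tp hg hι q (cross g vol (ι q) (n (ι q)) (dincl ι q a) : E3) b
  exact h.trans (bil_cross hg _ _ _ _)

lemma bil_shapeOp (hg : IsSmoothMetric g) (hι : IsBoundaryInclusion ι) (q : B) (a b : E2) :
    bil (inducedMetric g ι) q (en (shapeOp g ι n) q a) b =
      bil g (ι q) (cd g n (ι q) (di ι q a)) (di ι q b) := by
  have h : en (shapeOp g ι n) q a = tp g ι q (cd g n (ι q) (di ι q a)) := rfl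
  rw [h, bil_tp hg hι]

/-- The frame `n`, `f1`, `f2` at a boundary point is orthonormal and positively oriented. In such
a frame all the invariants of the boundary are computed. -/
structure Adapted (g : MetricField (𝓡∂ 3) M) (vol : TriField M) (ι : B → M)
    (n : VField (𝓡∂ 3) M) (x : B) (f1 f2 : E2) : Prop where
  frame : IsFrame (bil g (ι x)) (vf n (ι x)) (di ι x f1) (di ι x f2)
  volume : tri vol (ι x) (vf n (ι x)) (di ι x f1) (di ι x f2) = 1

lemma IsVolumeForm.tri_unit (hvol : IsVolumeForm g vol) (p : M) :
    IsUnitVolume (bil g p) (tri vol p) := by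
  have := hvol.coordTri_unit (x := p) (extChartAt (𝓡∂ 3) p p)
  rwa [coordMetric_self, coordTri_self] at this

/-- A frame is built from the coordinate frame; if it is negatively oriented, the last vector is
reversed. -/
lemma exists_adapted (hg : IsSmoothMetric g) (hvol : IsVolumeForm g vol)
    (hι : IsBoundaryInclusion ι) (hn : IsInwardUnitNormal g ι n) (x : B) :
    ∃ f1 f2, Adapted g vol ι n x f1 f2 := by
  have hpos := bil_inducedMetric_pos hg hι x
  set G := bil (inducedMetric g ι) x with hG
  have hsymm : ∀ a b, G a b = G b a := fun a b => hg.bil_symm _ _ _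
  have hnorm : ∀ a : E2, a ≠ 0 → ∃ c : ℝ, G (c • a) (c • a) = 1 := by
    intro a ha
    have h := hpos a ha
    refine ⟨(Real.sqrt (G a a))⁻¹, ?_⟩
    have h2 := Real.sq_sqrt h.le
    have h3 := (Real.sqrt_pos.2 h).ne'
    simp only [map_smul, smul_apply, smul_eq_mul]
    field_simp
    linarith
  have he0 : (EuclideanSpace.single 0 1 : E2) ≠ 0 := fun h => by
    simpa using congrArg (fun v : E2 => v 0) h
  obtain ⟨c, hc⟩ := hnorm _ he0
  set f1 : E2 := c • (EuclideanSpace.single 0 1 : E2) with hf1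
  have hb0 : (EuclideanSpace.single 1 1 : E2) - G (EuclideanSpace.single 1 1) f1 • f1 ≠ 0 :=
    fun h => by simpa [hf1] using congrArg (fun v : E2 => v 1) h
  obtain ⟨d, hd⟩ := hnorm _ hb0
  set f2 : E2 := d • ((EuclideanSpace.single 1 1 : E2) - G (EuclideanSpace.single 1 1) f1 • f1)
    with hf2
  have h12 : G f1 f2 = 0 := by
    rw [hf2]
    simp [hc, hsymm f1]
  have hframe : ∀ f : E2, G f f = 1 → G f1 f = 0 →
      IsFrame (bil g (ι x)) (vf n (ι x)) (di ι x f1) (di ι x f) := fun f h1 h2 =>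
    isFrame_of_orthonormal (hg.bil_symm _) finrank_E3 (hn.unit x) hc h1 (hn.normal x f1)
      (hn.normal x f) h2
  have hsq := (hvol.tri_unit (ι x)).frame_sq (hframe f2 hd h12)
  rcases mul_self_eq_one_iff.1 hsq with h | h
  · exact ⟨f1, f2, hframe f2 hd h12, h⟩
  · refine ⟨f1, -f2, hframe _ (by simp [hd]) (by simp [h12]), ?_⟩
    simp [h]

lemma Adapted.expand {x : B} {f1 f2 : E2} (h : Adapted g vol ι n x f1 f2)
    (hg : IsSmoothMetric g) (hι : IsBoundaryInclusion ι) (hn : IsInwardUnitNormal g ι n) (a : E2) :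
    a = bil (inducedMetric g ι) x a f1 • f1 + bil (inducedMetric g ι) x a f2 • f2 := by
  apply di_injective hι x
  have h1 := h.frame.expand (di ι x a)
  have h2 : bil g (ι x) (di ι x a) (vf n (ι x)) = 0 := by
    rw [hg.bil_symm]; exact hn.normal x a
  rw [h2, zero_smul, zero_add] at h1
  rw [map_add, map_smul, map_smul]
  exact h1

lemma Adapted.tri_eq {x : B} {f1 f2 : E2} (h : Adapted g vol ι n x f1 f2)
    (hvol : IsVolumeForm g vol) (a b c : E3) :
    tri vol (ι x) a b c =
      det3 (bil g (ι x) a (vf n (ι x))) (bil g (ι x) a (di ι x f1)) (bil g (ι x) a (di ι x f2))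
        (bil g (ι x) b (vf n (ι x))) (bil g (ι x) b (di ι x f1)) (bil g (ι x) b (di ι x f2))
        (bil g (ι x) c (vf n (ι x))) (bil g (ι x) c (di ι x f1)) (bil g (ι x) c (di ι x f2)) := by
  rw [(hvol.tri_unit (ι x)).expand h.frame, h.volume, mul_one]

lemma Adapted.rotFrame {x : B} {f1 f2 : E2} (h : Adapted g vol ι n x f1 f2)
    (hg : IsSmoothMetric g) (hvol : IsVolumeForm g vol) (hι : IsBoundaryInclusion ι)
    (hn : IsInwardUnitNormal g ι n) :
    RotFrame (bil (inducedMetric g ι) x) (en (rotJ g vol ι n) x) f1 f2 where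
  h11 := h.frame.h11
  h12 := h.frame.h12
  h21 := h.frame.h21
  h22 := h.frame.h22
  J1 := by
    rw [h.expand hg hι hn (en (rotJ g vol ι n) x f1), bil_rotJ hg hι, bil_rotJ hg hι,
      (hvol.tri_unit (ι x)).alt_right, h.volume, zero_smul, one_smul, zero_add]
  J2 := by
    rw [h.expand hg hι hn (en (rotJ g vol ι n) x f2), bil_rotJ hg hι, bil_rotJ hg hι,
      (hvol.tri_unit (ι x)).alt_right, alt_swap_right (hvol.tri_unit (ι x)).alt_right, h.volume,
      zero_smul, neg_one_smul, add_zero]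
  expand := h.expand hg hι hn

lemma isRot_rotJ (hg : IsSmoothMetric g) (hvol : IsVolumeForm g vol) (hι : IsBoundaryInclusion ι)
    (hn : IsInwardUnitNormal g ι n) : IsRot (inducedMetric g ι) (rotJ g vol ι n) := fun x => by
  obtain ⟨f1, f2, h⟩ := exists_adapted hg hvol hι hn x
  exact ⟨f1, f2, h.rotFrame hg hvol hι hn⟩

lemma IsInwardUnitNormal.smoothAlong (hn : IsInwardUnitNormal g ι n) : SmoothAlong ι n := hn.smooth

/-- An endomorphism field is smooth if the associated bilinear form `⟨L X, Y⟩` is. -/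
lemma smoothEnd_of_form {gB : MetricField (𝓡 2) B} (hgB : IsSmoothMetric gB) {L : EndField B}
    (h : ∀ x : B, ∀ y ∈ (extChartAt (𝓡 2) x).target, ∀ a b : E2, ContDiffAt ℝ ∞ (fun y =>
      bil gB ((extChartAt (𝓡 2) x).symm y) (en L ((extChartAt (𝓡 2) x).symm y) (fr (𝓡 2) x y a))
        (fr (𝓡 2) x y b)) y) : SmoothEnd L := by
  intro x y hy
  let T : E2 → E2 →L[ℝ] E2 →L[ℝ] ℝ := fun y => (ContinuousLinearMap.precomp ℝ (fr (𝓡 2) x y)) ∘L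
    bil gB ((extChartAt (𝓡 2) x).symm y) ∘L en L ((extChartAt (𝓡 2) x).symm y) ∘L fr (𝓡 2) x y
  have hT : ContDiffOn ℝ ∞ T (extChartAt (𝓡 2) x).target :=
    contDiffOn_clm_apply.2 fun a => contDiffOn_clm_apply.2 fun b => fun z hz =>
      (h x z hz a b).contDiffWithinAt
  have hT' := hT.contDiffAt ((isOpen_target2 x).mem_nhds hy)
  have hG : ContDiffAt ℝ ∞ (coordMetric gB x) y := by
    have := (hgB x y hy).smooth
    rwa [range2, contDiffWithinAt_univ] at this
  have hinv : ContDiffAt ℝ ∞ (fun z => (coordMetric gB x z).inverse) y :=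
    ((hgB x y hy).inv.contDiffAt_map_inverse (n := ∞)).comp y hG
  refine (hinv.clm_comp hT').congr_of_eventuallyEq ?_
  filter_upwards [(isOpen_target2 x).mem_nhds hy] with z hz
  ext1 a
  refine metric_ext (hgB x z hz).pos fun c => ?_
  simp only [ContinuousLinearMap.comp_apply]
  rw [metric_inverse_apply (hgB x z hz).inv, coordMetric_apply, fr_inverse hz]
  rfl

lemma smoothEnd_rotJ [T2Space M] (hg : IsSmoothMetric g) (hvol : IsVolumeForm g vol)
    (hι : IsBoundaryInclusion ι) (hn : IsInwardUnitNormal g ι n) : SmoothEnd (rotJ g vol ι n) := by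
  refine smoothEnd_of_form (isSmoothMetric_induced hg hι) fun x y hy a b => ?_
  have hb := mem_bT (ι := ι) hy
  refine ((((tri_bF_smooth hvol hι hb).clm_apply (hn.smoothAlong.al_smooth hι hb)).clm_apply
    (bD_apply_smooth hι hb a)).clm_apply (bD_apply_smooth hι hb b)).congr_of_eventuallyEq ?_
  filter_upwards [bT_nhds hι hb] with z hz
  rw [bil_rotJ hg hι, coordTri_bF hz, fr_al n hz, fr_bD hι hz, fr_bD hι hz]

lemma smoothEnd_shapeOp (hg : IsSmoothMetric g)
    (hι : IsBoundaryInclusion ι) (hn : IsInwardUnitNormal g ι n) : SmoothEnd (shapeOp g ι n) := by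
  refine smoothEnd_of_form (isSmoothMetric_induced hg hι) fun x y hy a b => ?_
  have hb := mem_bT (ι := ι) hy
  refine (((metric_bF_smooth hg hι hb).clm_apply (hn.smoothAlong.cv_smooth hg hι hb a)).clm_apply
    (bD_apply_smooth hι hb b)).congr_of_eventuallyEq ?_
  filter_upwards [bT_nhds hι hb] with z hz
  rw [bil_shapeOp hg hι, coordMetric_bF hz, hn.smoothAlong.fr_cv hg hι hz, fr_bD hι hz]

/-- The trace of an endomorphism field. -/
def trc (L : EndField B) (q : B) : ℝ := LinearMap.trace ℝ E2 (en L q).toLinearMap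

/-- The trace is invariant under the change to the coordinate frame. -/
lemma smooth0_trc {L : EndField B} (hL : SmoothEnd L) : Smooth0 (trc L) := by
  intro x y hy
  let τ : (E2 →L[ℝ] E2) →L[ℝ] ℝ := LinearMap.toContinuousLinearMap
    ((LinearMap.trace ℝ E2) ∘ₗ (ContinuousLinearMap.coeLM ℝ : (E2 →L[ℝ] E2) →ₗ[ℝ] E2 →ₗ[ℝ] E2))
  refine (τ.contDiff.contDiffAt.comp y (hL x y hy)).congr_of_eventuallyEq ?_
  filter_upwards [(isOpen_target2 x).mem_nhds hy] with z hz
  change LinearMap.trace ℝ E2 (en L ((extChartAt (𝓡 2) x).symm z)).toLinearMap =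
    LinearMap.trace ℝ E2 ((fr (𝓡 2) x z).inverse.toLinearMap ∘ₗ
      ((en L ((extChartAt (𝓡 2) x).symm z)).toLinearMap ∘ₗ (fr (𝓡 2) x z).toLinearMap))
  rw [LinearMap.trace_comp_comm']
  congr 1
  ext1 a
  simp only [LinearMap.comp_apply, ContinuousLinearMap.coe_coe, fr_inverse hz]

lemma SmoothEnd.comp {L L' : EndField B} (hL : SmoothEnd L) (hL' : SmoothEnd L') :
    SmoothEnd (fun q => L q ∘L L' q) := by
  intro x y hy
  refine ((hL x y hy).clm_comp (hL' x y hy)).congr_of_eventuallyEq ?_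
  filter_upwards [(isOpen_target2 x).mem_nhds hy] with z hz
  ext1 a
  simp only [ContinuousLinearMap.comp_apply, fr_inverse hz]
  rfl

lemma trc_eq {gB : MetricField (𝓡 2) B} {J L : EndField B} {x : B} {f1 f2 : E2}
    (hf : RotFrame (bil gB x) (en J x) f1 f2) :
    trc L x = bil gB x (en L x f1) f1 + bil gB x (en L x f2) f2 := by
  have h : (en L x).toLinearMap =
      (((bil gB x).flip f1 ∘L en L x).toLinearMap).smulRight f1 +
      (((bil gB x).flip f2 ∘L en L x).toLinearMap).smulRight f2 := by
    ext1 a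
    exact hf.expand (en L x a)
  rw [trc, h, map_add, LinearMap.trace_smulRight, LinearMap.trace_smulRight]
  rfl

end Frame

/-! ### The curvature of a pulled back metric -/

section GaussChart

variable {E E' : Type*} [NormedAddCommGroup E] [NormedSpace ℝ E] [NormedAddCommGroup E']
  [NormedSpace ℝ E'] [FiniteDimensional ℝ E] [FiniteDimensional ℝ E']

/-- The covariant derivative of `∇_b c`, for constant `b` and `c`. -/
lemma nab_chr_apply {G' : E' → E' →L[ℝ] E' →L[ℝ] ℝ} {y : E'}
    (hG' : IsMetricAt G' univ y) (a b c : E') :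
    nab (chr G' univ) univ id (fun z => chr G' univ z b c) y a =
      fderivWithin ℝ (chr G' univ) univ y a b c + chr G' univ y a (chr G' univ y b c) := by
  have hΓ := hG'.chr_smooth.differentiableWithinAt (n := ∞) (by simp)
  rw [nab_apply, fderivWithin_id uniqueDiffWithinAt_univ,
    ((hΓ.hasFDerivWithinAt.clm_apply (hasFDerivWithinAt_const b _ _)).clm_apply
      (hasFDerivWithinAt_const c _ _)).fderivWithin uniqueDiffWithinAt_univ]
  simp

/-- The curvature of a pulled back metric, in terms of the ambient curvature and of the second
derivatives of the map. The two terms in brackets are the products of the normal components of the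
second derivatives, so this is the Gauss equation before the normal is chosen. -/
lemma curv_pullback {G : E → E →L[ℝ] E →L[ℝ] ℝ} {G' : E' → E' →L[ℝ] E' →L[ℝ] ℝ} {s : Set E}
    {F : E' → E} {y : E'} (hst : MapsTo F univ s)
    (hG : ∀ᶠ z in 𝓝 y, IsMetricAt G s (F z)) (hG' : ∀ᶠ z in 𝓝 y, IsMetricAt G' univ z)
    (hF : ∀ᶠ z in 𝓝 y, ContDiffAt ℝ ∞ F z)
    (h : ∀ᶠ z in 𝓝 y, ∀ a b, G' z a b =
      G (F z) (fderivWithin ℝ F univ z a) (fderivWithin ℝ F univ z b)) (a b c e : E') :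
    G' y (curv (chr G' univ) univ y a b c) e =
      G (F y) (curv (chr G s) s (F y) (fderivWithin ℝ F univ y a) (fderivWithin ℝ F univ y b)
        (fderivWithin ℝ F univ y c)) (fderivWithin ℝ F univ y e) +
      (G (F y) (nab (chr G s) univ F (fun z => fderivWithin ℝ F univ z c) y b)
        (nab (chr G s) univ F (fun z => fderivWithin ℝ F univ z e) y a) -
        G' y (chr G' univ y b c) (chr G' univ y a e)) -
      (G (F y) (nab (chr G s) univ F (fun z => fderivWithin ℝ F univ z c) y a)
        (nab (chr G s) univ F (fun z => fderivWithin ℝ F univ z e) y b) -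
        G' y (chr G' univ y a c) (chr G' univ y b e)) := by
  have hu : UniqueDiffWithinAt ℝ (univ : Set E') y := uniqueDiffWithinAt_univ
  have hGy := hG.self_of_nhds
  have hG'y := hG'.self_of_nhds
  have hFy := hF.self_of_nhds
  have hD : ∀ c, ContDiffAt ℝ ∞ (fun z => fderivWithin ℝ F univ z c) y := fun c => by
    simp only [fderivWithin_univ]
    exact (hFy.fderiv_right (m := ∞) (by simp)).clm_apply contDiffAt_const
  have hΓF : ContDiffAt ℝ ∞ (fun z => chr G s (F z)) y := by
    have := hGy.chr_smooth.comp y hFy.contDiffWithinAt hst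
    rwa [contDiffWithinAt_univ] at this
  have hnab : ∀ c b, DifferentiableWithinAt ℝ
      (fun z => nab (chr G s) univ F (fun z => fderivWithin ℝ F univ z c) z b) univ y := by
    intro c b
    have h1 : ContDiffAt ℝ ∞ (fun z => fderiv ℝ (fun z => fderivWithin ℝ F univ z c) z b +
        chr G s (F z) (fderivWithin ℝ F univ z b) (fderivWithin ℝ F univ z c)) y :=
      (((hD c).fderiv_right (m := ∞) (by simp)).clm_apply contDiffAt_const).add
        ((hΓF.clm_apply (hD b)).clm_apply (hD c))
    have h2 := (h1.differentiableAt (by simp)).differentiableWithinAt (s := univ)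
    simpa only [nab_apply, fderivWithin_univ] using h2
  have hΓ' := hG'y.chr_smooth.differentiableWithinAt (n := ∞) (by simp)
  -- both expressions of the Christoffel symbols of the first kind are differentiated
  have key : ∀ a b, G' y (nab (chr G' univ) univ id (fun z => chr G' univ z b c) y a) e +
      G' y (chr G' univ y b c) (chr G' univ y a e) =
      G (F y) (nab (chr G s) univ F (fun z => nab (chr G s) univ F
        (fun z => fderivWithin ℝ F univ z c) z b) y a) (fderivWithin ℝ F univ y e) +
      G (F y) (nab (chr G s) univ F (fun z => fderivWithin ℝ F univ z c) y b)
        (nab (chr G s) univ F (fun z => fderivWithin ℝ F univ z e) y a) := by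
    intro a b
    have h1 := nab_metric (F := id) hu (mapsTo_univ _ _) hG'y.diff hG'y.compat
      differentiableWithinAt_id ((hΓ'.clm_apply (differentiableWithinAt_const b)).clm_apply
        (differentiableWithinAt_const c)) (differentiableWithinAt_const e) a
    have h2 := nab_metric hu hst hGy.diff hGy.compat
      (hFy.differentiableAt (by simp)).differentiableWithinAt (hnab c b)
      ((hD e).differentiableAt (by simp)).differentiableWithinAt a
    have h3 : nab (chr G' univ) univ id (fun _ => e) y a = chr G' univ y a e := by
      rw [nab_apply, fderivWithin_id hu]
      simp
    rw [h3] at h1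
    simp only [id_eq] at h1
    rw [← h1, ← h2]
    congr 1
    rw [fderivWithin_univ, fderivWithin_univ]
    apply Filter.EventuallyEq.fderiv_eq
    filter_upwards [hG, hG', hF, eventually_eventually_nhds.2 h] with z hz hz' hFz hhz
    rw [chr_spec hz'.inv, chrFst_pullback hz hst uniqueDiffOn_univ (mem_univ z) (by simp)
      hFz.contDiffWithinAt hz'.diff (by rwa [nhdsWithin_univ])]
  have hcomm := nab_comm (hGy.chr_smooth.differentiableWithinAt (by simp)) hst uniqueDiffOn_univ
    (mem_univ y) (by simp) hFy.contDiffWithinAt (hD c).contDiffWithinAt a b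
  rw [← hcomm, HypBdry.curv]
  have k1 := key a b
  have k2 := key b a
  rw [nab_chr_apply hG'y] at k1 k2
  simp only [map_add, map_sub, add_apply, sub_apply] at k1 k2 ⊢
  linear_combination k1 - k2

end GaussChart

/-! ### The Gauss equation -/

section Gauss

variable {M : Type*} [TopologicalSpace M] [ChartedSpace (EuclideanHalfSpace 3) M]
  [IsManifold (𝓡∂ 3) ∞ M]
  {B : Type*} [TopologicalSpace B] [ChartedSpace (EuclideanSpace ℝ (Fin 2)) B]
  [IsManifold (𝓡 2) ∞ B] {g : MetricField (𝓡∂ 3) M} {vol : TriField M} {ι : B → M}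
  {n : VField (𝓡∂ 3) M}

/-- The second fundamental form `⟨∇_X n, Y⟩` of the boundary. -/
def sff (g : MetricField (𝓡∂ 3) M) (ι : B → M) (n : VField (𝓡∂ 3) M) (x : B) (a b : E2) : ℝ :=
  bil g (ι x) (cd g n (ι x) (di ι x a)) (di ι x b)

/-- The derivative of the unit normal is tangential. -/
lemma bil_cd_normal (hg : IsSmoothMetric g) (hι : IsBoundaryInclusion ι)
    (hn : IsInwardUnitNormal g ι n) (x : B) (a : E2) :
    bil g (ι x) (cd g n (ι x) (di ι x a)) (vf n (ι x)) = 0 := by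
  have h := d0_pairing hg hι hn.smoothAlong hn.smoothAlong x a
  have h1 : pairing g ι n n = fun _ => 1 := funext hn.unit
  rw [d0_apply (smooth_pairing hg hι hn.smoothAlong hn.smoothAlong), h1,
    hg.bil_symm _ (vf n (ι x))] at h
  simp at h
  linarith

/-- The normal component of the second derivatives of the inclusion is minus the second
fundamental form. -/
lemma bil_nab_bD_normal (hg : IsSmoothMetric g) (hι : IsBoundaryInclusion ι)
    (hn : IsInwardUnitNormal g ι n) (x : B) (a b : E2) :
    bil g (ι x) (nab (chr (coordMetric g (ι x)) (range (𝓡∂ 3))) univ (bF ι x (ι x))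
      (fun y => bD ι x (ι x) y b) (extChartAt (𝓡 2) x x) a) (vf n (ι x)) = -sff g ι n x a b := by
  have hb := mem_bT_self (ι := ι) x
  have h := fderiv_metric_along hg hι hb (hn.smoothAlong.al_diff hι hb)
    (bD_differentiable hι hb b) a
  have h0 : (fun y => coordMetric g (ι x) (bF ι x (ι x) y) (al ι n x (ι x) y)
      (bD ι x (ι x) y b)) =ᶠ[𝓝 (extChartAt (𝓡 2) x x)] fun _ => 0 := by
    filter_upwards [bT_nhds hι hb] with z hz
    rw [coordMetric_bF hz, fr_al n hz, fr_bD hι hz]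
    exact hn.normal _ _
  have e2 := hn.smoothAlong.cv_self hg hι x a
  rw [cv] at e2
  rw [h0.fderiv_eq, e2, al_self, bD_self hι, bF_self, coordMetric_self,
    hg.bil_symm _ (vf n (ι x))] at h
  simp only [fderiv_fun_const, Pi.zero_apply, zero_apply] at h
  rw [sff]
  linarith

lemma sff_symm (hg : IsSmoothMetric g) (hι : IsBoundaryInclusion ι)
    (hn : IsInwardUnitNormal g ι n) (x : B) (a b : E2) : sff g ι n x a b = sff g ι n x b a := by
  have h1 := bil_nab_bD_normal hg hι hn x a b
  have h2 := bil_nab_bD_normal hg hι hn x b a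
  rw [nab_bD_symm hg hι (mem_bT_self x)] at h1
  linarith

/-- The Gauss equation for the boundary of a hyperbolic manifold. -/
lemma gauss_equation [T2Space M] (hg : IsSmoothMetric g) (hh : IsHyperbolic g)
    (hvol : IsVolumeForm g vol) (hι : IsBoundaryInclusion ι) (hn : IsInwardUnitNormal g ι n)
    (x : B) (a b c e : E2) :
    bil (inducedMetric g ι) x (curvature (inducedMetric g ι) x a b c : E2) e =
      bil (inducedMetric g ι) x a c * bil (inducedMetric g ι) x b e -
      bil (inducedMetric g ι) x b c * bil (inducedMetric g ι) x a e +
      (sff g ι n x b c * sff g ι n x a e - sff g ι n x a c * sff g ι n x b e) := by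
  have hgB := isSmoothMetric_induced hg hι
  have hb := mem_bT_self (ι := ι) x
  obtain ⟨f1, f2, hf⟩ := exists_adapted hg hvol hι hn x
  have hr := hf.rotFrame hg hvol hι hn
  have hself := coordMetric_self (inducedMetric g ι) x
  have h := curv_pullback (G := coordMetric g (ι x)) (G' := coordMetric (inducedMetric g ι) x)
    (F := bF ι x (ι x)) (y := extChartAt (𝓡 2) x x) (bF_mem_range ι x (ι x) univ)
    (by filter_upwards [bT_nhds hι hb] with z hz using hg _ _ (bF_mem_target hz))
    (by
      filter_upwards [bT_nhds hι hb] with z hz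
      rw [← range2]
      exact hgB _ _ hz.1)
    (by filter_upwards [bT_nhds hι hb] with z hz using bF_smooth hι hz)
    (by filter_upwards [bT_nhds hι hb] with z hz a b using coordMetric_induced hι hz a b) a b c e
  -- the tangential part of the second derivatives of the inclusion is intrinsic
  have hΓ : ∀ b c e, bil g (ι x) (nab (chr (coordMetric g (ι x)) (range (𝓡∂ 3))) univ
      (bF ι x (ι x)) (fun y => bD ι x (ι x) y c) (extChartAt (𝓡 2) x x) b) (di ι x e) =
      bil (inducedMetric g ι) x (chr (coordMetric (inducedMetric g ι) x) univ
        (extChartAt (𝓡 2) x x) b c) e := by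
    intro b c e
    have hm := hgB x _ (mem_extChartAt_target x)
    rw [range2] at hm
    have hp := chrFst_pullback (hg _ _ (bF_mem_target hb)) (bF_mem_range ι x (ι x) univ)
      uniqueDiffOn_univ (mem_univ _) (by simp) (bF_smooth hι hb).contDiffWithinAt hm.diff
      (by
        rw [nhdsWithin_univ]
        filter_upwards [bT_nhds hι hb] with z hz a b using coordMetric_induced hι hz a b) b c e
    rw [← hself, chr_spec hm.inv, hp]
    change _ = coordMetric g (ι x) _ _ (bD ι x (ι x) (extChartAt (𝓡 2) x x) e)
    rw [bD_self hι, bF_self, coordMetric_self]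
    rfl
  have hN := bil_nab_bD_normal hg hι hn x
  have hprod : ∀ b c a e, bil g (ι x) (nab (chr (coordMetric g (ι x)) (range (𝓡∂ 3))) univ
      (bF ι x (ι x)) (fun y => bD ι x (ι x) y c) (extChartAt (𝓡 2) x x) b)
      (nab (chr (coordMetric g (ι x)) (range (𝓡∂ 3))) univ
      (bF ι x (ι x)) (fun y => bD ι x (ι x) y e) (extChartAt (𝓡 2) x x) a) -
      bil (inducedMetric g ι) x (chr (coordMetric (inducedMetric g ι) x) univ
        (extChartAt (𝓡 2) x x) b c) (chr (coordMetric (inducedMetric g ι) x) univ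
        (extChartAt (𝓡 2) x x) a e) = sff g ι n x b c * sff g ι n x a e := by
    intro b c a e
    rw [hf.frame.inner, hr.inner, hΓ, hΓ, hΓ, hΓ, hN, hN]
    ring
  change _ = coordMetric g (ι x) (bF ι x (ι x) (extChartAt (𝓡 2) x x))
    (curv _ _ _ (bD ι x (ι x) (extChartAt (𝓡 2) x x) a) (bD ι x (ι x) (extChartAt (𝓡 2) x x) b)
      (bD ι x (ι x) (extChartAt (𝓡 2) x x) c)) (bD ι x (ι x) (extChartAt (𝓡 2) x x) e) +
    (coordMetric g (ι x) (bF ι x (ι x) (extChartAt (𝓡 2) x x))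
      (nab _ _ _ (fun y => bD ι x (ι x) y c) _ b) (nab _ _ _ (fun y => bD ι x (ι x) y e) _ a) - _) -
    (coordMetric g (ι x) (bF ι x (ι x) (extChartAt (𝓡 2) x x))
      (nab _ _ _ (fun y => bD ι x (ι x) y c) _ a) (nab _ _ _ (fun y => bD ι x (ι x) y e) _ b) - _)
    at h
  rw [bD_self hι, bF_self, hself, coordMetric_self, hh.curv hg, hprod, hprod] at h
  rw [curvature_eq_curv hgB, range2, h]
  simp only [map_sub, map_smul, sub_apply, smul_apply, smul_eq_mul, bil_inducedMetric]
  ring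

/-- The Gaussian curvature of the boundary is `-1 + det S`. It is defined by the coordinate frame,
and here computed in an adapted frame. -/
lemma gaussCurvature_eq [T2Space M] (hg : IsSmoothMetric g) (hh : IsHyperbolic g)
    (hvol : IsVolumeForm g vol) (hι : IsBoundaryInclusion ι) (hn : IsInwardUnitNormal g ι n)
    {x : B} {f1 f2 : E2} (hf : Adapted g vol ι n x f1 f2) :
    gaussCurvature (inducedMetric g ι) x = -1 +
      (sff g ι n x f1 f1 * sff g ι n x f2 f2 - sff g ι n x f1 f2 ^ 2) := by
  have hr := hf.rotFrame hg hvol hι hn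
  have h0 := hr.area_ne_zero
  rw [hr.area] at h0
  have hK : gaussCurvature (inducedMetric g ι) x =
      bil (inducedMetric g ι) x (curvature (inducedMetric g ι) x (EuclideanSpace.single 0 1 : E2)
        (EuclideanSpace.single 1 1 : E2) (EuclideanSpace.single 1 1 : E2) : E2)
        (EuclideanSpace.single 0 1) /
      (bil (inducedMetric g ι) x (EuclideanSpace.single 0 1) (EuclideanSpace.single 0 1) *
        bil (inducedMetric g ι) x (EuclideanSpace.single 1 1) (EuclideanSpace.single 1 1) -
        bil (inducedMetric g ι) x (EuclideanSpace.single 0 1) (EuclideanSpace.single 1 1) ^ 2) :=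
    rfl
  rw [hK, gauss_equation hg hh hvol hι hn]
  generalize (EuclideanSpace.single 0 1 : E2) = e0 at *
  generalize (EuclideanSpace.single 1 1 : E2) = e1 at *
  have hs : ∀ a b, sff g ι n x a b =
      bil (inducedMetric g ι) x a f1 * bil (inducedMetric g ι) x b f1 * sff g ι n x f1 f1 +
      (bil (inducedMetric g ι) x a f1 * bil (inducedMetric g ι) x b f2 +
       bil (inducedMetric g ι) x a f2 * bil (inducedMetric g ι) x b f1) * sff g ι n x f1 f2 +
      bil (inducedMetric g ι) x a f2 * bil (inducedMetric g ι) x b f2 * sff g ι n x f2 f2 := by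
    intro a b
    have h21 := sff_symm hg hι hn x f2 f1
    unfold sff at h21 ⊢
    conv_lhs => rw [hr.expand a, hr.expand b]
    simp only [map_add, map_smul, add_apply, smul_apply, smul_eq_mul]
    linear_combination (bil (inducedMetric g ι) x a f2 * bil (inducedMetric g ι) x b f1) * h21
  rw [hs e1 e1, hs e0 e0, hs e0 e1, hs e1 e0, hr.inner e0 e0, hr.inner e0 e1, hr.inner e1 e0,
    hr.inner e1 e1]
  generalize bil (inducedMetric g ι) x e0 f1 = p at *
  generalize bil (inducedMetric g ι) x e0 f2 = q at *
  generalize bil (inducedMetric g ι) x e1 f1 = r at *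
  generalize bil (inducedMetric g ι) x e1 f2 = t at *
  rw [div_eq_iff]
  · ring
  · have : (p * p + q * q) * (r * r + t * t) - (p * r + q * t) ^ 2 = (p * t - q * r) ^ 2 := by ring
    rw [this]
    exact pow_ne_zero 2 h0

end Gauss

/-! ### The forms on the boundary in an adapted frame -/

section Pointwise

variable {M : Type*} [TopologicalSpace M] [ChartedSpace (EuclideanHalfSpace 3) M]
  [IsManifold (𝓡∂ 3) ∞ M]
  {B : Type*} [TopologicalSpace B] [ChartedSpace (EuclideanSpace ℝ (Fin 2)) B]
  [IsManifold (𝓡 2) ∞ B]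

section Smoothness
variable {gB : MetricField (𝓡 2) B} {J : EndField B}

lemma smooth0_star2_wedge (hg : IsSmoothMetric gB) (hJ : IsRot gB J) (hJs : SmoothEnd J)
    {α β : OneForm B} (hα : Smooth1 α) (hβ : Smooth1 β) : Smooth0 (star2 gB J (wedge α β)) := by
  intro x y hy
  have hl : ∀ {α : OneForm B} (_ : Smooth1 α) (a : E2), ContDiffAt ℝ ∞ (fun y => lf α x y a) y :=
    fun h a => (h x y hy).clm_apply contDiffAt_const
  have hD := ((hl hα (EuclideanSpace.single 0 1)).mul (hl hβ (EuclideanSpace.single 1 1))).sub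
    ((hl hα (EuclideanSpace.single 1 1)).mul (hl hβ (EuclideanSpace.single 0 1)))
  refine (hD.div (ar_smooth hg hJs hy) (ar_ne_zero hJ hy)).congr_of_eventuallyEq ?_
  filter_upwards [(isOpen_target2 x).mem_nhds hy] with z hz
  have h1 := star2_mul (θ := wedge α β) (x := (extChartAt (𝓡 2) x).symm z)
    (β := (vl α ((extChartAt (𝓡 2) x).symm z)).smulRight (vl β ((extChartAt (𝓡 2) x).symm z))) hJ
    (fun a b => by simp only [ContinuousLinearMap.smulRight_apply]; rfl)
    (fr (𝓡 2) x z (EuclideanSpace.single 0 1)) (fr (𝓡 2) x z (EuclideanSpace.single 1 1))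
  simp only [Pi.div_apply]
  rw [eq_div_iff (ar_ne_zero hJ hz)]
  exact h1.symm

lemma smooth0_delta1 (hg : IsSmoothMetric gB) (hJ : IsRot gB J) (hJs : SmoothEnd J)
    {α : OneForm B} (hα : Smooth1 α) : Smooth0 (delta1 gB J α) :=
  (smooth0_star2_d1 hg hJ hJs (hα.star hJs)).neg

end Smoothness

variable {g : MetricField (𝓡∂ 3) M} {vol : TriField M} {ι : B → M}
  {n u u' : VField (𝓡∂ 3) M}

lemma Adapted.shapeOp_apply (hg : IsSmoothMetric g) (hι : IsBoundaryInclusion ι)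
    (hn : IsInwardUnitNormal g ι n) {x : B} {f1 f2 : E2} (h : Adapted g vol ι n x f1 f2) (a : E2) :
    en (shapeOp g ι n) x a = sff g ι n x a f1 • f1 + sff g ι n x a f2 • f2 := by
  rw [h.expand hg hι hn (en (shapeOp g ι n) x a), bil_shapeOp hg hι, bil_shapeOp hg hι]
  rfl

lemma Adapted.meanCurvature_eq (hg : IsSmoothMetric g) (hvol : IsVolumeForm g vol)
    (hι : IsBoundaryInclusion ι)
    (hn : IsInwardUnitNormal g ι n) {x : B} {f1 f2 : E2} (h : Adapted g vol ι n x f1 f2) :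
    meanCurvature g ι n x = sff g ι n x f1 f1 + sff g ι n x f2 f2 := by
  have h1 := trc_eq (L := shapeOp g ι n) (h.rotFrame hg hvol hι hn)
  rw [bil_shapeOp hg hι, bil_shapeOp hg hι] at h1
  exact h1

lemma smooth0_meanCurvature (hg : IsSmoothMetric g) (hι : IsBoundaryInclusion ι)
    (hn : IsInwardUnitNormal g ι n) : Smooth0 (meanCurvature g ι n) :=
  smooth0_trc (smoothEnd_shapeOp hg hι hn)

/-- The Gaussian curvature is smooth: it is `-1 + det S`, where `2 det S = (tr S)² - tr S²`. -/
lemma smooth0_gaussCurvature [T2Space M] (hg : IsSmoothMetric g) (hh : IsHyperbolic g)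
    (hvol : IsVolumeForm g vol) (hι : IsBoundaryInclusion ι) (hn : IsInwardUnitNormal g ι n) :
    Smooth0 (gaussCurvature (inducedMetric g ι)) := by
  have hS := smoothEnd_shapeOp hg hι hn
  have hH := smooth0_trc hS
  have h2 := smooth0_trc (hS.comp hS)
  have h := (Smooth0.const (B := B) (-1)).add ((Smooth0.const (1 / 2)).mul ((hH.mul hH).sub h2))
  convert h using 1
  funext x
  obtain ⟨f1, f2, hf⟩ := exists_adapted hg hvol hι hn x
  have hr := hf.rotFrame hg hvol hι hn
  have e1 : trc (fun q => shapeOp g ι n q ∘L shapeOp g ι n q) x =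
      bil (inducedMetric g ι) x (en (shapeOp g ι n) x (en (shapeOp g ι n) x f1)) f1 +
      bil (inducedMetric g ι) x (en (shapeOp g ι n) x (en (shapeOp g ι n) x f2)) f2 :=
    trc_eq (L := fun q => shapeOp g ι n q ∘L shapeOp g ι n q) hr
  have e2 : trc (shapeOp g ι n) x = _ := hf.meanCurvature_eq hg hvol hι hn
  rw [gaussCurvature_eq hg hh hvol hι hn hf, e1, e2, hf.shapeOp_apply hg hι hn f1,
    hf.shapeOp_apply hg hι hn f2]
  simp only [map_add, map_smul, add_apply, smul_apply, smul_eq_mul, bil_shapeOp hg hι]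
  have e3 : ∀ a b, bil g (ι x) (cd g n (ι x) (di ι x a)) (di ι x b) = sff g ι n x a b :=
    fun _ _ => rfl
  simp only [e3, sff_symm hg hι hn x f2 f1]
  ring

/-- The star of the 1-form dual to the tangential part of `u`. -/
lemma star1_flatB (hg : IsSmoothMetric g) (hvol : IsVolumeForm g vol)
    (hι : IsBoundaryInclusion ι) (hn : IsInwardUnitNormal g ι n) (u : VField (𝓡∂ 3) M) :
    star1 (rotJ g vol ι n) (flatB g ι u) = twistForm vol ι n u := by
  funext x
  obtain ⟨f1, f2, hf⟩ := exists_adapted hg hvol hι hn x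
  have hT := hf.tri_eq hvol
  have key : ∀ a : E2, vl (star1 (rotJ g vol ι n) (flatB g ι u)) x a =
      vl (twistForm vol ι n u) x a := by
    intro a
    have e1 : vl (twistForm vol ι n u) x a =
      -tri vol (ι x) (vf n (ι x)) (di ι x a) (vf u (ι x)) := rfl
    have e2 : vl (flatB g ι u) x (en (rotJ g vol ι n) x a) =
      bil g (ι x) (vf u (ι x)) (di ι x (en (rotJ g vol ι n) x a)) := rfl
    rw [star1_apply, e1, e2, hf.expand hg hι hn (en (rotJ g vol ι n) x a), bil_rotJ hg hι,
      bil_rotJ hg hι]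
    simp only [map_add, map_smul, smul_eq_mul]
    rw [hT _ _ (di ι x f1), hT _ _ (di ι x f2), hT _ _ (vf u (ι x))]
    simp only [det3, hf.frame.h00, hf.frame.h01, hf.frame.h02, hf.frame.h10, hf.frame.h11,
      hf.frame.h12, hf.frame.h20, hf.frame.h21, hf.frame.h22]
    ring
  exact ContinuousLinearMap.ext key

/-- In an adapted frame, the formula `d * σ = (tr ∇u - h H) dA`, where the trace is over the
tangential directions: it says that the divergence of the tangential part of `u` is
`tr ∇u - h H`. -/
lemma Adapted.d1_twistForm_eq [T2Space M] (hg : IsSmoothMetric g) (hvol : IsVolumeForm g vol)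
    (hι : IsBoundaryInclusion ι) (hn : IsInwardUnitNormal g ι n) (hu : SmoothAlong ι u)
    {x : B} {f1 f2 : E2} (hf : Adapted g vol ι n x f1 f2) :
    d1 (twistForm vol ι n u) x f1 f2 =
      bil g (ι x) (cd g u (ι x) (di ι x f1)) (di ι x f1) +
      bil g (ι x) (cd g u (ι x) (di ι x f2)) (di ι x f2) -
      pairing g ι u n x * (sff g ι n x f1 f1 + sff g ι n x f2 f2) := by
  have hT := hf.tri_eq hvol
  have hN := bil_cd_normal hg hι hn x
  rw [d1_twistForm hg hvol hι hn.smoothAlong hu, hT, hT, hT, hT]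
  simp only [det3, hf.frame.h00, hf.frame.h01, hf.frame.h02, hf.frame.h10, hf.frame.h11,
      hf.frame.h12, hf.frame.h20, hf.frame.h21, hf.frame.h22, hN, pairing, sff]
  ring

end Pointwise

/-! ### The pointwise identity -/

section Identity

variable {M : Type*} [TopologicalSpace M] [ChartedSpace (EuclideanHalfSpace 3) M]
  [IsManifold (𝓡∂ 3) ∞ M]
  {B : Type*} [TopologicalSpace B] [ChartedSpace (EuclideanSpace ℝ (Fin 2)) B]
  [IsManifold (𝓡 2) ∞ B]
  {g : MetricField (𝓡∂ 3) M} {vol : TriField M} {ι : B → M}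
  {n u u' : VField (𝓡∂ 3) M}

/-- A field of endomorphisms of the tangent spaces of `M` as a function with values in the
endomorphisms of the model space. -/
def endo (η : Π x : M, TangentSpace (𝓡∂ 3) x →L[ℝ] TangentSpace (𝓡∂ 3) x) (p : M) :
    E3 →L[ℝ] E3 := η p

/-- In an adapted frame, the formula `d (h * σ) = dh ∧ *σ + h d * σ`. -/
lemma Adapted.d1_pairing_smul_star [T2Space M] (hg : IsSmoothMetric g)
    (hvol : IsVolumeForm g vol)
    (hι : IsBoundaryInclusion ι) (hn : IsInwardUnitNormal g ι n) (hu : SmoothAlong ι u)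
    {x : B} {f1 f2 : E2} (hf : Adapted g vol ι n x f1 f2) :
    d1 (fun x => pairing g ι u n x • twistForm vol ι n u x) x f1 f2 =
      d0 (pairing g ι u n) x f1 * vl (flatB g ι u) x f1 +
      d0 (pairing g ι u n) x f2 * vl (flatB g ι u) x f2 +
      pairing g ι u n x * d1 (twistForm vol ι n u) x f1 f2 := by
  have hr := hf.rotFrame hg hvol hι hn
  have e1 : vl (twistForm vol ι n u) x f1 = - vl (flatB g ι u) x f2 := by
    rw [← star1_flatB hg hvol hι hn, star1_apply, hr.J1]
  have e2 : vl (twistForm vol ι n u) x f2 = vl (flatB g ι u) x f1 := by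
    rw [← star1_flatB hg hvol hι hn, star1_apply, hr.J2, map_neg, neg_neg]
  rw [d1_smul (smooth_pairing hg hι hu hn.smoothAlong)
    (smooth_twistForm hvol hι hn.smoothAlong hu), e1, e2]
  ring

/-- The star of `η ∧ η'` in an adapted frame. -/
lemma star2_bdryWedge (hg : IsSmoothMetric g) (hvol : IsVolumeForm g vol)
    (hι : IsBoundaryInclusion ι) (hn : IsInwardUnitNormal g ι n)
    (η η' : Π x : M, TangentSpace (𝓡∂ 3) x →L[ℝ] TangentSpace (𝓡∂ 3) x) {x : B} {f1 f2 : E2}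
    (hf : Adapted g vol ι n x f1 f2) :
    star2 (inducedMetric g ι) (rotJ g vol ι n) (bdryWedge g ι η η') x =
      bil g (ι x) (endo η (ι x) (di ι x f1)) (endo η' (ι x) (di ι x f2)) -
      bil g (ι x) (endo η (ι x) (di ι x f2)) (endo η' (ι x) (di ι x f1)) := by
  let P : E2 →L[ℝ] E3 := endo η (ι x) ∘L di ι x
  let P' : E2 →L[ℝ] E3 := endo η' (ι x) ∘L di ι x
  let β : E2 →L[ℝ] E2 →L[ℝ] ℝ := (ContinuousLinearMap.precomp ℝ P') ∘L bil g (ι x) ∘L P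
  exact star2_eq (θ := bdryWedge g ι η η') (β := β) (isRot_rotJ hg hvol hι hn)
    (fun a b => rfl) (hf.rotFrame hg hvol hι hn)

/-- The 1-form `⟨u, ∇ u'⟩ + h * σ + h' * σ'`; its exterior derivative is the difference of the two
sides of the formula for `b`. -/
def primitiveForm (g : MetricField (𝓡∂ 3) M) (vol : TriField M) (ι : B → M)
    (n u u' : VField (𝓡∂ 3) M) : OneForm B := fun x =>
  connForm g ι u u' x + (pairing g ι u n x • twistForm vol ι n u x +
    pairing g ι u' n x • twistForm vol ι n u' x)

lemma smooth_primitiveForm [T2Space M] (hg : IsSmoothMetric g) (hvol : IsVolumeForm g vol)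
    (hι : IsBoundaryInclusion ι) (hn : IsInwardUnitNormal g ι n) (hu : SmoothAlong ι u)
    (hu' : SmoothAlong ι u') : Smooth1 (primitiveForm g vol ι n u u') :=
  (smooth_connForm hg hι hu hu').add
    (((smooth_twistForm hvol hι hn.smoothAlong hu).smul
      (smooth_pairing hg hι hu hn.smoothAlong)).add
    ((smooth_twistForm hvol hι hn.smoothAlong hu').smul
      (smooth_pairing hg hι hu' hn.smoothAlong)))

/-- The pointwise form of the formula for `b`: the two sides differ by the exterior derivative of
`primitiveForm`. In an adapted frame both are polynomials in the components of `u`, `u'`, `∇u`,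
`∇u'` and of the second fundamental form. The hyperbolic metric enters through `d1_connForm`,
through the components of `d_E s` and through the Gauss equation for `K`. -/
lemma star2_bdryWedge_eq [T2Space M] (hg : IsSmoothMetric g) (hh : IsHyperbolic g)
    (hvol : IsVolumeForm g vol) (hι : IsBoundaryInclusion ι) (hn : IsInwardUnitNormal g ι n)
    (hu : SmoothAlong ι u) (hu' : SmoothAlong ι u')
    {η η' : Π x : M, TangentSpace (𝓡∂ 3) x →L[ℝ] TangentSpace (𝓡∂ 3) x}
    (hη : IsCoboundary g vol u u' η η') (x : B) :
    let gB := inducedMetric g ι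
    let J := rotJ g vol ι n
    let S := shapeOp g ι n
    let H := meanCurvature g ι n
    let K := gaussCurvature gB
    let σ := flatB g ι u
    let σ' := flatB g ι u'
    let h := pairing g ι u n
    let h' := pairing g ι u' n
    star2 gB J (bdryWedge g ι η η') x =
      2 * (h x * delta1 gB J σ x + h' x * delta1 gB J σ' x) -
      star2 gB J (wedge (fun x => actOn S σ x + star1 J σ' x)
        (star1 J (fun x => star1 J (actOn S σ') x + σ x))) x -
      (H x * h x * h x + H x * h' x * h' x) +
      star2 gB J (wedge (fun x => K x • σ x) (star1 J (star1 J σ'))) x +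
      star2 gB J (d1 (primitiveForm g vol ι n u u')) x := by
  intro gB J S H K σ σ' h h'
  obtain ⟨f1, f2, hf⟩ := exists_adapted hg hvol hι hn x
  have hr : RotFrame (bil gB x) (en J x) f1 f2 := hf.rotFrame hg hvol hι hn
  have hJ : IsRot gB J := isRot_rotJ hg hvol hι hn
  have hstar : ∀ (α : OneForm B), vl (star1 J α) x f1 = - vl α x f2 ∧
      vl (star1 J α) x f2 = vl α x f1 := fun α =>
    ⟨by rw [star1_apply, hr.J1], by rw [star1_apply, hr.J2, map_neg, neg_neg]⟩
  have hact : ∀ (α : OneForm B) (a : E2), vl (actOn S α) x a =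
      sff g ι n x a f1 * vl α x f1 + sff g ι n x a f2 * vl α x f2 := fun α a => by
    have : vl (actOn S α) x a = vl α x (en S x a) := rfl
    rw [this, hf.shapeOp_apply hg hι hn, map_add, map_smul, map_smul, smul_eq_mul, smul_eq_mul]
  have hadd : ∀ (α β : OneForm B) (a : E2), vl (fun x => α x + β x) x a = vl α x a + vl β x a :=
    fun _ _ _ => rfl
  have hsmul : ∀ (f : B → ℝ) (α : OneForm B) (a : E2), vl (fun x => f x • α x) x a =
    f x * vl α x a := fun _ _ _ => rfl
  have hδ : ∀ {w : VField (𝓡∂ 3) M} (_ : SmoothAlong ι w), delta1 gB J (flatB g ι w) x =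
      -d1 (twistForm vol ι n w) x f1 f2 := fun {w} _ => by
    rw [delta1, star1_flatB hg hvol hι hn, star2_d1_eq hJ _ hr]
  have hprim : d1 (primitiveForm g vol ι n u u') x f1 f2 = d1 (connForm g ι u u') x f1 f2 +
      (d1 (fun x => pairing g ι u n x • twistForm vol ι n u x) x f1 f2 +
      d1 (fun x => pairing g ι u' n x • twistForm vol ι n u' x) x f1 f2) := by
    have s1 := (smooth_twistForm hvol hι hn.smoothAlong hu).smul
      (smooth_pairing hg hι hu hn.smoothAlong)
    have s2 := (smooth_twistForm hvol hι hn.smoothAlong hu').smul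
      (smooth_pairing hg hι hu' hn.smoothAlong)
    have := d1_add (smooth_connForm hg hι hu hu') (s1.add s2) x f1 f2
    rw [d1_add s1 s2] at this
    exact this
  have hT := hf.tri_eq hvol
  have hη1 : ∀ a c : E3, bil g (ι x) (endo η (ι x) a) c =
      bil g (ι x) (cd g u (ι x) a) c - tri vol (ι x) (vf u' (ι x)) a c := fun a c =>
    (hη.eq hg hh hvol (ι x) a c).1
  have hη2 : ∀ a c : E3, bil g (ι x) (endo η' (ι x) a) c =
      bil g (ι x) (cd g u' (ι x) a) c + tri vol (ι x) (vf u (ι x)) a c := fun a c =>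
    (hη.eq hg hh hvol (ι x) a c).2
  rw [star2_d1_eq hJ _ hr, star2_inner1 hJ _ _ hr, star2_inner1 hJ _ _ hr,
    star2_bdryWedge hg hvol hι hn η η' hf, hδ hu, hδ hu', hprim,
    hf.d1_pairing_smul_star hg hvol hι hn hu, hf.d1_pairing_smul_star hg hvol hι hn hu',
    hf.d1_twistForm_eq hg hvol hι hn hu, hf.d1_twistForm_eq hg hvol hι hn hu',
    d1_connForm hg hh hι hu hu', d0_pairing hg hι hu hn.smoothAlong,
    d0_pairing hg hι hu hn.smoothAlong, d0_pairing hg hι hu' hn.smoothAlong,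
    d0_pairing hg hι hu' hn.smoothAlong]
  simp only [hadd, hsmul, hact, (hstar _).1, (hstar _).2]
  have hK : K x = _ := gaussCurvature_eq hg hh hvol hι hn hf
  have hH : H x = _ := hf.meanCurvature_eq hg hvol hι hn
  rw [hK, hH]
  have hN := bil_cd_normal hg hι hn x
  have v1 : ∀ a, vl σ x a = bil g (ι x) (vf u (ι x)) (di ι x a) := fun _ => rfl
  have v2 : ∀ a, vl σ' x a = bil g (ι x) (vf u' (ι x)) (di ι x a) := fun _ => rfl
  have v1' : ∀ a, vl (flatB g ι u) x a = bil g (ι x) (vf u (ι x)) (di ι x a) := fun _ => rfl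
  have v2' : ∀ a, vl (flatB g ι u') x a = bil g (ι x) (vf u' (ι x)) (di ι x a) := fun _ => rfl
  have w1 : h x = bil g (ι x) (vf u (ι x)) (vf n (ι x)) := rfl
  have w2 : h' x = bil g (ι x) (vf u' (ι x)) (vf n (ι x)) := rfl
  have w1' : pairing g ι u n x = bil g (ι x) (vf u (ι x)) (vf n (ι x)) := rfl
  have w2' : pairing g ι u' n x = bil g (ι x) (vf u' (ι x)) (vf n (ι x)) := rfl
  have hs : ∀ a b, bil g (ι x) (cd g n (ι x) (di ι x a)) (di ι x b) = sff g ι n x a b :=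
    fun _ _ => rfl
  have hI := hf.frame.inner
  rw [hI (endo η (ι x) (di ι x f1)), hI (endo η (ι x) (di ι x f2)), hη1, hη1, hη1, hη1, hη1, hη1,
    hη2, hη2, hη2, hη2, hη2, hη2,
    hI (cd g u (ι x) (di ι x f1)) (cd g u' (ι x) (di ι x f2)),
    hI (cd g u (ι x) (di ι x f2)) (cd g u' (ι x) (di ι x f1)),
    hI (vf u (ι x)) (cd g n (ι x) (di ι x f1)), hI (vf u (ι x)) (cd g n (ι x) (di ι x f2)),
    hI (vf u' (ι x)) (cd g n (ι x) (di ι x f1)), hI (vf u' (ι x)) (cd g n (ι x) (di ι x f2)),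
    hg.bil_symm (ι x) (di ι x f1) (vf u' (ι x)), hg.bil_symm (ι x) (di ι x f2) (vf u' (ι x))]
  simp only [hT, det3, hf.frame.h00, hf.frame.h01, hf.frame.h02, hf.frame.h10, hf.frame.h11,
    hf.frame.h12, hf.frame.h20, hf.frame.h21, hf.frame.h22, hN, hs, v1, v2, v1', v2', w1, w2, w1',
    w2', sff_symm hg hι hn x f2 f1]
  ring

end Identity

/-! ### Integration over the boundary -/

section Integration

variable {B : Type*} [TopologicalSpace B] [ChartedSpace (EuclideanSpace ℝ (Fin 2)) B]
  [IsManifold (𝓡 2) ∞ B] {gB : MetricField (𝓡 2) B} {J : EndField B}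

/-- The pointwise form of `⟨β, (Δ - K)σ⟩ = ⟨δβ, δσ⟩ + ⟨dβ, dσ⟩ - ⟨Kβ, σ⟩`, with `Δ = dδ + δd`: the
difference is `d (δσ *β - (*dσ) β)`. -/
lemma star2_wedge_laplacian (hJ : IsRot gB J) {σ β : OneForm B} (hβ : Smooth1 β)
    (hsβ : Smooth1 (star1 J β)) (hδ : Smooth0 (delta1 gB J σ)) (hd : Smooth0 (star2 gB J (d1 σ)))
    (K : B → ℝ) (x : B) :
    star2 gB J (wedge β (star1 J (fun x => laplacian gB J σ x - K x • σ x))) x =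
      delta1 gB J β x * delta1 gB J σ x + star2 gB J (d1 σ) x * star2 gB J (d1 β) x -
      K x * star2 gB J (wedge β (star1 J σ)) x +
      star2 gB J (d1 (fun x => delta1 gB J σ x • star1 J β x -
        star2 gB J (d1 σ) x • β x)) x := by
  obtain ⟨f1, f2, hr⟩ := hJ x
  have hstar : ∀ (α : OneForm B), vl (star1 J α) x f1 = - vl α x f2 ∧
      vl (star1 J α) x f2 = vl α x f1 := fun α =>
    ⟨by rw [star1_apply, hr.J1], by rw [star1_apply, hr.J2, map_neg, neg_neg]⟩
  have hL : ∀ a, vl (fun x => laplacian gB J σ x - K x • σ x) x a =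
      vl (d0 (delta1 gB J σ)) x a - vl (star1 J (d0 (star2 gB J (d1 σ)))) x a - K x * vl σ x a :=
    fun a => rfl
  have s1 : Smooth1 (fun x => delta1 gB J σ x • star1 J β x) := hsβ.smul hδ
  have s2 : Smooth1 (fun x => star2 gB J (d1 σ) x • β x) := hβ.smul hd
  have hsub : d1 (fun x => delta1 gB J σ x • star1 J β x - star2 gB J (d1 σ) x • β x) x f1 f2 =
      d1 (fun x => delta1 gB J σ x • star1 J β x) x f1 f2 -
      d1 (fun x => star2 gB J (d1 σ) x • β x) x f1 f2 := by
    have h := d1_add (s1.sub s2) s2 x f1 f2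
    simp only [sub_add_cancel] at h
    linarith
  have hδβ : delta1 gB J β x = - d1 (star1 J β) x f1 f2 := by
    rw [delta1, star2_d1_eq hJ _ hr]
  rw [star2_inner1 hJ _ _ hr, star2_inner1 hJ _ _ hr, hL, hL, star2_d1_eq hJ (fun x =>
    delta1 gB J σ x • star1 J β x - star2 gB J (d1 σ) x • β x) hr, hsub, d1_smul hδ hsβ,
    d1_smul hd hβ, (hstar _).1, (hstar _).2, (hstar _).1, (hstar _).2, hδβ,
    star2_d1_eq hJ β hr]
  have e : ∀ (f : B → ℝ) (a : E2), vl (d0 f) x a = d0 f x a := fun _ _ => rfl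
  simp only [e]
  ring

lemma integral_add_sub_add {X : Type*} [MeasurableSpace X] {μ : Measure X} {f1 f2 f3 f4 : X → ℝ}
    (i1 : Integrable f1 μ) (i2 : Integrable f2 μ) (i3 : Integrable f3 μ) (i4 : Integrable f4 μ) :
    ∫ x, f1 x + f2 x - f3 x + f4 x ∂μ =
      (∫ x, f1 x ∂μ) + (∫ x, f2 x ∂μ) - (∫ x, f3 x ∂μ) + ∫ x, f4 x ∂μ := by
  have k1 : Integrable (fun x => f1 x + f2 x) μ := i1.add i2
  have k2 : Integrable (fun x => f1 x + f2 x - f3 x) μ := k1.sub i3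
  rw [integral_add k2 i4, integral_sub k1 i3, integral_add i1 i2]

variable [MeasurableSpace B] [BorelSpace B]

lemma inner0_eq (hJ : IsRot gB J) (f k : B → ℝ) :
    inner0 gB J f k = ∫ x, f x * k x ∂(area gB) := by
  rw [inner0, integral2]
  simp only [star2_inner0 hJ]

lemma inner2_smul_eq (H : B → ℝ) (θ : TwoForm B) :
    inner2 gB J (fun x a b => H x * θ x a b) θ =
      ∫ x, H x * star2 gB J θ x * star2 gB J θ x ∂(area gB) := by
  rw [inner2, integral2]
  congr 1
  funext x
  rw [star2_inner2]
  simp only [star2]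
  ring

end Integration

section Main

variable {M : Type*} [TopologicalSpace M] [ChartedSpace (EuclideanHalfSpace 3) M]
  [IsManifold (𝓡∂ 3) ∞ M]
  {B : Type*} [TopologicalSpace B] [ChartedSpace (EuclideanSpace ℝ (Fin 2)) B]
  [IsManifold (𝓡 2) ∞ B]
  {g : MetricField (𝓡∂ 3) M} {vol : TriField M} {ι : B → M}
  {n u u' : VField (𝓡∂ 3) M}

lemma IsBoundaryInclusion.t2Space [T2Space M] (hι : IsBoundaryInclusion ι) : T2Space B :=
  hι.isEmbedding.t2Space

/-- The boundary of a compact manifold is closed, hence compact. -/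
lemma IsBoundaryInclusion.compactSpace [CompactSpace M] (hι : IsBoundaryInclusion ι) :
    CompactSpace B := by
  have hc : IsClosed (range ι) := by
    rw [hι.range_eq]
    exact (𝓡∂ 3).isClosed_boundary (n := ∞) (by simp)
  exact Topology.IsClosedEmbedding.compactSpace ⟨hι.isEmbedding, hc⟩

/-- The 1-form dual to the tangential part `v` of `u` is `X ↦ ⟨u, X⟩`. -/
lemma flatB_eq {v : VField (𝓡 2) B} {h : B → ℝ} (hn : IsInwardUnitNormal g ι n)
    (hdec : ∀ x : B, u (ι x) = dincl ι x (v x) + h x • n (ι x)) :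
    (fun x => inducedMetric g ι x (v x) : OneForm B) = flatB g ι u := by
  funext x
  have h1 : vf u (ι x) = di ι x (v x) + h x • vf n (ι x) := hdec x
  have key : ∀ a : E2, bil g (ι x) (di ι x (v x)) (di ι x a) = vl (flatB g ι u) x a := by
    intro a
    have h2 : vl (flatB g ι u) x a = bil g (ι x) (vf u (ι x)) (di ι x a) := rfl
    have h3 : bil g (ι x) (vf n (ι x)) (di ι x a) = 0 := hn.normal x a
    rw [h2, h1, map_add, map_smul, add_apply, smul_apply, h3, smul_zero, add_zero]
  exact ContinuousLinearMap.ext key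

/-- The normal part `h` of `u` is `⟨u, n⟩`. -/
lemma pairing_eq {v : VField (𝓡 2) B} {h : B → ℝ} (hg : IsSmoothMetric g)
    (hn : IsInwardUnitNormal g ι n)
    (hdec : ∀ x : B, u (ι x) = dincl ι x (v x) + h x • n (ι x)) : h = pairing g ι u n := by
  funext x
  have h1 : vf u (ι x) = di ι x (v x) + h x • vf n (ι x) := hdec x
  have h2 : bil g (ι x) (di ι x (v x)) (vf n (ι x)) = 0 := by
    rw [hg.bil_symm]; exact hn.normal x (v x)
  have h3 : bil g (ι x) (vf n (ι x)) (vf n (ι x)) = 1 := hn.unit x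
  rw [pairing, h1, map_add, map_smul, add_apply, smul_apply, h2, h3]
  simp

end Main

end HypBdry

end

theorem mainTheorem6
    {M : Type*} [TopologicalSpace M] [ChartedSpace (EuclideanHalfSpace 3) M]
    [IsManifold (𝓡∂ 3) ∞ M] [CompactSpace M] [T2Space M]
    {B : Type*} [TopologicalSpace B] [ChartedSpace (EuclideanSpace ℝ (Fin 2)) B]
    [IsManifold (𝓡 2) ∞ B] [MeasurableSpace B] [BorelSpace B]
    -- a compact oriented hyperbolic 3-manifold, with metric `g` and volume form `vol`
    (g : Bundle.ContMDiffRiemannianMetric (𝓡∂ 3) ∞ (EuclideanSpace ℝ (Fin 3))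
      (fun x : M => TangentSpace (𝓡∂ 3) x))
    (hg : IsHyperbolic g.inner)
    (vol : Π x : M, TangentSpace (𝓡∂ 3) x →L[ℝ] TangentSpace (𝓡∂ 3) x →L[ℝ]
      TangentSpace (𝓡∂ 3) x →L[ℝ] ℝ)
    (hvol : IsVolumeForm g.inner vol)
    -- its boundary surface, and the inward unit normal
    (ι : B → M) (hι : IsBoundaryInclusion ι)
    (n : VField (𝓡∂ 3) M) (hn : IsInwardUnitNormal g.inner ι n)
    -- the section `s = u + i u'` of `E`, and `d_E s = η + i η'`
    (u u' : VField (𝓡∂ 3) M) (hu : SmoothFieldOn u univ) (hu' : SmoothFieldOn u' univ)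
    (η η' : Π x : M, TangentSpace (𝓡∂ 3) x →L[ℝ] TangentSpace (𝓡∂ 3) x)
    (hη : IsCoboundary g.inner vol u u' η η')
    -- the decompositions `u = v + h n` and `u' = v' + h' n` along the boundary
    (v v' : VField (𝓡 2) B) (h h' : B → ℝ)
    (hdec : ∀ x : B, u (ι x) = dincl ι x (v x) + h x • n (ι x))
    (hdec' : ∀ x : B, u' (ι x) = dincl ι x (v' x) + h' x • n (ι x)) :
    let gB := inducedMetric g.inner ι
    let J := rotJ g.inner vol ι n
    let S := shapeOp g.inner ι n
    let S' : OneForm B → OneForm B := fun α x => -star1 J (actOn S (star1 J α)) x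
    let H := meanCurvature g.inner ι n
    let K := gaussCurvature gB
    let σ : OneForm B := fun x => gB x (v x)
    let σ' : OneForm B := fun x => gB x (v' x)
    let b := integral2 gB J (bdryWedge g.inner ι η η')
    (b = 2 * (inner0 gB J h (delta1 gB J σ) + inner0 gB J h' (delta1 gB J σ'))
        - inner1 gB J (fun x => actOn S σ x + star1 J σ' x)
            (fun x => star1 J (actOn S σ') x + σ x)
        - (inner0 gB J (fun x => H x * h x) h + inner0 gB J (fun x => H x * h' x) h')
        + inner1 gB J (fun x => K x • σ x) (star1 J σ')) ∧
    ∀ A : OneForm B → OneForm B,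
      (∀ x, 2 * h' x = star2 gB J (d1 σ) x) →
      (∀ x, 2 * h x = -star2 gB J (d1 σ') x) →
      (∀ x, σ' x = star1 J (A σ) x) →
      b = inner1 gB J (fun x => A σ x - actOn S σ x) (fun x => σ x - S' (A σ) x)
        + inner1 gB J (A σ) (fun x => laplacian gB J σ x - K x • σ x)
        - (1 / 4) * (inner0 gB J (fun x => H x * delta1 gB J (A σ) x) (delta1 gB J (A σ))
          + inner2 gB J (fun x a c => H x * d1 σ x a c) (d1 σ)) := by
  intro gB J S S' H K σ σ' b
  have hT2 : T2Space B := hι.t2Space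
  have hcB : CompactSpace B := hι.compactSpace
  have hgs : IsSmoothMetric (I := 𝓡∂ 3) g.inner := isSmoothMetric_contMDiff g
  have hua : SmoothAlong ι u := ⟨univ, isOpen_univ, subset_univ _, hu⟩
  have hua' : SmoothAlong ι u' := ⟨univ, isOpen_univ, subset_univ _, hu'⟩
  have hgB : IsSmoothMetric gB := isSmoothMetric_induced hgs hι
  have hJ : IsRot gB J := isRot_rotJ hgs hvol hι hn
  have hJs : SmoothEnd J := smoothEnd_rotJ hgs hvol hι hn
  have hSs : SmoothEnd S := smoothEnd_shapeOp hgs hι hn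
  have hσe : σ = flatB g.inner ι u := flatB_eq hn hdec
  have hσe' : σ' = flatB g.inner ι u' := flatB_eq hn hdec'
  have hhe : h = pairing g.inner ι u n := pairing_eq hgs hn hdec
  have hhe' : h' = pairing g.inner ι u' n := pairing_eq hgs hn hdec'
  have hσ : Smooth1 σ := hσe ▸ smooth_flatB hgs hι hua
  have hσ' : Smooth1 σ' := hσe' ▸ smooth_flatB hgs hι hua'
  have hh : Smooth0 h := hhe ▸ smooth_pairing hgs hι hua hn.smoothAlong
  have hh' : Smooth0 h' := hhe' ▸ smooth_pairing hgs hι hua' hn.smoothAlong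
  have hH : Smooth0 H := smooth0_meanCurvature hgs hι hn
  have hK : Smooth0 K := smooth0_gaussCurvature hgs hg hvol hι hn
  have hint : ∀ {f : B → ℝ}, Smooth0 f → Integrable f (area gB) := fun hf =>
    integrable_area hgB hJ hJs hf.continuous
  have hw : ∀ {α β : OneForm B}, Smooth1 α → Smooth1 β → Smooth0 (star2 gB J (wedge α β)) :=
    fun hα hβ => smooth0_star2_wedge hgB hJ hJs hα hβ
  have hd : ∀ {α : OneForm B}, Smooth1 α → Smooth0 (star2 gB J (d1 α)) :=
    fun hα => smooth0_star2_d1 hgB hJ hJs hα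
  have hδ : ∀ {α : OneForm B}, Smooth1 α → Smooth0 (delta1 gB J α) :=
    fun hα => smooth0_delta1 hgB hJ hJs hα
  have hstokes : ∀ {α : OneForm B}, Smooth1 α → ∫ x, star2 gB J (d1 α) x ∂(area gB) = 0 :=
    fun hα => stokes hgB hJ hJs hα
  have part1 : b = 2 * (inner0 gB J h (delta1 gB J σ) + inner0 gB J h' (delta1 gB J σ'))
        - inner1 gB J (fun x => actOn S σ x + star1 J σ' x)
            (fun x => star1 J (actOn S σ') x + σ x)
        - (inner0 gB J (fun x => H x * h x) h + inner0 gB J (fun x => H x * h' x) h')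
        + inner1 gB J (fun x => K x • σ x) (star1 J σ') := by
    have hpt : ∀ x, star2 gB J (bdryWedge g.inner ι η η') x =
        2 * (h x * delta1 gB J σ x + h' x * delta1 gB J σ' x) -
        star2 gB J (wedge (fun x => actOn S σ x + star1 J σ' x)
          (star1 J (fun x => star1 J (actOn S σ') x + σ x))) x -
        (H x * h x * h x + H x * h' x * h' x) +
        star2 gB J (wedge (fun x => K x • σ x) (star1 J (star1 J σ'))) x +
        star2 gB J (d1 (primitiveForm g.inner vol ι n u u')) x := by
      rw [hσe, hσe', hhe, hhe']
      exact star2_bdryWedge_eq hgs hg hvol hι hn hua hua' hη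
    -- all terms are smooth functions on a compact surface, so the integral can be split
    have i1 := hint ((Smooth0.const 2).mul ((hh.mul (hδ hσ)).add (hh'.mul (hδ hσ'))))
    have i2 := hint (hw ((hσ.act hSs).add (hσ'.star hJs))
      ((((hσ'.act hSs).star hJs).add hσ).star hJs)).neg
    have i3 := hint (((hH.mul hh).mul hh).add ((hH.mul hh').mul hh'))
    have i4 := hint (hw (hσ.smul hK) ((hσ'.star hJs).star hJs))
    have hprim := smooth_primitiveForm hgs hvol hι hn hua hua'
    have i5 := hint ((hw (hσ.smul hK) ((hσ'.star hJs).star hJs)).add (hd hprim))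
    have key := integral_add_sub_add i1 i2 i3 i5
    rw [integral_const_mul, integral_add (hint (hh.mul (hδ hσ))) (hint (hh'.mul (hδ hσ'))),
      integral_neg, integral_add (hint ((hH.mul hh).mul hh)) (hint ((hH.mul hh').mul hh')),
      integral_add i4 (hint (hd hprim)), hstokes hprim, add_zero, ← sub_eq_add_neg] at key
    change integral2 gB J (bdryWedge g.inner ι η η') = _
    rw [integral2, inner0_eq hJ, inner0_eq hJ, inner0_eq hJ, inner0_eq hJ, inner1, inner1,
      integral2, integral2, ← key]
    congr 1
    funext x
    rw [hpt]
    ring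
  refine ⟨part1, fun A h1 h2 h3 => ?_⟩
  rw [part1]
  set β := A σ with hβ
  have e0 : σ' = star1 J β := funext h3
  have e1 : star1 J σ' = fun x => - β x := by rw [e0, star1_star1 hJ]
  -- `A` is arbitrary, but `A σ` is smooth, since it is `-*σ'`
  have hβs : Smooth1 β := by
    have := (hσ'.star hJs).neg
    rw [e1] at this
    simpa only [neg_neg] using this
  have e2 : ∀ x, h x = 1 / 2 * delta1 gB J β x := fun x => by
    have := h2 x
    rw [e0] at this
    rw [delta1]
    linarith
  have e3 : ∀ x, h' x = 1 / 2 * star2 gB J (d1 σ) x := fun x => by linarith [h1 x]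
  -- `δσ' = -*d*(*β) = *dβ`
  have e4 : ∀ x, delta1 gB J σ' x = star2 gB J (d1 β) x := fun x => by
    have hneg : ∀ x, d1 (fun x => - β x) x = fun a c => - d1 β x a c := by
      intro x
      funext a c
      have h5 := d1_add hβs.neg hβs x a c
      simp only [neg_add_cancel] at h5
      have h6 := d1_smul (Smooth0.const (0 : ℝ)) hβs x a c
      simp only [zero_smul] at h6
      rw [h6] at h5
      have h7 : ∀ a : E2, d0 (fun _ : B => (0 : ℝ)) x a = 0 := fun a => by
        rw [d0_apply (Smooth0.const 0)]
        simp
      have h8 := h7 a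
      have h9 := h7 c
      rw [h8, h9] at h5
      linarith
    rw [delta1, e1, star2, star2, hneg]
    ring
  have hω : Smooth1 (fun x => delta1 gB J σ x • star1 J β x - star2 gB J (d1 σ) x • β x) :=
    ((hβs.star hJs).smul (hδ hσ)).sub (hβs.smul (hd hσ))
  have hL := star2_wedge_laplacian hJ hβs (hβs.star hJs) (hδ hσ) (hd hσ) K
  have j1 := hint ((hδ hβs).mul (hδ hσ))
  have j2 := hint ((hd hσ).mul (hd hβs))
  have j3 := hint (hK.mul (hw hβs (hσ.star hJs)))
  have j4 := hint (hd hω)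
  -- the terms that involve the shape operator agree pointwise
  have c1 : inner1 gB J (fun x => actOn S σ x + star1 J σ' x)
      (fun x => star1 J (actOn S σ') x + σ x) =
      - inner1 gB J (fun x => β x - actOn S σ x) (fun x => σ x - S' β x) := by
    rw [inner1, inner1, integral2, integral2, ← integral_neg]
    congr 1
    funext x
    obtain ⟨f1, f2, hr⟩ := hJ x
    rw [star2_inner1 hJ _ _ hr, star2_inner1 hJ _ _ hr, e1, e0]
    have k1 : ∀ a, vl (fun x => actOn S σ x + (fun x => - β x) x) x a =
        vl (actOn S σ) x a - vl β x a := fun a => (sub_eq_add_neg _ _).symm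
    have k2 : ∀ a, vl (fun x => β x - actOn S σ x) x a = vl β x a - vl (actOn S σ) x a :=
      fun a => rfl
    have k3 : ∀ a, vl (fun x => star1 J (actOn S (star1 J β)) x + σ x) x a =
        vl (star1 J (actOn S (star1 J β))) x a + vl σ x a := fun a => rfl
    have k4 : ∀ a, vl (fun x => σ x - S' β x) x a =
        vl σ x a - - vl (star1 J (actOn S (star1 J β))) x a := fun a => rfl
    simp only [k1, k2, k3, k4]
    ring
  have c2 : inner1 gB J (fun x => K x • σ x) (star1 J σ') =
      - ∫ x, K x * star2 gB J (wedge β (star1 J σ)) x ∂(area gB) := by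
    rw [inner1, integral2, ← integral_neg, e1]
    congr 1
    funext x
    obtain ⟨f1, f2, hr⟩ := hJ x
    rw [star2_inner1 hJ _ _ hr, star2_inner1 hJ _ _ hr]
    have k1 : ∀ a, vl (fun x => K x • σ x) x a = K x * vl σ x a := fun a => rfl
    have k2 : ∀ a, vl (fun x => - β x) x a = - vl β x a := fun a => rfl
    simp only [k1, k2]
    ring
  have c3 : inner1 gB J β (fun x => laplacian gB J σ x - K x • σ x) =
      (∫ x, delta1 gB J β x * delta1 gB J σ x ∂(area gB)) +
      (∫ x, star2 gB J (d1 σ) x * star2 gB J (d1 β) x ∂(area gB)) -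
      ∫ x, K x * star2 gB J (wedge β (star1 J σ)) x ∂(area gB) := by
    rw [inner1, integral2, integral_congr_ae (Filter.Eventually.of_forall hL),
      integral_add_sub_add j1 j2 j3 j4, hstokes hω, add_zero]
  have c4 : inner0 gB J h (delta1 gB J σ) =
      1 / 2 * ∫ x, delta1 gB J β x * delta1 gB J σ x ∂(area gB) := by
    rw [inner0_eq hJ, ← integral_const_mul]
    congr 1
    funext x
    rw [e2]
    ring
  have c5 : inner0 gB J h' (delta1 gB J σ') =
      1 / 2 * ∫ x, star2 gB J (d1 σ) x * star2 gB J (d1 β) x ∂(area gB) := by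
    rw [inner0_eq hJ, ← integral_const_mul]
    congr 1
    funext x
    rw [e3, e4]
    ring
  have c6 : inner0 gB J (fun x => H x * h x) h =
      1 / 4 * inner0 gB J (fun x => H x * delta1 gB J β x) (delta1 gB J β) := by
    rw [inner0_eq hJ, inner0_eq hJ, ← integral_const_mul]
    congr 1
    funext x
    rw [e2]
    ring
  have c7 : inner0 gB J (fun x => H x * h' x) h' =
      1 / 4 * inner2 gB J (fun x a c => H x * d1 σ x a c) (d1 σ) := by
    rw [inner0_eq hJ, inner2_smul_eq, ← integral_const_mul]
    congr 1
    funext x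
    rw [e3]
    ring
  rw [c1, c2, c3, c4, c5, c6, c7]
  ring
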